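/- Let $K$ be a field of characteristic $0$. A $K$-variety is a nonempty reduced separated scheme of finite type over $K$ (not necessarily irreducible), and an algebraic $K$-group is a group object $G$ in $K$-schemes whose underlying scheme is a $K$-variety (not necessarily affine). For $K$-morphisms $\varphi:X\to G$ and $\psi:Y\to G$ the convolution $\varphi*\psi:X\times Y\to G$ is $(x,y)\mapsto\varphi(x)\cdot\psi(y)$; iterating, $\varphi_1*\dots*\varphi_m:X_1\times\dots\times X_m\to G$ is $(x_1,\dots,x_m)\mapsto\varphi_1(x_1)\cdots\varphi_m(x_m)$ (for $m=0$ it is the unit section), and $\varphi^{*m}$ is the $m$-fold convolution of $\varphi$ with itself. A $K$-morphism $\varphi:X\to Y$ is strongly dominant if its base change to an algebraic closure $\overline K$ of $K$ is dominant on every irreducible component of $X_{\overline K}$. Fibers are scheme-theoretic fibers over arbitrary points of the scheme $G$. A morphism is normal if it is flat and all its fibers are geometrically normal. A scheme is regular in codimension $k$ if each of its local rings of dimension at most $k$ is regular. (A) Let $m\in\mathbb N$, let $X_1,\dots,X_m$ be smooth $K$-varieties, let $G$ be a connected algebraic $K$-group, and let $\varphi_i:X_i\to G$, $1\le i\le m$,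 be strongly dominant morphisms. Then: 1. For all $1\le i,j\le m$ the morphism $\varphi_i*\varphi_j$ is surjective. 2. If $m\ge\dim G$, then $\varphi_1*\dots*\varphi_m$ is flat. 3. If $m\ge\dim G+1$, then $\varphi_1*\dots*\varphi_m$ is flat with reduced fibers. 4. If $m\ge\dim G+2$, then $\varphi_1*\dots*\varphi_m$ is flat with (geometrically) normal fibers, i.e. it is a normal morphism. 5. If $m\ge\dim G+k$ with $k>2$, then $\varphi_1*\dots*\varphi_m$ is flat with (geometrically) normal fibers, and its fibers are regular in codimension $k-1$. (B) The bounds in 2--5 are tight in every positive dimension: for every $n\ge1$ there are a connected algebraic $K$-group $G$ of dimension $n$, a smooth $K$-variety $X$ and a strongly dominant morphism $\varphi:X\to G$ such that $\varphi^{*d}$ is not flat for any $d<n$, $\varphi^{*n}$ has a non-reduced fiber, $\varphi^{*(n+1)}$ has a non-normal fiber, and for every $k\ge0$ the morphism $\varphi^{*(n+k)}$ has a fiber that is not regular in codimension $k$. -/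

import Mathlib

open AlgebraicGeometry CategoryTheory MonoidalCategory CartesianMonoidalCategory MonObj

universe u

noncomputable section

namespace AlgConv

/-- A (not necessarily irreducible) algebraic variety over `K`: a nonempty reduced separated
scheme of finite type over `K`. -/
structure IsVariety {K : Type u} [Field K] (X : Over (Spec (.of K))) : Prop where
  nonempty : Nonempty X.left
  isReduced : IsReduced X.left
  isSeparated : IsSeparated X.hom
  locallyOfFiniteType : LocallyOfFiniteType X.hom
  quasiCompact : QuasiCompact X.hom

/-- A variety that is smooth over `K` (possibly disconnected and of varying dimension). -/
structure IsSmoothVariety {K : Type u} [Field K] (X : Over (Spec (.of K))) : Prop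
    extends IsVariety X where
  smooth : Smooth X.hom

/-- A connected algebraic group over `K`: a group object whose underlying `K`-scheme is a
connected variety. It need not be affine. -/
structure IsConnectedAlgebraicGroup {K : Type u} [Field K] (G : Over (Spec (.of K)))
    [GrpObj G] : Prop extends IsVariety G where
  connected : ConnectedSpace G.left

/-- The structure morphism `Spec K̄ ⟶ Spec K` of an algebraic closure. -/
def specClosure (K : Type u) [Field K] :
    Spec (.of (AlgebraicClosure K)) ⟶ Spec (.of K) :=
  Spec.map (CommRingCat.ofHom (algebraMap K (AlgebraicClosure K)))

/-- `φ : X ⟶ Y` is strongly dominant if it is dominant on every absolutely irreducible component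
of `X`, i.e. if the base change of `φ` to `K̄` maps every irreducible component of `X_K̄` onto a
dense subset of `Y_K̄`. -/
def StronglyDominant {K : Type u} [Field K] {X Y : Over (Spec (.of K))} (φ : X ⟶ Y) : Prop :=
  ∀ Z ∈ irreducibleComponents ((Over.pullback (specClosure K)).obj X).left,
    Dense (((Over.pullback (specClosure K)).map φ).left '' Z)

/-- The convolution `(x, y) ↦ φ x * ψ y` of two morphisms to a group. -/
def conv {K : Type u} [Field K] {G : Over (Spec (.of K))} [GrpObj G]
    {X Y : Over (Spec (.of K))} (φ : X ⟶ G) (ψ : Y ⟶ G) : X ⊗ Y ⟶ G :=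
  (φ ⊗ₘ ψ) ≫ μ[G]

/-- The product `X 0 × (X 1 × (⋯ × Spec K))` over `K`. -/
def prodFam {K : Type u} [Field K] :
    (m : ℕ) → (Fin m → Over (Spec (.of K))) → Over (Spec (.of K))
  | 0, _ => 𝟙_ _
  | m + 1, X => X 0 ⊗ prodFam m (fun i => X i.succ)

/-- The convolution `φ 0 * φ 1 * ⋯ * φ (m - 1)` of a family of morphisms to a group; the empty
convolution is the unit section. -/
def convFam {K : Type u} [Field K] {G : Over (Spec (.of K))} [GrpObj G] :
    (m : ℕ) → {X : Fin m → Over (Spec (.of K))} → ((i : Fin m) → (X i ⟶ G)) →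
      (prodFam m X ⟶ G)
  | 0, _, _ => η[G]
  | m + 1, _, φ => conv (φ 0) (convFam m (fun i => φ i.succ))

/-- The `m`-th convolution power `φ * ⋯ * φ` of a morphism to a group. -/
def convPow {K : Type u} [Field K] {G : Over (Spec (.of K))} [GrpObj G]
    {X : Over (Spec (.of K))} (φ : X ⟶ G) (m : ℕ) : prodFam m (fun _ => X) ⟶ G :=
  convFam m (fun _ => φ)

/-- A scheme is normal if all its local rings are integrally closed domains. -/
def IsNormalScheme (X : Scheme.{u}) : Prop :=
  ∀ x : X, IsDomain (X.presheaf.stalk x) ∧ IsIntegrallyClosed (X.presheaf.stalk x)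

/-- A scheme is regular in codimension `k` (Serre's condition `R_k`) if all its local rings of
dimension at most `k` are regular. -/
def IsRegularInCodim (X : Scheme.{u}) (k : ℕ) : Prop :=
  ∀ x : X, ringKrullDim (X.presheaf.stalk x) ≤ (k : WithBot ℕ∞) →
    IsRegularLocalRing (X.presheaf.stalk x)

/-- A morphism is normal if it is flat and all its scheme-theoretic fibers are geometrically
normal over the respective residue fields. -/
def IsNormalMorphism {X Y : Scheme.{u}} (f : X ⟶ Y) : Prop :=
  Flat f ∧ ∀ y : Y, geometrically IsNormalScheme (f.fiberToSpecResidueField y)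

end AlgConv

end

/-!
The convolution of two morphisms is smooth at `(x, y)` as soon as one factor is smooth at its point.
Hence the non-smooth locus of `φ₁ * ⋯ * φₘ` lies in the product of the non-smooth loci of the `φᵢ`,
each of codimension at least one by generic smoothness, and so has codimension at least `m`. Source
and target being regular, a fibre is cut out by a regular sequence wherever its dimension is the
expected one; flatness comes from the local criterion, and regularity in codimension `k` of the
fibres gives reducedness and normality through Serre's criteria, as complete intersections satisfy
every condition `Sₖ`.

The bounds are attained by the endomorphism `x ↦ (x₀², x₀² x₁, …, x₀² xₙ₋₁)` of affine space: every
coordinate of a convolution power of it lies in the square of the maximal ideal at a point of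
codimension at most the number of factors, so there the fibre has the embedding dimension of the
source but, if the power is flat, smaller dimension.
-/

namespace AlgConv

open scoped TensorProduct

/-! ### The local criterion of flatness -/

section LocalCriterion

open IsLocalRing RingTheory.Sequence

variable (B : Type u) [CommRing B] (M : Type u) [AddCommGroup M] [Module B M]

/-- The vanishing of `Tor₁(M, N)`: tensoring with `M` preserves injectivity of every submodule
inclusion with cokernel isomorphic to `N`. -/
def TorOneVanishes (N : Type u) [AddCommGroup N] [Module B N] : Prop :=
  ∀ (L : Type u) [AddCommGroup L] [Module B L] (g : L →ₗ[B] N), Function.Surjective g →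
    Function.Injective (g.ker.subtype.lTensor M)

variable {B}

lemma lTensor_comp_injective_of_exact {K E F L N : Type*} [AddCommGroup K] [Module B K]
    [AddCommGroup E] [Module B E] [AddCommGroup F] [Module B F] [AddCommGroup L] [Module B L]
    [AddCommGroup N] [Module B N] {i : K →ₗ[B] E} {j : N →ₗ[B] E} {p : E →ₗ[B] F} {q : E →ₗ[B] L}
    (hi : Function.Injective (i.lTensor M)) (hpi : p ∘ₗ i = 0) (hjq : Function.Exact j q)
    (hq : Function.Surjective q) (hpj : Function.Injective ((p ∘ₗ j).lTensor M)) :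
    Function.Injective ((q ∘ₗ i).lTensor M) := by
  rw [injective_iff_map_eq_zero] at hi hpj ⊢
  intro u hu
  rw [LinearMap.lTensor_comp, LinearMap.comp_apply] at hu
  obtain ⟨w, hw⟩ := (lTensor_exact M hjq hq _).mp hu
  have hw₀ : w = 0 := hpj w <| by
    rw [LinearMap.lTensor_comp, LinearMap.comp_apply, hw, ← LinearMap.comp_apply,
      ← LinearMap.lTensor_comp, hpi, LinearMap.lTensor_zero, LinearMap.zero_apply]
  exact hi u (by rw [← hw, hw₀, map_zero])

namespace TorOneVanishes

variable {M} {N N₁ N₂ : Type u} [AddCommGroup N] [Module B N] [AddCommGroup N₁] [Module B N₁]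
  [AddCommGroup N₂] [Module B N₂]

lemma lTensor_injective (h : TorOneVanishes B M N) {L' L : Type u} [AddCommGroup L'] [Module B L']
    [AddCommGroup L] [Module B L] {f : L' →ₗ[B] L} {g : L →ₗ[B] N} (hf : Function.Injective f)
    (hg : Function.Surjective g) (hfg : Function.Exact f g) :
    Function.Injective (f.lTensor M) := by
  let e : L' ≃ₗ[B] g.ker := LinearEquiv.ofInjective f hf ≪≫ₗ
    LinearEquiv.ofEq _ _ hfg.linearMap_ker_eq.symm
  have hfe : f = g.ker.subtype ∘ₗ e.toLinearMap := rfl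
  rw [hfe, LinearMap.lTensor_comp]
  exact (h L g hg).comp (e.lTensor M).injective

lemma of_projective [Module.Projective B N] : TorOneVanishes B M N := by
  intro L _ _ g hg
  obtain ⟨s, hs⟩ := Module.projective_lifting_property g LinearMap.id hg
  have hgs (x : N) : g (s x) = x := LinearMap.congr_fun hs x
  let r : L →ₗ[B] g.ker := (LinearMap.id - s ∘ₗ g).codRestrict _ (fun x ↦ by simp [hgs])
  have hr : r ∘ₗ g.ker.subtype = LinearMap.id := by
    ext ⟨x, hx⟩
    simp [r, LinearMap.mem_ker.mp hx]
  have hrM : r.lTensor M ∘ₗ g.ker.subtype.lTensor M = LinearMap.id := by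
    rw [← LinearMap.lTensor_comp, hr, LinearMap.lTensor_id]
  exact Function.LeftInverse.injective (g := r.lTensor M) (LinearMap.congr_fun hrM)

lemma of_linearEquiv (h : TorOneVanishes B M N) (e : N ≃ₗ[B] N₁) : TorOneVanishes B M N₁ :=
  fun _ _ _ g hg ↦ h.lTensor_injective (g := e.symm.toLinearMap ∘ₗ g)
    (Submodule.injective_subtype _) (e.symm.surjective.comp hg) fun x ↦ by simp

lemma of_extension {f : N₁ →ₗ[B] N} {g : N →ₗ[B] N₂} (hf : Function.Injective f)
    (hg : Function.Surjective g) (hfg : Function.Exact f g) (h₁ : TorOneVanishes B M N₁)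
    (h₂ : TorOneVanishes B M N₂) : TorOneVanishes B M N := by
  intro L _ _ p hp
  let L₁ : Submodule B L := (g ∘ₗ p).ker
  have hpL₁ : p.ker ≤ L₁ := LinearMap.ker_le_ker_comp p g
  let e := LinearEquiv.ofInjective f hf
  let q : L₁ →ₗ[B] N₁ := e.symm.toLinearMap ∘ₗ
    (p ∘ₗ L₁.subtype).codRestrict f.range fun x ↦ (hfg _).mp x.2
  have hq : Function.Surjective q := by
    refine e.symm.surjective.comp ?_
    rintro ⟨_, y, rfl⟩
    obtain ⟨x, hx⟩ := hp (f y)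
    have hxL₁ : g (p x) = 0 := hx ▸ (hfg _).mpr ⟨y, rfl⟩
    exact ⟨⟨x, hxL₁⟩, Subtype.ext hx⟩
  have hq_exact : Function.Exact (Submodule.inclusion hpL₁) q := fun x ↦ by
    have hqx : q x = 0 ↔ p x = 0 := by
      simp only [q, LinearMap.comp_apply, LinearEquiv.coe_coe, EmbeddingLike.map_eq_zero_iff,
        Subtype.ext_iff]
      rfl
    rw [hqx]
    exact ⟨fun hx ↦ ⟨⟨x, hx⟩, rfl⟩, by rintro ⟨y, rfl⟩; exact y.2⟩
  have hsub : p.ker.subtype = L₁.subtype ∘ₗ Submodule.inclusion hpL₁ := rfl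
  rw [hsub, LinearMap.lTensor_comp]
  exact (h₂ L (g ∘ₗ p) (hg.comp hp)).comp
    (h₁.lTensor_injective (Submodule.inclusion_injective hpL₁) hq hq_exact)

/-- `Tor₁(M, N)` can be tested on one presentation whose middle term has vanishing `Tor₁`: any
other surjection onto `N` is compared with it through the fibre product of the two. -/
lemma of_presentation {F : Type u} [AddCommGroup F] [Module B F] {f : N₁ →ₗ[B] F} {g : F →ₗ[B] N}
    (hg : Function.Surjective g) (hfg : Function.Exact f g) (hF : TorOneVanishes B M F)
    (hf : Function.Injective (f.lTensor M)) :
    TorOneVanishes B M N := by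
  intro L _ _ p hp
  let E : Submodule B (F × L) :=
    LinearMap.eqLocus (g ∘ₗ LinearMap.fst B F L) (p ∘ₗ LinearMap.snd B F L)
  have hE (x : E) : g x.1.1 = p x.1.2 := x.2
  let i : p.ker →ₗ[B] E := (LinearMap.inr B F L ∘ₗ p.ker.subtype).codRestrict E fun x ↦
    (map_zero g).trans x.2.symm
  let j : N₁ →ₗ[B] E := (LinearMap.inl B F L ∘ₗ f).codRestrict E fun x ↦
    ((hfg _).mpr ⟨x, rfl⟩).trans (map_zero p).symm
  let πF : E →ₗ[B] F := LinearMap.fst B F L ∘ₗ E.subtype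
  let πL : E →ₗ[B] L := LinearMap.snd B F L ∘ₗ E.subtype
  have hπF : Function.Surjective πF := fun x ↦ by
    obtain ⟨y, hy⟩ := hp (g x)
    exact ⟨⟨(x, y), hy.symm⟩, rfl⟩
  have hπL : Function.Surjective πL := fun y ↦ by
    obtain ⟨x, hx⟩ := hg (p y)
    exact ⟨⟨(x, y), hx⟩, rfl⟩
  have hi_inj : Function.Injective i := fun x y hxy ↦ Subtype.ext (congrArg (·.1.2) hxy)
  have hi_exact : Function.Exact i πF := fun x ↦ by
    refine ⟨fun hx ↦ ?_, by rintro ⟨y, rfl⟩; rfl⟩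
    have hx₁ : x.1.1 = 0 := hx
    exact ⟨⟨x.1.2, (hE x).symm.trans (hx₁ ▸ map_zero g)⟩, Subtype.ext (Prod.ext hx₁.symm rfl)⟩
  have hj_exact : Function.Exact j πL := fun x ↦ by
    refine ⟨fun hx ↦ ?_, by rintro ⟨y, rfl⟩; rfl⟩
    have hx₂ : x.1.2 = 0 := hx
    obtain ⟨y, hy⟩ := (hfg _).mp ((hE x).trans (hx₂ ▸ map_zero p))
    exact ⟨y, Subtype.ext (Prod.ext hy hx₂.symm)⟩
  have hπFi : πF ∘ₗ i = 0 := LinearMap.ext fun _ ↦ rfl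
  have hπFj : πF ∘ₗ j = f := LinearMap.ext fun _ ↦ rfl
  have hπLi : πL ∘ₗ i = p.ker.subtype := LinearMap.ext fun _ ↦ rfl
  rw [← hπLi]
  exact lTensor_comp_injective_of_exact M (hF.lTensor_injective hi_inj hπF hi_exact) hπFi hj_exact
    hπL (hπFj ▸ hf)

lemma of_isFiniteLength [IsLocalRing B] (h : TorOneVanishes B M (ResidueField B))
    (hN : IsFiniteLength B N) : TorOneVanishes B M N := by
  induction hN with
  | of_subsingleton => exact .of_projective
  | @of_simple_quotient N _ _ N' hs _ ih =>
    obtain ⟨I, hI, ⟨e⟩⟩ := isSimpleModule_iff_quot_maximal.mp hs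
    obtain rfl := IsLocalRing.eq_maximalIdeal hI
    exact of_extension (Submodule.injective_subtype N') (Submodule.mkQ_surjective N')
      (LinearMap.exact_subtype_mkQ N') ih (h.of_linearEquiv e.symm)

lemma quotSMulTop (h : TorOneVanishes B M N) {r : B} (hr : IsSMulRegular (M ⊗[B] N) r) :
    TorOneVanishes B M (QuotSMulTop r N) := by
  refine of_presentation (f := LinearMap.lsmul B N r) (Submodule.mkQ_surjective _) ?_ h ?_
  · rw [LinearMap.exact_iff, Submodule.ker_mkQ]
    exact Submodule.map_top _
  · have hlsmul : (LinearMap.lsmul B N r).lTensor M = LinearMap.lsmul B (M ⊗[B] N) r := by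
      ext
      simp
    rw [hlsmul]
    exact hr

lemma quotient_ofList_smul_top {rs : List B} (h : TorOneVanishes B M N)
    (hrs : IsWeaklyRegular (M ⊗[B] N) rs) :
    TorOneVanishes B M (N ⧸ (Ideal.ofList rs • ⊤ : Submodule B N)) := by
  induction rs generalizing N with
  | nil => exact h.of_linearEquiv (Submodule.quotEquivOfEqBot _ (by simp)).symm
  | cons r rs ih =>
    rw [isWeaklyRegular_cons_iff] at hrs
    refine (ih (h.quotSMulTop hrs.1) ?_).of_linearEquiv
      (Submodule.quotOfListConsSMulTopEquivQuotSMulTopInner N r rs).symm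
    exact ((QuotSMulTop.tensorQuotSMulTopEquivQuotSMulTop r M N).isWeaklyRegular_congr rs).mpr hrs.2

end TorOneVanishes

lemma lTensor_mkQ_comap_eq_zero {I Q : Ideal B} (h : TorOneVanishes B M (B ⧸ (I ⊔ Q)))
    {u : M ⊗[B] I} (hu : I.subtype.lTensor M u = 0) :
    (Submodule.mkQ (Submodule.comap I.subtype Q)).lTensor M u = 0 := by
  have hinj : Function.Injective ((I ⊔ Q).subtype.lTensor M) :=
    h.lTensor_injective (Submodule.injective_subtype _) (Submodule.mkQ_surjective _)
      (LinearMap.exact_subtype_mkQ _)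
  have hu_sup : (Submodule.inclusion (le_sup_left : I ≤ I ⊔ Q)).lTensor M u = 0 := by
    refine (injective_iff_map_eq_zero _).mp hinj _ ?_
    rwa [← LinearMap.comp_apply, ← LinearMap.lTensor_comp]
  let C := Submodule.comap I.subtype I ⊓ Submodule.comap I.subtype Q
  let e := LinearMap.quotientInfEquivSupQuotient I Q
  have hmkQ : Submodule.mkQ (Submodule.comap I.subtype Q) =
      (Submodule.factor (inf_le_right : C ≤ _) ∘ₗ e.symm.toLinearMap ∘ₗ Submodule.mkQ _) ∘ₗ
        Submodule.inclusion (le_sup_left : I ≤ I ⊔ Q) := by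
    ext x
    exact congrArg (Submodule.factor (inf_le_right : C ≤ _)) (e.symm_apply_apply (C.mkQ x)).symm
  rw [hmkQ, LinearMap.lTensor_comp, LinearMap.comp_apply, hu_sup, map_zero]

section Noetherian

variable [IsNoetherianRing B] [IsLocalRing B]

lemma TorOneVanishes.quotient_sup_pow_maximalIdeal (h : TorOneVanishes B M (ResidueField B))
    (I : Ideal B) (k : ℕ) : TorOneVanishes B M (B ⧸ (I ⊔ maximalIdeal B ^ k)) := by
  set J := I ⊔ maximalIdeal B ^ k
  by_cases hJ : J = ⊤
  · have := Submodule.Quotient.subsingleton_iff.mpr hJ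
    exact .of_projective
  refine .of_isFiniteLength h (isFiniteLength_iff_isNoetherian_isArtinian.mpr ⟨inferInstance, ?_⟩)
  have hmin : maximalIdeal B ∈ J.minimalPrimes :=
    ⟨⟨(maximalIdeal.isMaximal B).isPrime, le_maximalIdeal hJ⟩,
      fun _ hq _ ↦ hq.1.le_of_pow_le (le_sup_right.trans hq.2)⟩
  have := IsLocalRing.quotient_artinian_of_mem_minimalPrimes_of_isLocalRing J hmin
  exact isArtinian_of_surjective_algebraMap (Ideal.Quotient.mk_surjective (I := J))

lemma exists_comap_pow_maximalIdeal_le_smul_top (I : Ideal B) (j : ℕ) :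
    ∃ k, Submodule.comap I.subtype (maximalIdeal B ^ k) ≤
      (maximalIdeal B ^ j • ⊤ : Submodule B I) := by
  obtain ⟨k, hk⟩ := Ideal.exists_pow_inf_eq_pow_smul (M := B) (maximalIdeal B) I
  have hjk := hk (j + k) (Nat.le_add_left k j)
  simp only [Nat.add_sub_cancel, smul_eq_mul, Ideal.mul_top] at hjk
  refine ⟨j + k, fun c hc ↦ ?_⟩
  have hcI : (c : B) ∈ maximalIdeal B ^ j • I :=
    Ideal.mul_mono_right inf_le_right (hjk.le ⟨hc, c.2⟩)
  have hmap : maximalIdeal B ^ j • I = (maximalIdeal B ^ j • ⊤ : Submodule B I).map I.subtype := by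
    rw [Submodule.map_smul'', Submodule.map_top, Submodule.range_subtype]
  obtain ⟨d, hd, hdc⟩ := hmap ▸ hcI
  rwa [← Subtype.ext hdc]

end Noetherian

variable {A : Type*} [CommRing A] [Algebra B A] [Module A M] [IsScalarTower B A M]

lemma tmul_mem_map_smul_top {N : Type*} [AddCommGroup N] [Module B N] {J : Ideal B} (m : M)
    {x : N} (hx : x ∈ (J • ⊤ : Submodule B N)) :
    m ⊗ₜ[B] x ∈ (J.map (algebraMap B A) • ⊤ : Submodule A (M ⊗[B] N)) := by
  induction hx using Submodule.smul_induction_on' with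
  | smul r hr n _ =>
    have htmul : m ⊗ₜ[B] (r • n) = algebraMap B A r • (m ⊗ₜ[B] n) := by
      rw [TensorProduct.tmul_smul, algebraMap_smul]
    rw [htmul]
    exact Submodule.smul_mem_smul (Ideal.mem_map_of_mem _ hr) trivial
  | add x _ y _ hx hy => rw [TensorProduct.tmul_add]; exact add_mem hx hy

lemma mem_map_smul_top_of_lTensor_mkQ_eq_zero {N : Type*} [AddCommGroup N] [Module B N]
    {J : Ideal B} {u : M ⊗[B] N}
    (hu : (Submodule.mkQ (J • ⊤ : Submodule B N)).lTensor M u = 0) :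
    u ∈ (J.map (algebraMap B A) • ⊤ : Submodule A (M ⊗[B] N)) := by
  obtain ⟨v, rfl⟩ := (lTensor_exact M (LinearMap.exact_subtype_mkQ _)
    (Submodule.mkQ_surjective _) u).mp hu
  clear hu
  induction v with
  | zero => simp
  | tmul m c => exact tmul_mem_map_smul_top M m c.2
  | add x y hx hy => rw [map_add]; exact add_mem hx hy

theorem flat_of_torOneVanishes_residueField [IsNoetherianRing B] [IsLocalRing B]
    [IsNoetherianRing A] [IsLocalRing A] [IsLocalHom (algebraMap B A)] [Module.Finite A M]
    (h : TorOneVanishes B M (ResidueField B)) :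
    Module.Flat B M := by
  rw [Module.Flat.iff_lTensor_injective]
  intro I _
  rw [injective_iff_map_eq_zero]
  intro u hu
  set 𝔫 := (maximalIdeal B).map (algebraMap B A)
  have h𝔫 : 𝔫 ≠ ⊤ := fun hn ↦ (maximalIdeal.isMaximal A).ne_top
    (top_le_iff.mp (hn ▸ ((local_hom_TFAE (algebraMap B A)).out 0 2).mp ‹_›))
  have : Module.Finite A (M ⊗[B] I) :=
    .equiv (TensorProduct.AlgebraTensorModule.cancelBaseChange B A A M I)
  have hu_mem (j : ℕ) : u ∈ (𝔫 ^ j • ⊤ : Submodule A (M ⊗[B] I)) := by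
    obtain ⟨k, hk⟩ := exists_comap_pow_maximalIdeal_le_smul_top I j
    rw [← Ideal.map_pow]
    refine mem_map_smul_top_of_lTensor_mkQ_eq_zero M ?_
    rw [← Submodule.factor_comp_mk hk, LinearMap.lTensor_comp, LinearMap.comp_apply,
      lTensor_mkQ_comap_eq_zero M (h.quotient_sup_pow_maximalIdeal M I k) hu, map_zero]
  have hu_iInf : u ∈ (⨅ j, 𝔫 ^ j • ⊤ : Submodule A (M ⊗[B] I)) :=
    (Submodule.mem_iInf _).mpr hu_mem
  rwa [Ideal.iInf_pow_smul_eq_bot_of_isLocalRing 𝔫 h𝔫] at hu_iInf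

theorem flat_of_isWeaklyRegular [IsNoetherianRing B] [IsLocalRing B] [IsNoetherianRing A]
    [IsLocalRing A] [IsLocalHom (algebraMap B A)] [Module.Finite A M] {rs : List B}
    (h : IsWeaklyRegular M rs) (hrs : Ideal.ofList rs = maximalIdeal B) : Module.Flat B M := by
  have hB : TorOneVanishes B M (B ⧸ (Ideal.ofList rs • ⊤ : Ideal B)) :=
    TorOneVanishes.of_projective.quotient_ofList_smul_top
      (((TensorProduct.rid B M).isWeaklyRegular_congr rs).mpr h)
  rw [smul_eq_mul, Ideal.mul_top, hrs] at hB
  exact flat_of_torOneVanishes_residueField M (A := A) hB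

end LocalCriterion

/-! ### Regular local rings -/

section RegularLocalRing

open IsLocalRing RingTheory.Sequence

section ParameterElement

variable {A : Type*} [CommRing A] [IsLocalRing A]

lemma exists_generators_quotient_span_singleton {d : ℕ}
    (v : Fin (d + 1) → A) (hv : Ideal.span (Set.range v) = maximalIdeal A) {x : A}
    (hx : x ∈ maximalIdeal A) (hx2 : x ∉ maximalIdeal A ^ 2) :
    ∃ w : Fin d → A ⧸ Ideal.span {x},
      Ideal.span (Set.range w) = (maximalIdeal A).map (Ideal.Quotient.mk (Ideal.span {x})) := by
  have hvm (i) : v i ∈ maximalIdeal A := hv ▸ Ideal.subset_span ⟨i, rfl⟩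
  rw [← hv, Ideal.mem_span_range_iff_exists_fun] at hx
  obtain ⟨a, ha⟩ := hx
  obtain ⟨i, hi⟩ : ∃ i, IsUnit (a i) := by
    by_contra! h
    refine hx2 (ha ▸ Ideal.sum_mem _ fun i _ ↦ ?_)
    rw [pow_two]
    exact Ideal.mul_mem_mul ((mem_maximalIdeal _).mpr (h i)) (hvm i)
  let π := Ideal.Quotient.mk (Ideal.span {x})
  let w : Fin d → A ⧸ Ideal.span {x} := fun j ↦ π (v (i.succAbove j))
  have hwi : π (v i) ∈ Ideal.span (Set.range w) := by
    have hsum : π (a i) * π (v i) + ∑ k, π (a (i.succAbove k)) * w k = 0 := by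
      have hπx : π x = 0 := Ideal.Quotient.eq_zero_iff_mem.mpr (Ideal.mem_span_singleton_self x)
      simpa only [Fin.sum_univ_succAbove _ i, map_add, map_sum, map_mul, hπx] using congrArg π ha
    refine (Ideal.unit_mul_mem_iff_mem _ (hi.map π)).mp ?_
    rw [eq_neg_of_add_eq_zero_left hsum]
    exact neg_mem (Ideal.sum_mem _ fun k _ ↦ Ideal.mul_mem_left _ _ (Ideal.subset_span ⟨k, rfl⟩))
  refine ⟨w, ?_⟩
  rw [← hv, Ideal.map_span]
  refine le_antisymm (Ideal.span_mono ?_) (Ideal.span_le.mpr ?_)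
  · rintro _ ⟨j, rfl⟩
    exact ⟨_, ⟨_, rfl⟩, rfl⟩
  · rintro _ ⟨_, ⟨j, rfl⟩, rfl⟩
    obtain rfl | ⟨k, rfl⟩ := Fin.eq_self_or_eq_succAbove i j
    exacts [hwi, Ideal.subset_span ⟨k, rfl⟩]

lemma maximalIdeal_notMem_minimalPrimes (hA : 0 < ringKrullDim A) :
    maximalIdeal A ∉ minimalPrimes A := fun h ↦ by
  rw [← maximalIdeal_height_eq_ringKrullDim, Ideal.height_eq_zero_iff.mpr h] at hA
  exact lt_irrefl _ hA

variable [IsNoetherianRing A]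

lemma not_maximalIdeal_le_sq (hA : 0 < ringKrullDim A) :
    ¬ maximalIdeal A ≤ maximalIdeal A ^ 2 := fun h ↦ by
  have hbot : maximalIdeal A = ⊥ := by
    refine Submodule.eq_bot_of_le_smul_of_le_jacobson_bot (maximalIdeal A) _
      (IsNoetherian.noetherian _) ?_ (maximalIdeal_le_jacobson _)
    rwa [smul_eq_mul, ← pow_two]
  exact hA.ne' (ringKrullDim_eq_zero_of_isField (isField_iff_maximalIdeal_eq.mpr hbot))

lemma exists_mem_maximalIdeal_notMem_sq_notMem_minimalPrimes (hA : 0 < ringKrullDim A) :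
    ∃ x ∈ maximalIdeal A, x ∉ maximalIdeal A ^ 2 ∧ ∀ p ∈ minimalPrimes A, x ∉ p := by
  have hfin := minimalPrimes.finite_of_isNoetherianRing A
  by_contra! h
  have hcover : (maximalIdeal A : Set A) ⊆
      ⋃ I ∈ (↑(insert (maximalIdeal A ^ 2) hfin.toFinset) : Set (Ideal A)), (I : Set A) := by
    intro x hx
    simp only [Set.mem_iUnion]
    by_cases hx2 : x ∈ maximalIdeal A ^ 2
    · exact ⟨_, Finset.mem_coe.mpr (Finset.mem_insert_self _ _), hx2⟩
    · obtain ⟨p, hp, hxp⟩ := h x hx hx2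
      exact ⟨p, Finset.mem_coe.mpr (Finset.mem_insert_of_mem (hfin.mem_toFinset.mpr hp)), hxp⟩
  have hprime : ∀ I ∈ insert (maximalIdeal A ^ 2) hfin.toFinset,
      I ≠ maximalIdeal A ^ 2 → I ≠ maximalIdeal A ^ 2 → I.IsPrime := by
    intro I hI hne _
    rw [Finset.mem_insert, hfin.mem_toFinset] at hI
    exact (hI.resolve_left hne).1.1
  obtain ⟨I, hI, hle⟩ := (Ideal.subset_union_prime (f := fun I : Ideal A ↦ I) _ _ hprime).mp hcover
  rw [Finset.mem_insert, hfin.mem_toFinset] at hI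
  obtain rfl | hI := hI
  · exact not_maximalIdeal_le_sq hA hle
  · obtain rfl : I = maximalIdeal A := le_antisymm (le_maximalIdeal hI.1.1.ne_top) hle
    exact maximalIdeal_notMem_minimalPrimes hA hI

/-- A minimal prime `p ⊆ (x)` satisfies `p = x p`, so it vanishes by Nakayama's lemma. -/
lemma isDomain_of_isPrime_span_singleton {x : A} (hx : x ∈ maximalIdeal A)
    (hmin : ∀ p ∈ minimalPrimes A, x ∉ p) (hprime : (Ideal.span {x}).IsPrime) : IsDomain A := by
  obtain ⟨p, hp, hpx⟩ := Ideal.exists_minimalPrimes_le (bot_le : ⊥ ≤ Ideal.span {x})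
  have hp_prime := hp.1.1
  obtain rfl : p = ⊥ := by
    refine Submodule.eq_bot_of_le_smul_of_le_jacobson_bot (maximalIdeal A) _
      (IsNoetherian.noetherian _) (fun y hy ↦ ?_) (maximalIdeal_le_jacobson _)
    obtain ⟨a, rfl⟩ := Ideal.mem_span_singleton'.mp (hpx hy)
    rw [mul_comm]
    exact Submodule.smul_mem_smul hx ((hp_prime.mem_or_mem hy).resolve_right (hmin p hp))
  exact IsDomain.of_bot_isPrime A

lemma le_ringKrullDim_quotient_span_singleton {x : A} (hx : x ∈ maximalIdeal A) {d : ℕ}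
    (hd : ((d + 1 : ℕ) : WithBot ℕ∞) ≤ ringKrullDim A) :
    (d : WithBot ℕ∞) ≤ ringKrullDim (A ⧸ Ideal.span {x}) := by
  rw [← maximalIdeal_height_eq_ringKrullDim, Nat.cast_add, Nat.cast_one] at hd
  exact ENat.WithBot.add_le_add_one_right_iff.mp
    (hd.trans (Ideal.height_le_ringKrullDim_quotient_add_one hx))

end ParameterElement

section Lift

variable {A : Type*} [CommRing A] {x : A}

lemma map_out_map_algebraMap {I : Ideal A} (rs : List (A ⧸ I)) :
    (rs.map Quotient.out).map (algebraMap A (A ⧸ I)) = rs := by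
  rw [List.map_map]
  exact (List.map_congr_left fun y _ ↦ Quotient.out_eq' y).trans (List.map_id rs)

lemma ofList_cons_map_out (rs : List (A ⧸ Ideal.span {x})) :
    Ideal.ofList (x :: rs.map Quotient.out) =
      (Ideal.ofList rs).comap (Ideal.Quotient.mk (Ideal.span {x})) := by
  have hmap : (Ideal.ofList (rs.map Quotient.out)).map (Ideal.Quotient.mk (Ideal.span {x})) =
      Ideal.ofList rs := by
    rw [Ideal.map_ofList]
    exact congrArg Ideal.ofList (map_out_map_algebraMap rs)
  rw [← hmap, Ideal.comap_map_of_surjective _ Ideal.Quotient.mk_surjective, Ideal.ofList_cons,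
    sup_comm]
  exact congrArg (_ ⊔ ·) Ideal.mk_ker.symm

lemma isWeaklyRegular_cons_map_out {rs : List (A ⧸ Ideal.span {x})} (hx : IsSMulRegular A x)
    (hrs : IsWeaklyRegular (A ⧸ Ideal.span {x}) rs) :
    IsWeaklyRegular A (x :: rs.map Quotient.out) := by
  let e : QuotSMulTop x A ≃ₗ[A] A ⧸ Ideal.span {x} := Submodule.quotEquivOfEq _ _ (by
    rw [← Submodule.ideal_span_singleton_smul, smul_eq_mul, Ideal.mul_top])
  rw [isWeaklyRegular_cons_iff, e.isWeaklyRegular_congr,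
    ← isWeaklyRegular_map_algebraMap_iff (A ⧸ Ideal.span {x}), map_out_map_algebraMap]
  exact ⟨hx, hrs⟩

end Lift

lemma isDomain_and_exists_isWeaklyRegular (d : ℕ) (A : Type u) [CommRing A] [IsLocalRing A]
    [IsNoetherianRing A] (v : Fin d → A) (hv : Ideal.span (Set.range v) = maximalIdeal A)
    (hd : (d : WithBot ℕ∞) ≤ ringKrullDim A) :
    IsDomain A ∧ ∃ rs : List A, rs.length = d ∧ Ideal.ofList rs = maximalIdeal A ∧
      IsWeaklyRegular A rs := by
  induction d generalizing A with
  | zero =>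
    have hm : maximalIdeal A = ⊥ := by rw [← hv, Set.range_eq_empty, Ideal.span_empty]
    exact ⟨(isField_iff_maximalIdeal_eq.mpr hm).isDomain, [], rfl,
      by rw [hm, Ideal.ofList_nil], .nil A A⟩
  | succ d ih =>
    have hdim : (0 : WithBot ℕ∞) < ringKrullDim A :=
      lt_of_lt_of_le (by exact_mod_cast Nat.succ_pos d) hd
    obtain ⟨x, hxm, hx2, hxmin⟩ := exists_mem_maximalIdeal_notMem_sq_notMem_minimalPrimes hdim
    have hle : Ideal.span {x} ≤ maximalIdeal A := (Ideal.span_singleton_le_iff_mem _).mpr hxm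
    let π := Ideal.Quotient.mk (Ideal.span {x})
    have hπ : Function.Surjective π := Ideal.Quotient.mk_surjective
    have : Nontrivial (A ⧸ Ideal.span {x}) :=
      Ideal.Quotient.nontrivial_iff.mpr (ne_top_of_le_ne_top (maximalIdeal.isMaximal A).ne_top hle)
    have : IsLocalRing (A ⧸ Ideal.span {x}) := .of_surjective' π hπ
    have hmax : (maximalIdeal A).map π = maximalIdeal (A ⧸ Ideal.span {x}) :=
      map_maximalIdeal_of_surjective _ hπ
    obtain ⟨w, hw⟩ := exists_generators_quotient_span_singleton v hv hxm hx2
    obtain ⟨hdom, rs, hlen, hrs, hreg⟩ := ih (A ⧸ Ideal.span {x}) w (hw.trans hmax)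
      (le_ringKrullDim_quotient_span_singleton hxm hd)
    have hA : IsDomain A := isDomain_of_isPrime_span_singleton hxm hxmin
      ((Ideal.Quotient.isDomain_iff_prime _).mp hdom)
    have hx0 : x ≠ 0 := fun h ↦ hx2 (h ▸ zero_mem _)
    refine ⟨hA, x :: rs.map Quotient.out, by rw [List.length_cons, List.length_map, hlen], ?_,
      isWeaklyRegular_cons_map_out (.of_ne_zero hx0) hreg⟩
    rw [ofList_cons_map_out, hrs]
    have := hπ.isLocalHom
    exact maximalIdeal_comap π

section IsRegularLocalRing

variable (A : Type u) [CommRing A] [IsRegularLocalRing A]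

lemma exists_fin_generators_maximalIdeal :
    ∃ (d : ℕ) (v : Fin d → A), Ideal.span (Set.range v) = maximalIdeal A ∧
      (d : WithBot ℕ∞) = ringKrullDim A := by
  have hfg : (maximalIdeal A).FG := IsNoetherian.noetherian _
  have := (Submodule.FG.finite_generators hfg).to_subtype
  let e := Finite.equivFin (maximalIdeal A).generators
  refine ⟨_, fun i ↦ e.symm i, ?_, ?_⟩
  · have hrange : Set.range (fun i ↦ (e.symm i : A)) = (maximalIdeal A).generators := by
      rw [← Function.comp_def, EquivLike.range_comp, Subtype.range_coe]
    rw [hrange]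
    exact Submodule.span_generators _
  · rw [Nat.card_coe_set_eq, Submodule.FG.generators_ncard hfg]
    exact IsRegularLocalRing.spanFinrank_maximalIdeal

lemma isDomain_of_isRegularLocalRing : IsDomain A := by
  obtain ⟨d, v, hv, hd⟩ := exists_fin_generators_maximalIdeal A
  exact (isDomain_and_exists_isWeaklyRegular d A v hv hd.le).1

lemma exists_isWeaklyRegular_ofList_eq_maximalIdeal :
    ∃ rs : List A, (rs.length : WithBot ℕ∞) = ringKrullDim A ∧
      Ideal.ofList rs = maximalIdeal A ∧ IsWeaklyRegular A rs := by
  obtain ⟨d, v, hv, hd⟩ := exists_fin_generators_maximalIdeal A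
  obtain ⟨-, rs, hlen, h⟩ := isDomain_and_exists_isWeaklyRegular d A v hv hd.le
  exact ⟨rs, by rw [hlen, hd], h⟩

end IsRegularLocalRing

section Depth

open Abelian

variable {A : Type u} [CommRing A] [IsNoetherianRing A] [IsLocalRing A]

omit [IsNoetherianRing A] in
lemma smul_top_lt_top_of_le_maximalIdeal (M : Type u) [AddCommGroup M] [Module A M]
    [Module.Finite A M] [Nontrivial M] :
    maximalIdeal A • (⊤ : Submodule A M) < ⊤ := by
  rw [lt_top_iff_ne_top]
  exact Submodule.top_ne_ideal_smul_of_le_jacobson_annihilator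
    (IsLocalRing.maximalIdeal_le_jacobson _) |>.symm

lemma exists_isRegular_quotSMulTop {M : Type u} [AddCommGroup M] [Module A M] [Module.Finite A M]
    [Nontrivial M] {x : A} (hx : x ∈ maximalIdeal A) (hreg : IsSMulRegular M x) {n : ℕ}
    (h : ∃ rs : List A, rs.length = n + 1 ∧ (∀ r ∈ rs, r ∈ maximalIdeal A) ∧ IsRegular M rs) :
    ∃ rs : List A, rs.length = n ∧ (∀ r ∈ rs, r ∈ maximalIdeal A) ∧
      IsRegular (QuotSMulTop x M) rs := by
  have : Nontrivial (QuotSMulTop x M) := nontrivial_quotSMulTop_of_mem_maximalIdeal M hx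
  have h1 := ((ModuleCat.exists_isRegular_tfae (maximalIdeal A) (n + 1) (ModuleCat.of A M)
    (smul_top_lt_top_of_le_maximalIdeal M)).out 3 1).mp h
  refine ((ModuleCat.exists_isRegular_tfae (maximalIdeal A) n (ModuleCat.of A (QuotSMulTop x M))
    (smul_top_lt_top_of_le_maximalIdeal _)).out 1 3).mp fun i hi ↦ ?_
  have zero1 := AddCommGrpCat.isZero_of_iff_subsingleton.mpr (h1 i (by omega))
  have zero2 := AddCommGrpCat.isZero_of_iff_subsingleton.mpr (h1 (i + 1) (by omega))
  exact AddCommGrpCat.subsingleton_of_isZero <| ShortComplex.Exact.isZero_of_both_zeros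
    ((Ext.covariant_sequence_exact₃' _
      (IsSMulRegular.smulShortComplex_shortExact (M := ModuleCat.of A M) hreg)) i (i + 1) rfl)
    (zero1.eq_zero_of_src _) (zero2.eq_zero_of_tgt _)

lemma exists_isRegular_quotient_ofList {fs : List A} (hfs : ∀ f ∈ fs, f ∈ maximalIdeal A) {n : ℕ}
    {M : Type u} [AddCommGroup M] [Module A M] [Module.Finite A M] [Nontrivial M]
    (hreg : IsWeaklyRegular M fs)
    (h : ∃ rs : List A, rs.length = fs.length + n ∧ (∀ r ∈ rs, r ∈ maximalIdeal A) ∧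
      IsRegular M rs) :
    ∃ rs : List A, rs.length = n ∧ (∀ r ∈ rs, r ∈ maximalIdeal A) ∧
      IsRegular (M ⧸ (Ideal.ofList fs • ⊤ : Submodule A M)) rs := by
  induction fs generalizing M with
  | nil =>
    obtain ⟨rs, hl, hm, hr⟩ := h
    refine ⟨rs, by simpa using hl, hm, ?_⟩
    have e : M ≃ₗ[A] (M ⧸ (Ideal.ofList ([] : List A) • ⊤ : Submodule A M)) :=
      (Submodule.quotEquivOfEqBot _ (by simp)).symm
    exact (e.isRegular_congr rs).mp hr
  | cons f fs ih =>
    rw [isWeaklyRegular_cons_iff] at hreg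
    have hf := hfs f List.mem_cons_self
    have : Nontrivial (QuotSMulTop f M) := nontrivial_quotSMulTop_of_mem_maximalIdeal M hf
    have h' := exists_isRegular_quotSMulTop hf hreg.1 (n := fs.length + n) (by
      obtain ⟨rs, hl, h⟩ := h
      exact ⟨rs, by rw [hl, List.length_cons]; omega, h⟩)
    obtain ⟨rs, hl, hm, hr⟩ := ih (fun f hf ↦ hfs f (List.mem_cons_of_mem _ hf)) hreg.2 h'
    exact ⟨rs, hl, hm,
      ((Submodule.quotOfListConsSMulTopEquivQuotSMulTopInner M f fs).isRegular_congr rs).mpr hr⟩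

lemma not_isSMulRegular_of_mem_associatedPrimes {A M : Type*} [CommRing A] [IsNoetherianRing A]
    [AddCommGroup M] [Module A M] {Q : Ideal A} (h : Q ∈ associatedPrimes A M) {g : A}
    (hg : g ∈ Q) : ¬ IsSMulRegular M g :=
  (biUnion_associatedPrimes_eq_compl_regular A M).le (Set.mem_biUnion h hg)

lemma isSMulRegular_quotient_ofList_smul_top_iff {A : Type*} [CommRing A] {fs : List A} {g : A} :
    IsSMulRegular (A ⧸ (Ideal.ofList fs • ⊤ : Submodule A A)) g ↔
      IsSMulRegular (A ⧸ Ideal.ofList fs) g :=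
  LinearEquiv.isSMulRegular_congr (R := A) (Submodule.quotEquivOfEq _ _ (by
    rw [smul_eq_mul, Ideal.mul_top])) g

theorem ringKrullDim_le_length_of_mem_associatedPrimes {A : Type u} [CommRing A]
    [IsRegularLocalRing A] {fs : List A} (hfs : ∀ f ∈ fs, f ∈ maximalIdeal A)
    (hreg : IsWeaklyRegular A fs)
    (hass : maximalIdeal A ∈ associatedPrimes A (A ⧸ Ideal.ofList fs)) :
    ringKrullDim A ≤ fs.length := by
  by_contra! hlt
  obtain ⟨xs, hlen, hmax, hxs⟩ := exists_isWeaklyRegular_ofList_eq_maximalIdeal A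
  rw [← hlen] at hlt
  have hlt' : fs.length < xs.length := by exact_mod_cast hlt
  have hxm : ∀ r ∈ xs, r ∈ maximalIdeal A := fun r hr ↦ hmax ▸ Ideal.subset_span hr
  obtain ⟨n, hn⟩ := Nat.exists_eq_add_of_lt hlt'
  obtain ⟨rs, hl, hm, hr⟩ := exists_isRegular_quotient_ofList hfs (n := n + 1) hreg
    ⟨xs, by omega, hxm, .of_isWeaklyRegular_of_mem_maximalIdeal A hxm hxs⟩
  obtain ⟨r, rs, rfl⟩ := List.exists_cons_of_length_eq_add_one hl
  rw [isRegular_cons_iff] at hr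
  exact not_isSMulRegular_of_mem_associatedPrimes hass (hm r List.mem_cons_self)
    (isSMulRegular_quotient_ofList_smul_top_iff.mp hr.1)

end Depth

end RegularLocalRing

section SmoothRegular

open IsLocalRing

lemma isRegularLocalRing_of_flat_of_map_maximalIdeal_eq {B A : Type*} [CommRing B]
    [IsRegularLocalRing B] [CommRing A] [IsLocalRing A] [IsNoetherianRing A] [Algebra B A]
    [Module.Flat B A] (h : (maximalIdeal B).map (algebraMap B A) = maximalIdeal A) :
    IsRegularLocalRing A := by
  have : IsLocalHom (algebraMap B A) := ((local_hom_TFAE (algebraMap B A)).out 0 2).mpr h.le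
  have : (maximalIdeal A).LiesOver (maximalIdeal B) := ⟨(maximalIdeal_comap (algebraMap B A)).symm⟩
  have hdim : ringKrullDim B ≤ ringKrullDim A := by
    rw [← maximalIdeal_height_eq_ringKrullDim, ← maximalIdeal_height_eq_ringKrullDim,
      Ideal.height_eq_height_add_of_liesOver_of_hasGoingDown (maximalIdeal B) (maximalIdeal A)]
    exact_mod_cast le_self_add
  refine IsRegularLocalRing.of_spanFinrank_maximalIdeal_le _ (le_trans ?_ hdim)
  rw [← (isRegularLocalRing_iff B).mp ‹_›, Nat.cast_le, ← h]
  have hfg := (maximalIdeal B).fg_of_isNoetherianRing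
  have hfin := Submodule.FG.finite_generators hfg
  conv_lhs => rw [← (maximalIdeal B).span_generators, ← Ideal.span, Ideal.map_span]
  rw [← Submodule.FG.generators_ncard hfg]
  exact (Submodule.spanFinrank_span_le_ncard_of_finite (hfin.image _)).trans
    (Set.ncard_image_le hfin)

lemma isRegularRing_of_etale (R S : Type*) [CommRing R] [CommRing S] [Algebra R S]
    [Algebra.Etale R S] [IsRegularRing R] : IsRegularRing S := by
  have : IsNoetherianRing S := Algebra.FiniteType.isNoetherianRing R S
  refine isRegularRing_iff.mpr fun p hp ↦ ?_
  let q := p.under R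
  let := Localization.AtPrime.algebraOfLiesOver q p
  refine isRegularLocalRing_of_flat_of_map_maximalIdeal_eq (B := Localization.AtPrime q) ?_
  have : Algebra.EssFiniteType (Localization.AtPrime q) (Localization.AtPrime p) := .of_comp R _ _
  have : IsLocalHom (algebraMap (Localization.AtPrime q) (Localization.AtPrime p)) := by
    rw [Localization.AtPrime.IsLiesOverAlgebra.algebraMap_eq]
    infer_instance
  exact Algebra.FormallyUnramified.map_maximalIdeal

lemma isRegularLocalRing_localization_of_isSmoothAt (K : Type*) {S : Type*} [Field K] [CommRing S]
    [Algebra K S] [Algebra.FinitePresentation K S] (p : Ideal S) [p.IsPrime]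
    [Algebra.IsSmoothAt K p] : IsRegularLocalRing (Localization.AtPrime p) := by
  obtain ⟨f, hfp, n, _, _, _⟩ :=
    Algebra.IsSmoothAt.exists_isStandardEtale_mvPolynomial (R := K) (p := p)
  have := isRegularRing_of_etale (MvPolynomial (Fin n) K) (Localization.Away f)
  have hd : Disjoint (Submonoid.powers f : Set S) (p : Set S) :=
    (Ideal.disjoint_powers_iff_notMem_of_isPrime _).mpr hfp
  let p' := p.map (algebraMap S (Localization.Away f))
  have : p'.IsPrime := IsLocalization.isPrime_of_isPrime_disjoint (.powers f) _ _ ‹_› hd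
  have hcomap : p'.comap (algebraMap S (Localization.Away f)) = p :=
    IsLocalization.under_map_of_isPrime_disjoint (.powers f) _ ‹_› hd
  have : IsLocalization.AtPrime (Localization.AtPrime p') p := by
    simpa only [hcomap] using IsLocalization.isLocalization_isLocalization_atPrime_isLocalization
      (.powers f) (Localization.AtPrime p') p'
  exact IsRegularLocalRing.of_ringEquiv
    (IsLocalization.algEquiv p.primeCompl (Localization.AtPrime p') _).toRingEquiv

lemma isRegularRing_of_smooth (K S : Type*) [Field K] [CommRing S] [Algebra K S]
    [Algebra.Smooth K S] : IsRegularRing S := by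
  have : IsNoetherianRing S := Algebra.FiniteType.isNoetherianRing K S
  exact isRegularRing_iff.mpr fun p _ ↦ isRegularLocalRing_localization_of_isSmoothAt K p

end SmoothRegular

/-! ### Flatness between regular local rings -/

section FlatCriterion

open IsLocalRing RingTheory.Sequence

lemma maximalIdeal_mem_associatedPrimes_quotient_map {A : Type*} [CommRing A] {I Q : Ideal A}
    [Q.IsPrime] (h : Q ∈ associatedPrimes A (A ⧸ I)) :
    maximalIdeal (Localization.AtPrime Q) ∈ associatedPrimes (Localization.AtPrime Q)
      (Localization.AtPrime Q ⧸ I.map (algebraMap A (Localization.AtPrime Q))) := by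
  rw [← Ideal.localized'_eq_map (Localization.AtPrime Q) Q.primeCompl I]
  open Module.associatedPrimes in
  refine mem_associatedPrimes_of_comap_mem_associatedPrimes_of_isLocalizedModule Q.primeCompl
    (I.toLocalizedQuotient' (Localization.AtPrime Q) Q.primeCompl
      (Algebra.linearMap A (Localization.AtPrime Q))) _ ?_
  rwa [← Ideal.under_def, Localization.AtPrime.under_maximalIdeal]

lemma le_of_mem_associatedPrimes_quotient {A : Type*} [CommRing A] {I Q : Ideal A}
    (h : Q ∈ associatedPrimes A (A ⧸ I)) : I ≤ Q := by
  have hann := IsAssociatedPrime.annihilator_le h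
  rwa [Submodule.annihilator_top, Ideal.annihilator_quotient] at hann

lemma height_le_length_of_mem_associatedPrimes {A : Type u} [CommRing A] [IsRegularRing A]
    {fs : List A} (hfs : IsWeaklyRegular A fs) {Q : Ideal A} [Q.IsPrime]
    (hQ : Q ∈ associatedPrimes A (A ⧸ Ideal.ofList fs)) : Q.height ≤ fs.length := by
  have hass := maximalIdeal_mem_associatedPrimes_quotient_map hQ
  rw [Ideal.map_ofList] at hass
  have hdim := ringKrullDim_le_length_of_mem_associatedPrimes
    (List.forall_mem_map.mpr fun f hf ↦ (IsLocalization.AtPrime.to_map_mem_maximal_iff _ Q f).mpr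
      (le_of_mem_associatedPrimes_quotient hQ (Ideal.subset_span hf)))
    (hfs.of_isLocalization _ Q.primeCompl) hass
  rw [IsLocalization.AtPrime.ringKrullDim_eq_height Q, List.length_map] at hdim
  exact_mod_cast hdim

lemma isWeaklyRegular_append_singleton_iff {A : Type*} [CommRing A] {fs : List A} {g : A} :
    IsWeaklyRegular A (fs ++ [g]) ↔
      IsWeaklyRegular A fs ∧ IsSMulRegular (A ⧸ Ideal.ofList fs) g := by
  rw [isWeaklyRegular_append_iff, isWeaklyRegular_singleton_iff,
    isSMulRegular_quotient_ofList_smul_top_iff]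

lemma isWeaklyRegular_of_forall_localization {A : Type u} [CommRing A] [IsRegularRing A]
    (rs : List A) (H : ∀ (Q : Ideal A) [Q.IsPrime], Q.height < rs.length →
      IsWeaklyRegular (Localization.AtPrime Q) rs) : IsWeaklyRegular A rs := by
  induction rs using List.reverseRecOn with
  | nil => exact .nil A A
  | append_singleton fs g ih =>
    have hlen : (fs.length : ℕ∞) < (fs ++ [g]).length := by
      rw [List.length_append, List.length_singleton]
      exact_mod_cast Nat.lt_succ_self _
    have hfs : IsWeaklyRegular A fs := ih fun Q _ hQ ↦
      ((isWeaklyRegular_append_iff _ fs [g]).mp (H Q (hQ.trans hlen))).1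
    rw [isWeaklyRegular_append_singleton_iff]
    refine ⟨hfs, by_contra fun hg ↦ ?_⟩
    have hg_mem := (biUnion_associatedPrimes_eq_compl_regular A (A ⧸ Ideal.ofList fs)).ge hg
    obtain ⟨Q, hQ, hgQ⟩ := Set.mem_iUnion₂.mp hg_mem
    have hQ_prime : Q.IsPrime := hQ.1
    have hQreg := H Q ((height_le_length_of_mem_associatedPrimes hfs hQ).trans_lt hlen)
    rw [← isWeaklyRegular_map_algebraMap_iff (Localization.AtPrime Q), List.map_append,
      List.map_singleton, isWeaklyRegular_append_singleton_iff, ← Ideal.map_ofList] at hQreg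
    exact not_isSMulRegular_of_mem_associatedPrimes
      (maximalIdeal_mem_associatedPrimes_quotient_map hQ)
      ((IsLocalization.AtPrime.to_map_mem_maximal_iff _ Q g).mpr hgQ) hQreg.2

lemma isRegularRing_of_isLocalization {S : Type*} [CommRing S] [IsRegularRing S] (M : Submonoid S)
    (A : Type*) [CommRing A] [Algebra S A] [IsLocalization M A] : IsRegularRing A := by
  have : IsNoetherianRing A := IsLocalization.isNoetherianRing M A inferInstance
  refine isRegularRing_iff.mpr fun Q _ ↦ ?_
  have := IsLocalization.isLocalization_isLocalization_atPrime_isLocalization M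
    (Localization.AtPrime Q) Q
  exact IsRegularLocalRing.of_ringEquiv (IsLocalization.algEquiv
    (Q.comap (algebraMap S A)).primeCompl (Localization.AtPrime (Q.comap (algebraMap S A)))
    (Localization.AtPrime Q)).toRingEquiv

lemma flat_localization_under {R S : Type*} [CommRing R] [CommRing S] [Algebra R S]
    (M : Submonoid S) {A : Type*} [CommRing A] [Algebra S A] [IsLocalization M A] [Algebra R A]
    [IsScalarTower R S A] (Q : Ideal A) [Q.IsPrime]
    [Module.Flat R (Localization.AtPrime (Q.under S))] :
    Module.Flat R (Localization.AtPrime Q) := by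
  have := IsLocalization.isLocalization_isLocalization_atPrime_isLocalization M
    (Localization.AtPrime Q) Q
  let e := IsLocalization.algEquiv (Q.under S).primeCompl (Localization.AtPrime (Q.under S))
    (Localization.AtPrime Q)
  exact .of_linearEquiv (e.restrictScalars R).symm.toLinearEquiv

/-- The maximal ideal of each local ring of `R` is generated by at most `m` elements forming a
regular sequence, and only primes of height less than `m` can obstruct the regularity of its
image in the regular ring `S`. -/
theorem flat_of_forall_height_lt {R S : Type u} [CommRing R] [CommRing S] [Algebra R S]
    [IsRegularRing R] [IsRegularRing S] {m : ℕ} (hR : ∀ (p : Ideal R) [p.IsPrime], p.height ≤ m)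
    (H : ∀ (q : Ideal S) [q.IsPrime], q.height < m → Module.Flat R (Localization.AtPrime q)) :
    Module.Flat R S := by
  refine Module.flat_of_isLocalized_maximal (S := S) S (fun q _ ↦ Localization.AtPrime q)
    (fun q _ ↦ Algebra.linearMap S (Localization.AtPrime q)) fun q hq ↦ ?_
  let p := q.under R
  let := Localization.AtPrime.algebraOfLiesOver p q
  let B := Localization.AtPrime p
  let A := Localization.AtPrime q
  have : IsRegularRing A := isRegularRing_of_isLocalization q.primeCompl A
  have hloc : IsLocalHom (algebraMap B A) := by
    rw [Localization.AtPrime.IsLiesOverAlgebra.algebraMap_eq]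
    infer_instance
  suffices Module.Flat B A from Module.Flat.trans R B A
  obtain ⟨rs, hlen, hrs, hreg⟩ := exists_isWeaklyRegular_ofList_eq_maximalIdeal B
  rw [IsLocalization.AtPrime.ringKrullDim_eq_height p] at hlen
  have hlen_le : (rs.length : ℕ∞) ≤ m :=
    (by exact_mod_cast hlen : (rs.length : ℕ∞) = p.height) ▸ hR p
  refine flat_of_isWeaklyRegular A (A := A) ?_ hrs
  rw [← isWeaklyRegular_map_algebraMap_iff A]
  refine isWeaklyRegular_of_forall_localization _ fun Q hQ hQ_lt ↦ ?_
  rw [List.length_map] at hQ_lt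
  have := H (Q.under S) (by
    rw [IsLocalization.height_under q.primeCompl]
    exact hQ_lt.trans_le hlen_le)
  have : Module.Flat B (Localization.AtPrime Q) :=
    (Module.flat_iff_of_isLocalization B p.primeCompl _).mpr
      (flat_localization_under (S := S) q.primeCompl Q)
  have hregQ := IsWeaklyRegular.of_flat (S := Localization.AtPrime Q) hreg
  rw [isWeaklyRegular_map_algebraMap_iff] at hregQ ⊢
  exact hregQ

end FlatCriterion

/-! ### Serre's criteria and complete intersections -/

section SerreCriterion

open IsLocalRing nonZeroDivisors

lemma isReduced_of_forall_mem_associatedPrimes {T : Type*} [CommRing T] [IsNoetherianRing T]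
    (H : ∀ (P : Ideal T) [P.IsPrime], P ∈ associatedPrimes T T →
      IsReduced (Localization.AtPrime P)) : IsReduced T := by
  refine ⟨fun t ht ↦ ?_⟩
  by_contra ht0
  obtain ⟨P, hP, hle⟩ := exists_le_isAssociatedPrime_of_isNoetherianRing T t ht0
  have := hP.1
  have := H P hP
  have h0 : algebraMap T (Localization.AtPrime P) t = 0 := (ht.map (algebraMap T _)).eq_zero
  obtain ⟨s, hs⟩ := (IsLocalization.map_eq_zero_iff P.primeCompl _ t).mp h0
  exact s.2 (hle (Submodule.mem_colon_singleton.mpr hs))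

lemma dvd_of_forall_mem_associatedPrimes {T : Type*} [CommRing T] [IsNoetherianRing T] {a s : T}
    (H : ∀ (P : Ideal T) [P.IsPrime], P ∈ associatedPrimes T (T ⧸ Ideal.span {s}) →
      algebraMap T (Localization.AtPrime P) s ∣ algebraMap T (Localization.AtPrime P) a) :
    s ∣ a := by
  by_contra hdvd
  have hne : Ideal.Quotient.mk (Ideal.span {s}) a ≠ 0 := fun h0 ↦
    hdvd (Ideal.mem_span_singleton.mp (Ideal.Quotient.eq_zero_iff_mem.mp h0))
  obtain ⟨P, hP, hle⟩ := exists_le_isAssociatedPrime_of_isNoetherianRing T _ hne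
  have := hP.1
  obtain ⟨c, hc⟩ := H P hP
  obtain ⟨⟨d, u⟩, hd⟩ := IsLocalization.surj P.primeCompl c
  have hua : algebraMap T (Localization.AtPrime P) (u * a) = algebraMap T _ (s * d) := by
    rw [map_mul, map_mul, ← hd, hc]; ring
  obtain ⟨v, hv⟩ := (IsLocalization.eq_iff_exists P.primeCompl _).mp hua
  have hmem : (v * u : T) ∈ P := by
    refine hle (Submodule.mem_colon_singleton.mpr ?_)
    rw [Submodule.mem_bot, Algebra.smul_def, Ideal.Quotient.algebraMap_eq, ← map_mul,
      Ideal.Quotient.eq_zero_iff_mem, Ideal.mem_span_singleton]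
    exact ⟨v * d, by rw [_root_.mul_assoc, hv]; ring⟩
  exact (hP.1.mem_or_mem hmem).elim v.2 u.2

lemma algebraMap_dvd_algebraMap_of_isIntegral {T A : Type*} [CommRing T] [CommRing A]
    [Algebra T A] [Module.Flat T A] [IsIntegrallyClosed A] {a : T} {s : T⁰}
    (h : IsIntegral T (IsLocalization.mk' (FractionRing T) a s)) :
    algebraMap T A s ∣ algebraMap T A a := by
  have hu (y : T⁰) : IsUnit (algebraMap T (FractionRing A) y) := by
    rw [IsScalarTower.algebraMap_apply T A (FractionRing A)]
    refine IsLocalization.map_units (M := A⁰) _ ⟨algebraMap T A y, ?_⟩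
    have hy := Module.Flat.isSMulRegular_of_nonZeroDivisors (M := A) y.2
    rw [mem_nonZeroDivisors_iff_right]
    intro x hx
    refine hy.right_eq_zero_of_smul ?_
    rw [Algebra.smul_def, mul_comm, hx]
  let g : FractionRing T →ₐ[T] FractionRing A :=
    { IsLocalization.lift hu with commutes' := fun t ↦ IsLocalization.lift_eq hu t }
  obtain ⟨c, hc⟩ := (isIntegrallyClosed_iff (FractionRing A)).mp ‹_› (h.map g).tower_top
  refine ⟨c, IsFractionRing.injective A (FractionRing A) ?_⟩
  rw [map_mul, hc, ← IsScalarTower.algebraMap_apply, ← IsScalarTower.algebraMap_apply,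
    ← g.commutes, ← g.commutes, ← map_mul, IsLocalization.mk'_spec']

lemma isIntegrallyClosed_of_forall_mem_associatedPrimes {T : Type*} [CommRing T]
    [IsNoetherianRing T]
    (H : ∀ (P : Ideal T) [P.IsPrime], ∀ s ∈ T⁰, P ∈ associatedPrimes T (T ⧸ Ideal.span {s}) →
      IsIntegrallyClosed (Localization.AtPrime P)) : IsIntegrallyClosed T := by
  refine (isIntegrallyClosed_iff (FractionRing T)).mpr fun {x} hx ↦ ?_
  obtain ⟨a, s, rfl⟩ := IsLocalization.exists_mk'_eq T⁰ x
  obtain ⟨c, hc⟩ : (s : T) ∣ a := dvd_of_forall_mem_associatedPrimes fun P _ hP ↦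
    have := H P s s.2 hP
    algebraMap_dvd_algebraMap_of_isIntegral hx
  exact ⟨c, by rw [IsLocalization.eq_mk'_iff_mul_eq, ← map_mul, hc, mul_comm]⟩

lemma mem_nonZeroDivisors_of_forall_notMem_minimalPrimes {T : Type*} [CommRing T]
    [_root_.IsReduced T] {s : T} (h : ∀ p ∈ minimalPrimes T, s ∉ p) : s ∈ T⁰ := by
  rw [mem_nonZeroDivisors_iff_right]
  intro x hx
  have hnil : x ∈ nilradical T := by
    rw [nilradical, ← Ideal.sInf_minimalPrimes, Ideal.mem_sInf]
    intro p hp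
    exact (hp.1.1.mem_or_mem (hx ▸ zero_mem p)).resolve_right (h p hp)
  rwa [nilradical_eq_zero, Ideal.zero_eq_bot, Ideal.mem_bot] at hnil

lemma exists_mul_eq_zero_of_mem_minimalPrimes {T : Type*} [CommRing T] [_root_.IsReduced T]
    {p : Ideal T} (hp : p ∈ minimalPrimes T) {a : T} (ha : a ∈ p) : ∃ b ∉ p, b * a = 0 := by
  have := hp.1.1
  have hdim : Ring.KrullDimLE 0 (Localization.AtPrime p) := by
    rw [Ring.krullDimLE_iff, IsLocalization.AtPrime.ringKrullDim_eq_height p,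
      Ideal.height_eq_zero_iff.mpr hp]
    rfl
  have hbot := isField_iff_maximalIdeal_eq.mp
    (Ring.KrullDimLE.isField_of_isReduced (R := Localization.AtPrime p))
  have h0 : algebraMap T (Localization.AtPrime p) a = 0 := by
    rw [← Ideal.mem_bot, ← hbot]
    exact (IsLocalization.AtPrime.to_map_mem_maximal_iff _ p a).mpr ha
  obtain ⟨v, hv⟩ := (IsLocalization.map_eq_zero_iff p.primeCompl _ a).mp h0
  exact ⟨v, v.2, hv⟩

lemma exists_mul_eq_zero_and_add_mem_nonZeroDivisors {T : Type*} [CommRing T]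
    [IsNoetherianRing T] [_root_.IsReduced T] (a : T) : ∃ b, b * a = 0 ∧ a + b ∈ T⁰ := by
  obtain ⟨b, hba, hbp⟩ : ∃ b, b * a = 0 ∧ ∀ p ∈ minimalPrimes T, a ∈ p → b ∉ p := by
    by_contra! h
    have hfin := (minimalPrimes.finite_of_isNoetherianRing T).subset
      (Set.sep_subset (minimalPrimes T) (a ∈ ·))
    have hcover : (((⊥ : Ideal T).colon {a} : Ideal T) : Set T) ⊆
        ⋃ p ∈ (hfin.toFinset : Set (Ideal T)), (p : Set T) := by
      intro b hb
      obtain ⟨p, hp, hap, hbp⟩ := h b (by simpa [Submodule.mem_colon_singleton] using hb)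
      exact Set.mem_biUnion (by simpa using ⟨hp, hap⟩) hbp
    obtain ⟨p, hp, hle⟩ := (Ideal.subset_union_prime (f := fun I : Ideal T ↦ I) ⊥ ⊥
      fun p hp _ _ ↦ (hfin.mem_toFinset.mp hp).1.1.1).mp hcover
    rw [Set.Finite.mem_toFinset] at hp
    obtain ⟨b, hbp, hba⟩ := exists_mul_eq_zero_of_mem_minimalPrimes hp.1 hp.2
    exact hbp (hle (by simpa [Submodule.mem_colon_singleton] using hba))
  refine ⟨b, hba, mem_nonZeroDivisors_of_forall_notMem_minimalPrimes fun p hp hab ↦ ?_⟩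
  by_cases hap : a ∈ p
  · exact hbp p hp hap ((Ideal.add_mem_iff_right p hap).mp hab)
  · have hb := (hp.1.1.mem_or_mem (hba ▸ zero_mem p)).resolve_right hap
    exact hap ((Ideal.add_mem_iff_left p hb).mp hab)

lemma isDomain_of_isIntegrallyClosed (T : Type*) [CommRing T] [IsNoetherianRing T]
    [IsLocalRing T] [_root_.IsReduced T] [IsIntegrallyClosed T] : IsDomain T := by
  refine @NoZeroDivisors.to_isDomain T _ _ ⟨fun {a c} hac ↦ ?_⟩
  obtain ⟨b, hba, hs⟩ := exists_mul_eq_zero_and_add_mem_nonZeroDivisors a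
  -- `a / (a + b)` is an idempotent of the total ring of fractions
  have hint : IsIntegral T (IsLocalization.mk' (FractionRing T) a ⟨a + b, hs⟩) := by
    refine ⟨Polynomial.X ^ 2 - Polynomial.X, Polynomial.monic_X_pow_sub (by simp), ?_⟩
    rw [Polynomial.eval₂_sub, Polynomial.eval₂_pow, Polynomial.eval₂_X, sub_eq_zero, pow_two,
      ← IsLocalization.mk'_mul, IsLocalization.mk'_eq_iff_eq]
    congr 1
    simp only [Submonoid.coe_mul]
    linear_combination (-(a + b)) * hba
  obtain ⟨e, he⟩ : a + b ∣ a := algebraMap_dvd_algebraMap_of_isIntegral (A := T) hint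
  have hee : e * (1 - e) = 0 := by
    rw [← mul_right_mem_nonZeroDivisors_eq_zero_iff (mul_mem hs hs)]
    linear_combination (-(a + b) + a + (a + b) * e) * he + hba
  rcases IsLocalRing.isUnit_or_isUnit_one_sub_self e with hu | hu
  · have h1 : e = 1 := (sub_eq_zero.mp (hu.mul_right_eq_zero.mp hee)).symm
    have hb0 : b = 0 := by rwa [h1, _root_.mul_one, eq_comm, add_eq_left] at he
    rw [hb0, add_zero] at hs
    exact .inr ((mul_left_mem_nonZeroDivisors_eq_zero_iff hs).mp hac)
  · rw [hu.mul_left_eq_zero.mp hee, mul_zero] at he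
    exact .inl he

end SerreCriterion

section CompleteIntersection

open IsLocalRing nonZeroDivisors RingTheory.Sequence

/-- A ring is a (local) complete intersection if it is the quotient of a regular local ring by a
regular sequence. -/
def IsLocalCompleteIntersection (T : Type u) [CommRing T] : Prop :=
  ∃ (A : Type u) (_ : CommRing A) (_ : IsRegularLocalRing A) (_ : Algebra A T) (fs : List A),
    (∀ f ∈ fs, f ∈ maximalIdeal A) ∧ IsWeaklyRegular A fs ∧
    Function.Surjective (algebraMap A T) ∧ RingHom.ker (algebraMap A T) = Ideal.ofList fs

lemma IsLocalCompleteIntersection.of_ringEquiv {T T' : Type u} [CommRing T] [CommRing T']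
    (e : T ≃+* T') (h : IsLocalCompleteIntersection T) : IsLocalCompleteIntersection T' := by
  obtain ⟨A, _, _, _, fs, hfs, hreg, hsurj, hker⟩ := h
  refine ⟨A, _, ‹_›, (e.toRingHom.comp (algebraMap A T)).toAlgebra, fs, hfs, hreg,
    e.surjective.comp hsurj, ?_⟩
  rw [RingHom.algebraMap_toAlgebra, ← hker]
  ext x
  simp [RingHom.mem_ker]

lemma comap_algebraMap_ofList_map {A T : Type*} [CommRing A] [CommRing T] [Algebra A T]
    (hsurj : Function.Surjective (algebraMap A T)) {fs : List A}
    (hker : RingHom.ker (algebraMap A T) = Ideal.ofList fs) (hs : List A) :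
    (Ideal.ofList (hs.map (algebraMap A T))).comap (algebraMap A T) =
      Ideal.ofList (fs ++ hs) := by
  rw [← Ideal.map_ofList, Ideal.comap_map_of_surjective' _ hsurj, hker, Ideal.ofList_append,
    sup_comm]

lemma isWeaklyRegular_append_of_surjective {A T : Type*} [CommRing A] [CommRing T] [Algebra A T]
    (hsurj : Function.Surjective (algebraMap A T)) {fs : List A}
    (hker : RingHom.ker (algebraMap A T) = Ideal.ofList fs) {hs : List A}
    (hfs : IsWeaklyRegular A fs) (hhs : IsWeaklyRegular T (hs.map (algebraMap A T))) :
    IsWeaklyRegular A (fs ++ hs) := by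
  rw [isWeaklyRegular_append_iff]
  let e : (A ⧸ (Ideal.ofList fs • ⊤ : Submodule A A)) ≃ₗ[A] T :=
    (Submodule.quotEquivOfEq _ (LinearMap.ker (Algebra.linearMap A T))
      (by rw [smul_eq_mul, Ideal.mul_top, ← hker]; rfl)).trans
      (LinearMap.quotKerEquivOfSurjective (Algebra.linearMap A T) hsurj)
  rw [isWeaklyRegular_map_algebraMap_iff] at hhs
  exact ⟨hfs, (e.isWeaklyRegular_congr hs).mpr hhs⟩

lemma comap_mem_associatedPrimes_quotient {A T : Type*} [CommRing A] [CommRing T]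
    [IsNoetherianRing A] {f : A →+* T} (hf : Function.Surjective f) {I Q : Ideal T}
    (hQ : Q ∈ associatedPrimes T (T ⧸ I)) :
    Q.comap f ∈ associatedPrimes A (A ⧸ I.comap f) := by
  have := isNoetherianRing_of_surjective A T f hf
  obtain ⟨hprime, z, hz⟩ := isAssociatedPrime_iff.mp hQ
  obtain ⟨t, rfl⟩ := Ideal.Quotient.mk_surjective z
  obtain ⟨a, rfl⟩ := hf t
  refine isAssociatedPrime_iff.mpr ⟨hprime.comap f, Ideal.Quotient.mk _ a, ?_⟩
  ext r
  simp only [Ideal.mem_comap, hz, Submodule.mem_colon_singleton, Submodule.mem_bot,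
    Algebra.smul_def, Ideal.Quotient.algebraMap_eq, ← map_mul, Ideal.Quotient.eq_zero_iff_mem]

lemma IsLocalCompleteIntersection.ringKrullDim_le_length {T : Type u} [CommRing T] [IsLocalRing T]
    (h : IsLocalCompleteIntersection T) {gs : List T} (hgs : ∀ g ∈ gs, g ∈ maximalIdeal T)
    (hreg : IsWeaklyRegular T gs)
    (hass : maximalIdeal T ∈ associatedPrimes T (T ⧸ Ideal.ofList gs)) :
    ringKrullDim T ≤ gs.length := by
  obtain ⟨A, _, _, _, fs, hfs, hfsreg, hsurj, hker⟩ := h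
  have hloc : IsLocalHom (algebraMap A T) := hsurj.isLocalHom _
  obtain ⟨hs, rfl⟩ : ∃ hs : List A, hs.map (algebraMap A T) = gs := hsurj.list_map gs
  have hcomap := comap_algebraMap_ofList_map hsurj hker hs
  have hmem : ∀ f ∈ fs ++ hs, f ∈ maximalIdeal A := by
    intro f hf
    rcases List.mem_append.mp hf with hf | hf
    · exact hfs f hf
    · have := hgs _ (List.mem_map_of_mem hf)
      rwa [← Ideal.mem_comap, maximalIdeal_comap] at this
  have hassA : maximalIdeal A ∈ associatedPrimes A (A ⧸ Ideal.ofList (fs ++ hs)) := by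
    rw [← hcomap, ← maximalIdeal_comap (algebraMap A T)]
    exact comap_mem_associatedPrimes_quotient hsurj hass
  have hle := ringKrullDim_le_length_of_mem_associatedPrimes hmem
    (isWeaklyRegular_append_of_surjective hsurj hker hfsreg hreg) hassA
  have hdim := ringKrullDim_add_length_eq_ringKrullDim_of_isRegular fs
    (.of_isWeaklyRegular_of_mem_maximalIdeal A hfs hfsreg)
  rw [ringKrullDim_eq_of_ringEquiv ((Ideal.quotEquivOfEq hker.symm).trans
    (RingHom.quotientKerEquivOfSurjective hsurj))] at hdim
  rw [← hdim, List.length_append, Nat.cast_add, add_comm] at hle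
  rw [List.length_map]
  exact ENat.WithBot.add_le_add_natCast_left_iff.mp hle

lemma isIntegrallyClosed_of_ringKrullDim_le_one {T : Type*} [CommRing T] [IsRegularLocalRing T]
    (h : ringKrullDim T ≤ 1) : IsIntegrallyClosed T := by
  have hd := isDomain_of_isRegularLocalRing T
  have hfin := (IsRegularLocalRing.iff_finrank_cotangentSpace T).mp ‹_›
  rw [← hfin] at h
  have h1 : Module.finrank (ResidueField T) (CotangentSpace T) ≤ 1 := by exact_mod_cast h
  have : IsPrincipalIdealRing T :=
    ((tfae_of_isNoetherianRing_of_isLocalRing_of_isDomain T).out 5 0).mp h1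
  infer_instance

section

variable {T : Type u} [CommRing T]
  (hci : ∀ (P : Ideal T) [P.IsPrime], IsLocalCompleteIntersection (Localization.AtPrime P))

include hci

lemma ringKrullDim_localization_le_of_mem_associatedPrimes {P : Ideal T} [P.IsPrime] {gs : List T}
    (hreg : IsWeaklyRegular T gs) (hass : P ∈ associatedPrimes T (T ⧸ Ideal.ofList gs)) :
    ringKrullDim (Localization.AtPrime P) ≤ gs.length := by
  have hassP := maximalIdeal_mem_associatedPrimes_quotient_map hass
  rw [Ideal.map_ofList] at hassP
  have hmem : ∀ g ∈ gs.map (algebraMap T (Localization.AtPrime P)), g ∈ maximalIdeal _ := by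
    intro g hg
    obtain ⟨g, hg', rfl⟩ := List.mem_map.mp hg
    exact (IsLocalization.AtPrime.to_map_mem_maximal_iff _ P g).mpr
      (le_of_mem_associatedPrimes_quotient hass (Ideal.subset_span hg'))
  have hle := (hci P).ringKrullDim_le_length hmem (hreg.of_isLocalization _ P.primeCompl) hassP
  rwa [List.length_map] at hle

variable [IsNoetherianRing T]

theorem isReduced_of_regular_codim_zero
    (hR : ∀ (P : Ideal T) [P.IsPrime], ringKrullDim (Localization.AtPrime P) ≤ 0 →
      IsRegularLocalRing (Localization.AtPrime P)) : _root_.IsReduced T := by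
  refine isReduced_of_forall_mem_associatedPrimes fun P _ hP ↦ ?_
  have hP' : P ∈ associatedPrimes T (T ⧸ Ideal.ofList ([] : List T)) := by
    refine (LinearEquiv.isAssociatedPrime_iff ?_).mp hP
    exact (Submodule.quotEquivOfEqBot _ (by simp)).symm
  have hdim := ringKrullDim_localization_le_of_mem_associatedPrimes hci (.nil T T) hP'
  have := hR P (by simpa using hdim)
  have := isDomain_of_isRegularLocalRing (Localization.AtPrime P)
  infer_instance

theorem isDomain_and_isIntegrallyClosed_of_regular_codim_one [IsLocalRing T]
    (hR : ∀ (P : Ideal T) [P.IsPrime], ringKrullDim (Localization.AtPrime P) ≤ 1 →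
      IsRegularLocalRing (Localization.AtPrime P)) : IsDomain T ∧ IsIntegrallyClosed T := by
  have := isReduced_of_regular_codim_zero hci fun P _ h ↦ hR P (h.trans zero_le_one)
  suffices IsIntegrallyClosed T from ⟨isDomain_of_isIntegrallyClosed T, this⟩
  refine isIntegrallyClosed_of_forall_mem_associatedPrimes fun P _ s hs hP ↦ ?_
  rw [← Ideal.ofList_singleton] at hP
  have h1 : ringKrullDim (Localization.AtPrime P) ≤ 1 := by
    refine (ringKrullDim_localization_le_of_mem_associatedPrimes hci ?_ hP).trans (by simp)
    rw [isWeaklyRegular_singleton_iff]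
    exact (isRegular_iff_mem_nonZeroDivisors.mpr hs).left.isSMulRegular
  have := hR P h1
  exact isIntegrallyClosed_of_ringKrullDim_le_one h1

end

lemma ker_algebraMap_localization_under_eq_map {S T : Type*} [CommRing S] [CommRing T] [Algebra S T]
    (hsurj : Function.Surjective (algebraMap S T)) (P : Ideal T) [P.IsPrime]
    [Algebra (Localization.AtPrime (P.under S)) (Localization.AtPrime P)]
    [IsScalarTower S (Localization.AtPrime (P.under S)) (Localization.AtPrime P)] :
    RingHom.ker (algebraMap (Localization.AtPrime (P.under S)) (Localization.AtPrime P)) =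
      (RingHom.ker (algebraMap S T)).map (algebraMap S (Localization.AtPrime (P.under S))) := by
  ext x
  obtain ⟨a, u, rfl⟩ := IsLocalization.exists_mk'_eq (P.under S).primeCompl x
  rw [IsLocalization.mk'_mem_iff, IsLocalization.mk'_mem_iff, RingHom.mem_ker,
    ← IsScalarTower.algebraMap_apply, IsScalarTower.algebraMap_apply S T,
    IsLocalization.map_eq_zero_iff P.primeCompl,
    IsLocalization.algebraMap_mem_map_algebraMap_iff (P.under S).primeCompl]
  constructor
  · rintro ⟨⟨v, hv⟩, h⟩
    obtain ⟨v, rfl⟩ := hsurj v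
    exact ⟨v, hv, by rw [RingHom.mem_ker, map_mul, h]⟩
  · rintro ⟨v, hv, h⟩
    exact ⟨⟨algebraMap S T v, hv⟩, by rwa [RingHom.mem_ker, map_mul] at h⟩

lemma isLocalCompleteIntersection_localization {R S T : Type u} [CommRing R] [CommRing S]
    [CommRing T] [Algebra R S] [Algebra S T] [IsRegularRing R] [IsRegularRing S] [Module.Flat R S]
    (𝔪 : Ideal R) [𝔪.IsMaximal] (hsurj : Function.Surjective (algebraMap S T))
    (hker : RingHom.ker (algebraMap S T) = 𝔪.map (algebraMap R S)) (P : Ideal T) [P.IsPrime] :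
    IsLocalCompleteIntersection (Localization.AtPrime P) := by
  let q := P.under S
  have hq : 𝔪.map (algebraMap R S) ≤ q := by
    rw [← hker]
    intro x hx
    rw [Ideal.mem_comap, RingHom.mem_ker.mp hx]
    exact zero_mem P
  have hover : q.LiesOver 𝔪 := ⟨(Ideal.IsMaximal.eq_of_le ‹_› (Ideal.IsPrime.ne_top inferInstance)
    (Ideal.map_le_iff_le_comap.mp hq))⟩
  let B := Localization.AtPrime 𝔪
  let A := Localization.AtPrime q
  let := Localization.AtPrime.algebraOfLiesOver 𝔪 q
  let := Localization.AtPrime.algebraOfLiesOver q P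
  have hlocBA : IsLocalHom (algebraMap B A) := by
    rw [Localization.AtPrime.IsLiesOverAlgebra.algebraMap_eq]
    infer_instance
  obtain ⟨rs, -, hrs, hreg⟩ := exists_isWeaklyRegular_ofList_eq_maximalIdeal B
  refine ⟨A, inferInstance, inferInstance, inferInstance, rs.map (algebraMap B A), ?_,
    hreg.of_flat, ?_, ?_⟩
  · intro f hf
    obtain ⟨g, hg, rfl⟩ := List.mem_map.mp hf
    have hgB : g ∈ maximalIdeal B := hrs ▸ Ideal.subset_span hg
    rwa [← maximalIdeal_comap (algebraMap B A)] at hgB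
  · rw [Localization.AtPrime.IsLiesOverAlgebra.algebraMap_eq]
    exact RingHom.surjective_localRingHom_of_surjective (algebraMap S T) hsurj P
  · have hmap : Ideal.ofList (rs.map (algebraMap B A)) =
        (𝔪.map (algebraMap R S)).map (algebraMap S A) := by
      rw [← Ideal.map_ofList, hrs, ← Localization.AtPrime.map_eq_maximalIdeal, Ideal.map_map,
        Ideal.map_map, ← IsScalarTower.algebraMap_eq, ← IsScalarTower.algebraMap_eq]
    rw [hmap, ker_algebraMap_localization_under_eq_map hsurj, hker]

end CompleteIntersection

/-! ### Fibres of morphisms of smooth schemes -/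

section Fibres

open IsLocalRing

variable {R S L : Type u} [CommRing R] [CommRing S] [Field L] [Algebra R S] [Algebra R L]

lemma flat_of_faithfulSMul (B L : Type*) [CommRing B] [Field L] [Algebra B L] [FaithfulSMul B L] :
    Module.Flat B L := by
  have : IsDomain B := (FaithfulSMul.algebraMap_injective B L).isDomain
  let : Algebra (FractionRing B) L := FractionRing.liftAlgebra B L
  exact Module.Flat.trans B (FractionRing B) L

lemma exists_flat_ringHom_quotient_map_ker :
    ∃ j : S ⧸ (RingHom.ker (algebraMap R L)).map (algebraMap R S) →+* L ⊗[R] S,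
      j.Flat ∧ j.comp (Ideal.Quotient.mk _) =
        (Algebra.TensorProduct.includeRight : S →ₐ[R] L ⊗[R] S).toRingHom := by
  let p := RingHom.ker (algebraMap R L)
  let κ : R ⧸ p →ₐ[R] L := Ideal.Quotient.liftₐ p (Algebra.ofId R L) fun _ hx ↦ hx
  have hκ : κ.Flat := by
    let : Algebra (R ⧸ p) L := κ.toRingHom.toAlgebra
    have : FaithfulSMul (R ⧸ p) L :=
      (faithfulSMul_iff_algebraMap_injective _ _).mpr (RingHom.kerLift_injective _)
    exact flat_of_faithfulSMul (R ⧸ p) L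
  let e := Algebra.TensorProduct.quotIdealMapEquivTensorQuot S p
  refine ⟨((Algebra.TensorProduct.comm R S L).toRingEquiv.toRingHom.comp
    (Algebra.TensorProduct.lTensor (S := R) S κ).toRingHom).comp e.toRingEquiv.toRingHom,
    .comp (.of_bijective e.bijective) (.comp (RingHom.Flat.lTensor (S := R) S hκ)
      (.of_bijective (AlgEquiv.bijective _))), ?_⟩
  ext s
  have hs : e (Ideal.Quotient.mk _ s) = s ⊗ₜ[R] 1 :=
    Algebra.TensorProduct.quotIdealMapEquivTensorQuot_mk S p s
  change Algebra.TensorProduct.comm R S L (Algebra.TensorProduct.lTensor S κ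
    (e (Ideal.Quotient.mk _ s))) = _
  rw [hs]
  simp

lemma under_comap_includeRight_eq_ker (P : Ideal (L ⊗[R] S)) [P.IsPrime] :
    (P.comap (Algebra.TensorProduct.includeRight : S →ₐ[R] L ⊗[R] S)).under R =
      RingHom.ker (algebraMap R L) := by
  have hbot : P.comap (algebraMap L (L ⊗[R] S)) = ⊥ := Ideal.eq_bot_of_prime _
  ext x
  have hx : (Algebra.TensorProduct.includeRight : S →ₐ[R] L ⊗[R] S) (algebraMap R S x) =
      algebraMap L (L ⊗[R] S) (algebraMap R L x) := by
    rw [AlgHom.commutes, ← IsScalarTower.algebraMap_apply]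
  rw [RingHom.mem_ker, ← Ideal.mem_bot, ← hbot, Ideal.mem_comap, Ideal.mem_comap, Ideal.mem_comap,
    hx]

lemma height_comap_le_of_flat {A B : Type*} [CommRing A] [CommRing B] [IsNoetherianRing A]
    [IsNoetherianRing B] {f : A →+* B} (hf : f.Flat) (P : Ideal B) [P.IsPrime] :
    (P.comap f).height ≤ P.height := by
  let := f.toAlgebra
  have : Module.Flat A B := hf
  have h := Ideal.height_eq_height_add_of_liesOver_of_hasGoingDown (P.under A) P
  exact le_self_add.trans_eq h.symm

lemma height_comap_includeRight_le [IsNoetherianRing R] [IsNoetherianRing S]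
    [IsNoetherianRing (L ⊗[R] S)] {n : ℕ∞} (hn : ∀ (p : Ideal R) [p.IsPrime], p.height ≤ n)
    (P : Ideal (L ⊗[R] S)) [P.IsPrime] :
    (P.comap (Algebra.TensorProduct.includeRight : S →ₐ[R] L ⊗[R] S)).height ≤ n + P.height := by
  let q := P.comap (Algebra.TensorProduct.includeRight : S →ₐ[R] L ⊗[R] S)
  have hquot := exists_flat_ringHom_quotient_map_ker (R := R) (S := S) (L := L)
  rw [← under_comap_includeRight_eq_ker P] at hquot
  obtain ⟨j, hj, hjmk⟩ := hquot
  have hq : q.map (Ideal.Quotient.mk ((q.under R).map (algebraMap R S))) = P.comap j := by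
    rw [← Ideal.map_comap_of_surjective _ Ideal.Quotient.mk_surjective (P.comap j),
      Ideal.comap_comap, hjmk]
    rfl
  calc q.height ≤ (q.under R).height + (q.map (Ideal.Quotient.mk _)).height :=
        Ideal.height_le_height_add_of_liesOver (q.under R) q
    _ ≤ n + P.height := add_le_add (hn _) (hq ▸ height_comap_le_of_flat hj P)

lemma isSmoothAt_baseChange [Algebra.FinitePresentation R S] (P : Ideal (L ⊗[R] S)) [P.IsPrime]
    [Algebra.IsSmoothAt R (P.comap (Algebra.TensorProduct.includeRight : S →ₐ[R] L ⊗[R] S))] :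
    Algebra.IsSmoothAt L P := by
  obtain ⟨f, hf, hsm⟩ := Algebra.IsSmoothAt.exists_notMem_smooth (R := R)
    (P.comap (Algebra.TensorProduct.includeRight : S →ₐ[R] L ⊗[R] S))
  let Sf := Localization.Away f
  let φ : L ⊗[R] S →ₐ[L] L ⊗[R] Sf :=
    Algebra.TensorProduct.lTensor (S := L) L (IsScalarTower.toAlgHom R S Sf)
  let := φ.toRingHom.toAlgebra
  have : IsScalarTower L (L ⊗[R] S) (L ⊗[R] Sf) := .of_algebraMap_eq' φ.comp_algebraMap.symm
  have hloc := IsLocalization.tensorProduct_tensorProduct_right R L (.powers f) Sf (by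
    ext s
    change φ (1 ⊗ₜ s) = 1 ⊗ₜ algebraMap S Sf s
    simp [φ])
  rw [Submonoid.map_powers] at hloc
  let g : L ⊗[R] S := 1 ⊗ₜ f
  have hloc' : IsLocalization.Away g (L ⊗[R] Sf) := hloc
  have : Algebra.Smooth L (Localization.Away g) :=
    .of_equiv ((IsLocalization.algEquiv (.powers g) (L ⊗[R] Sf)
      (Localization.Away g)).restrictScalars L)
  exact Algebra.basicOpen_subset_smoothLocus_iff_smooth.mpr this
    (show (⟨P, ‹_›⟩ : PrimeSpectrum _) ∈ PrimeSpectrum.basicOpen g from hf)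

theorem isRegularLocalRing_localization_tensorProduct [IsNoetherianRing R]
    [Algebra.FinitePresentation R S] {n m : ℕ∞} (hn : ∀ (p : Ideal R) [p.IsPrime], p.height ≤ n)
    (H : ∀ (q : Ideal S) [q.IsPrime], q.height < m → Algebra.IsSmoothAt R q)
    (P : Ideal (L ⊗[R] S)) [P.IsPrime] (hP : n + P.height < m) :
    IsRegularLocalRing (Localization.AtPrime P) := by
  have : IsNoetherianRing S := Algebra.FiniteType.isNoetherianRing R S
  have : IsNoetherianRing (L ⊗[R] S) := Algebra.FiniteType.isNoetherianRing L _
  have := H _ ((height_comap_includeRight_le hn P).trans_lt hP)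
  have := isSmoothAt_baseChange P
  exact isRegularLocalRing_localization_of_isSmoothAt L P

variable (K : Type u) [Field K] [Algebra K R] [Algebra K S] [Algebra K L] [IsScalarTower K R S]
  [IsScalarTower K R L]

-- The fibre `L ⊗[R] S` of `R → S` is also the fibre of the flat map `R ⊗[K] L → S ⊗[K] L` of
-- regular rings over the `L`-rational point `R ⊗[K] L → L`, whose maximal ideal is locally
-- generated by a regular sequence.
theorem isLocalCompleteIntersection_localization_tensorProduct [Algebra.Smooth K R]
    [Algebra.Smooth K S] [Module.Flat R S] (P : Ideal (L ⊗[R] S)) [P.IsPrime] :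
    IsLocalCompleteIntersection (Localization.AtPrime P) := by
  let R' := R ⊗[K] L
  let S' := R' ⊗[R] S
  have := isRegularRing_of_smooth L (L ⊗[K] R)
  have := isRegularRing_of_smooth L (L ⊗[K] S)
  have : IsRegularRing R' := .of_ringEquiv (Algebra.TensorProduct.comm K L R).toRingEquiv
  have : IsRegularRing S' := .of_ringEquiv ((Algebra.TensorProduct.comm K L S).toRingEquiv.trans
    ((Algebra.TensorProduct.cancelBaseChange K R R S L).symm.toRingEquiv.trans
      (Algebra.TensorProduct.comm R S R').toRingEquiv))
  let f : R' →ₐ[R] L := Algebra.TensorProduct.lift (Algebra.ofId R L) (AlgHom.id K L)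
    fun _ _ ↦ Commute.all _ _
  have hf : Function.Surjective f := fun l ↦ ⟨1 ⊗ₜ l, by
    rw [Algebra.TensorProduct.lift_tmul, map_one, _root_.one_mul, AlgHom.id_apply]⟩
  have : (RingHom.ker f).IsMaximal := RingHom.ker_isMaximal_of_surjective f.toRingHom hf
  let g : S' →ₐ[R] L ⊗[R] S := Algebra.TensorProduct.map f (AlgHom.id R S)
  let := g.toRingHom.toAlgebra
  refine isLocalCompleteIntersection_localization (R := R') (S := S') (RingHom.ker f) ?_ ?_ P
  · exact Algebra.TensorProduct.map_surjective _ _ hf Function.surjective_id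
  · exact Algebra.TensorProduct.rTensor_ker f hf

end Fibres

section Charts

open IsLocalRing
lemma flat_localization_of_isSmoothAt (R : Type*) {S : Type*} [CommRing R] [CommRing S]
    [Algebra R S] [Algebra.FinitePresentation R S] (q : Ideal S) [q.IsPrime]
    [Algebra.IsSmoothAt R q] : Module.Flat R (Localization.AtPrime q) := by
  obtain ⟨f, hf, hsm⟩ := Algebra.IsSmoothAt.exists_notMem_smooth (R := R) q
  have hle : Submonoid.powers f ≤ q.primeCompl := by
    rw [Submonoid.powers_le]
    exact hf
  let := IsLocalization.localizationAlgebraOfSubmonoidLe (Localization.Away f)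
    (Localization.AtPrime q) (.powers f) q.primeCompl hle
  have := IsLocalization.localization_isScalarTower_of_submonoid_le (Localization.Away f)
    (Localization.AtPrime q) (.powers f) q.primeCompl hle
  have := IsLocalization.isLocalization_of_submonoid_le (Localization.Away f)
    (Localization.AtPrime q) (.powers f) q.primeCompl hle
  have : Module.Flat (Localization.Away f) (Localization.AtPrime q) :=
    IsLocalization.flat _ (q.primeCompl.map (algebraMap S (Localization.Away f)))
  have : IsScalarTower R (Localization.Away f) (Localization.AtPrime q) :=
    .of_algebraMap_eq' (by
      rw [IsScalarTower.algebraMap_eq R S (Localization.AtPrime q),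
        IsScalarTower.algebraMap_eq S (Localization.Away f) (Localization.AtPrime q),
        RingHom.comp_assoc, ← IsScalarTower.algebraMap_eq])
  exact Module.Flat.trans R (Localization.Away f) (Localization.AtPrime q)

lemma exists_preimage_of_isPullback {P X Y Z : Scheme.{u}} {a : P ⟶ X} {b : P ⟶ Y} {f : X ⟶ Z}
    {g : Y ⟶ Z} (h : IsPullback a b f g) (x : X) (y : Y) (hxy : f x = g y) :
    ∃ p : P, a p = x ∧ b p = y := by
  obtain ⟨z, hz1, hz2⟩ := Scheme.Pullback.exists_preimage_pullback x y hxy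
  refine ⟨h.isoPullback.inv z, ?_, ?_⟩
  · rw [← Scheme.Hom.comp_apply, h.isoPullback_inv_fst, hz1]
  · rw [← Scheme.Hom.comp_apply, h.isoPullback_inv_snd, hz2]

/-- The point of `Spec R` given by a prime ideal `p` whose primality is found by instance search. -/
def specPoint {R : Type u} [CommRing R] (p : Ideal R) [hp : p.IsPrime] : Spec (.of R) :=
  (⟨p, hp⟩ : PrimeSpectrum R)

lemma exists_eq_specPoint {R : Type u} [CommRing R] (x : Spec (.of R)) :
    ∃ (p : Ideal R) (_ : p.IsPrime), x = specPoint p :=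
  ⟨PrimeSpectrum.asIdeal x, PrimeSpectrum.isPrime x, rfl⟩

/-- The local ring of a scheme at a point of an affine chart, as a localization. -/
noncomputable def stalkEquivLocalization {R : Type u} [CommRing R] {X : Scheme.{u}}
    (j : Spec (.of R) ⟶ X) [IsOpenImmersion j] (p : Ideal R) [p.IsPrime] :
    X.presheaf.stalk (j (specPoint p)) ≃+* Localization.AtPrime p :=
  ((asIso (j.stalkMap (specPoint p))) ≪≫
    Spec.stalkIso (.of R) (specPoint p)).commRingCatIsoToRingEquiv

lemma ringKrullDim_stalk_eq_height {R : Type u} [CommRing R] {X : Scheme.{u}}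
    (j : Spec (.of R) ⟶ X) [IsOpenImmersion j] (p : Ideal R) [p.IsPrime] :
    ringKrullDim (X.presheaf.stalk (j (specPoint p))) = p.height := by
  rw [ringKrullDim_eq_of_ringEquiv (stalkEquivLocalization j p),
    IsLocalization.AtPrime.ringKrullDim_eq_height p]

lemma stalkMap_iff_localRingHom {Q : ∀ {R S : Type u} [CommRing R] [CommRing S], (R →+* S) → Prop}
    (hQ : RingHom.RespectsIso Q) {X Y : Scheme.{u}} {f : X ⟶ Y} {R S : Type u} [CommRing R]
    [CommRing S] [Algebra R S] {j : Spec (.of R) ⟶ Y} {i : Spec (.of S) ⟶ X} [IsOpenImmersion j]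
    [IsOpenImmersion i] (h : i ≫ f = Spec.map (CommRingCat.ofHom (algebraMap R S)) ≫ j)
    (q : Ideal S) [q.IsPrime] :
    Q (f.stalkMap (i (specPoint q))).hom ↔
      Q (Localization.localRingHom (q.under R) q (algebraMap R S) rfl) := by
  let φ := CommRingCat.ofHom (algebraMap R S)
  let x : Spec (.of S) := specPoint q
  have h1 : Q (f.stalkMap (i x)).hom ↔ Q ((i ≫ f).stalkMap x).hom := by
    rw [Scheme.Hom.stalkMap_comp]
    exact (hQ.cancel_right_isIso _ (i.stalkMap x)).symm
  have h2 : Q ((Spec.map φ ≫ j).stalkMap x).hom ↔ Q ((Spec.map φ).stalkMap x).hom := by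
    rw [Scheme.Hom.stalkMap_comp]
    exact hQ.cancel_left_isIso (j.stalkMap (Spec.map φ x)) _
  have h3 := hQ.arrow_mk_iso_iff (Scheme.arrowStalkMapSpecIso φ x)
  rw [h1, h, h2]
  exact h3

lemma exists_affine_chart {X Y : Scheme.{u}} (f : X ⟶ Y) (x : X) :
    ∃ (R S : CommRingCat.{u}) (φ : R ⟶ S) (j : Spec R ⟶ Y) (i : Spec S ⟶ X),
      IsOpenImmersion j ∧ IsOpenImmersion i ∧ i ≫ f = Spec.map φ ≫ j ∧ x ∈ Set.range i := by
  obtain ⟨_, ⟨U, hU, rfl⟩, hxU, -⟩ :=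
    Y.isBasis_affineOpens.exists_subset_of_mem_open (Set.mem_univ (f x)) isOpen_univ
  obtain ⟨_, ⟨V, hV, rfl⟩, hxV, hVU⟩ :=
    X.isBasis_affineOpens.exists_subset_of_mem_open hxU (U.2.preimage f.continuous)
  refine ⟨_, _, f.appLE U V hVU, hU.fromSpec, hV.fromSpec, hU.isOpenImmersion_fromSpec,
    hV.isOpenImmersion_fromSpec,
    (IsAffineOpen.SpecMap_appLE_fromSpec f hU hV hVU).symm, ?_⟩
  rw [hV.range_fromSpec]
  exact hxV

lemma exists_smooth_chart {K : Type u} [Field K] {X Y : Scheme.{u}} (f : X ⟶ Y)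
    (g : Y ⟶ Spec (.of K)) [Smooth g] [Smooth (f ≫ g)] (x : X) :
    ∃ (R S : Type u) (_ : CommRing R) (_ : CommRing S) (_ : Algebra R S) (_ : Algebra K R)
      (_ : Algebra K S) (j : Spec (.of R) ⟶ Y) (i : Spec (.of S) ⟶ X),
      IsScalarTower K R S ∧ Algebra.Smooth K R ∧ Algebra.Smooth K S ∧ IsOpenImmersion j ∧
      IsOpenImmersion i ∧ i ≫ f = Spec.map (CommRingCat.ofHom (algebraMap R S)) ≫ j ∧
      x ∈ Set.range i := by
  obtain ⟨R, S, φ, j, i, hj, hi, h, hx⟩ := exists_affine_chart f x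
  obtain ⟨ρ, hρ⟩ := Spec.map_surjective (j ≫ g)
  have hρS : Spec.map (ρ ≫ φ) = i ≫ f ≫ g := by
    rw [Spec.map_comp, hρ, reassoc_of% h]
  have h1 : ρ.hom.Smooth := by
    have : Smooth (Spec.map ρ) := hρ ▸ inferInstance
    exact (HasRingHomProperty.Spec_iff (P := @Smooth)).mp this
  have h2 : (ρ ≫ φ).hom.Smooth := by
    have : Smooth (Spec.map (ρ ≫ φ)) := hρS ▸ inferInstance
    exact (HasRingHomProperty.Spec_iff (P := @Smooth)).mp this
  let := φ.hom.toAlgebra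
  let := ρ.hom.toAlgebra
  let := (ρ ≫ φ).hom.toAlgebra
  exact ⟨R, S, inferInstance, inferInstance, inferInstance, inferInstance, inferInstance, j, i,
    .of_algebraMap_eq' rfl, h1, h2, hj, hi, h, hx⟩

lemma isSmoothAt_of_formallySmooth_stalkMap {X Y : Scheme.{u}} {f : X ⟶ Y} {R S : Type u}
    [CommRing R] [CommRing S] [Algebra R S] {j : Spec (.of R) ⟶ Y} {i : Spec (.of S) ⟶ X}
    [IsOpenImmersion j] [IsOpenImmersion i]
    (h : i ≫ f = Spec.map (CommRingCat.ofHom (algebraMap R S)) ≫ j) (q : Ideal S) [q.IsPrime]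
    (hq : (f.stalkMap (i (specPoint q))).hom.FormallySmooth) : Algebra.IsSmoothAt R q := by
  rw [stalkMap_iff_localRingHom RingHom.FormallySmooth.respectsIso h q] at hq
  let := Localization.AtPrime.algebraOfLiesOver (q.under R) q
  have : Algebra.FormallySmooth (Localization.AtPrime (q.under R)) (Localization.AtPrime q) := hq
  exact Algebra.FormallySmooth.iff_restrictScalars.mpr this

lemma height_le_of_chart {Y : Scheme.{u}} {n : ℕ}
    (hn : ∀ y : Y, ringKrullDim (Y.presheaf.stalk y) ≤ n) {R : Type u} [CommRing R]
    (j : Spec (.of R) ⟶ Y) [IsOpenImmersion j] (p : Ideal R) [p.IsPrime] : p.height ≤ n := by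
  have h := hn (j (specPoint p))
  rw [ringKrullDim_stalk_eq_height j] at h
  exact_mod_cast h

section

variable {X Y : Scheme.{u}} {f : X ⟶ Y} {m n : ℕ}
  (hn : ∀ y : Y, ringKrullDim (Y.presheaf.stalk y) ≤ n)
  (H : ∀ x : X, ringKrullDim (X.presheaf.stalk x) < m → (f.stalkMap x).hom.FormallySmooth)

include H

lemma isSmoothAt_of_chart {R S : Type u}
    [CommRing R] [CommRing S] [Algebra R S] {j : Spec (.of R) ⟶ Y} {i : Spec (.of S) ⟶ X}
    [IsOpenImmersion j] [IsOpenImmersion i]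
    (h : i ≫ f = Spec.map (CommRingCat.ofHom (algebraMap R S)) ≫ j) (q : Ideal S) [q.IsPrime]
    (hlt : q.height < m) : Algebra.IsSmoothAt R q := by
  refine isSmoothAt_of_formallySmooth_stalkMap h q (H _ ?_)
  rw [ringKrullDim_stalk_eq_height i]
  exact_mod_cast hlt

include hn

theorem flat_of_forall_ringKrullDim_lt {K : Type u} [Field K] (g : Y ⟶ Spec (.of K)) [Smooth g]
    [Smooth (f ≫ g)] (hnm : n ≤ m) : Flat f := by
  rw [Flat.iff_flat_stalkMap]
  intro x
  obtain ⟨R, S, _, _, _, _, _, j, i, _, _, _, _, _, h, q, rfl⟩ := exists_smooth_chart f g x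
  obtain ⟨q, _, rfl⟩ := exists_eq_specPoint q
  have := isRegularRing_of_smooth K R
  have := isRegularRing_of_smooth K S
  have : Algebra.FinitePresentation R S := .of_restrict_scalars_finitePresentation K R S
  have hflat : Module.Flat R S := by
    refine flat_of_forall_height_lt (m := m) (fun p hp ↦ ?_) fun q hq hlt ↦ ?_
    · exact (height_le_of_chart hn j p).trans (by exact_mod_cast hnm)
    · have := isSmoothAt_of_chart H h q hlt
      exact flat_localization_of_isSmoothAt R q
  rw [stalkMap_iff_localRingHom RingHom.Flat.respectsIso h q]
  exact RingHom.Flat.localRingHom (RingHom.flat_algebraMap_iff.mpr hflat) _ _ rfl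

lemma isRegularLocalRing_of_chart {R S L : Type u} [CommRing R] [CommRing S] [Field L]
    [Algebra R S] [Algebra R L] [IsNoetherianRing R] [Algebra.FinitePresentation R S]
    {j : Spec (.of R) ⟶ Y} {i : Spec (.of S) ⟶ X} [IsOpenImmersion j] [IsOpenImmersion i]
    (h : i ≫ f = Spec.map (CommRingCat.ofHom (algebraMap R S)) ≫ j) {k : ℕ} (hk : n + k < m)
    (P : Ideal (L ⊗[R] S)) [P.IsPrime] (hP : ringKrullDim (Localization.AtPrime P) ≤ k) :
    IsRegularLocalRing (Localization.AtPrime P) := by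
  refine isRegularLocalRing_localization_tensorProduct (n := n) (m := m)
    (fun p _ ↦ height_le_of_chart hn j p) (fun q _ hlt ↦ isSmoothAt_of_chart H h q hlt) P ?_
  rw [IsLocalization.AtPrime.ringKrullDim_eq_height P] at hP
  have hP' : P.height ≤ k := by exact_mod_cast hP
  exact (add_le_add_right hP' _).trans_lt (by exact_mod_cast hk)

end

lemma isDomain_and_isIntegrallyClosed_localization {T : Type u} [CommRing T] [IsNoetherianRing T]
    (hci : ∀ (P : Ideal T) [P.IsPrime], IsLocalCompleteIntersection (Localization.AtPrime P))
    (hR : ∀ (P : Ideal T) [P.IsPrime], ringKrullDim (Localization.AtPrime P) ≤ 1 →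
      IsRegularLocalRing (Localization.AtPrime P)) (P : Ideal T) [P.IsPrime] :
    IsDomain (Localization.AtPrime P) ∧ IsIntegrallyClosed (Localization.AtPrime P) := by
  have he : ∀ (Q : Ideal (Localization.AtPrime P)) [Q.IsPrime],
      Nonempty (Localization.AtPrime (Q.under T) ≃+* Localization.AtPrime Q) := fun Q _ ↦ by
    have := IsLocalization.isLocalization_isLocalization_atPrime_isLocalization P.primeCompl
      (Localization.AtPrime Q) Q
    exact ⟨(IsLocalization.algEquiv (Q.under T).primeCompl (Localization.AtPrime (Q.under T))
      (Localization.AtPrime Q)).toRingEquiv⟩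
  refine isDomain_and_isIntegrallyClosed_of_regular_codim_one (fun Q _ ↦ ?_) fun Q _ hQ ↦ ?_
  · exact (hci (Q.under T)).of_ringEquiv (he Q).some
  · have := hR (Q.under T) (by rwa [ringKrullDim_eq_of_ringEquiv (he Q).some])
    exact .of_ringEquiv (he Q).some

lemma exists_chart_of_isPullback {K : Type u} [Field K] {X Y : Scheme.{u}} (f : X ⟶ Y)
    (g : Y ⟶ Spec (.of K)) [Smooth g] [Smooth (f ≫ g)] {L : Type u} [Field L] {Z : Scheme.{u}}
    {a : Z ⟶ X} {b : Z ⟶ Spec (.of L)} {l : Spec (.of L) ⟶ Y} (hZ : IsPullback a b f l) (z : Z) :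
    ∃ (R S : Type u) (_ : CommRing R) (_ : CommRing S) (_ : Algebra R S) (_ : Algebra K R)
      (_ : Algebra K S) (j : Spec (.of R) ⟶ Y) (i : Spec (.of S) ⟶ X) (_ : Algebra R L)
      (_ : Algebra K L) (P : Ideal (L ⊗[R] S)) (_ : P.IsPrime),
      IsScalarTower K R S ∧ Algebra.Smooth K R ∧ Algebra.Smooth K S ∧ IsOpenImmersion j ∧
      IsOpenImmersion i ∧ i ≫ f = Spec.map (CommRingCat.ofHom (algebraMap R S)) ≫ j ∧
      IsScalarTower K R L ∧ Nonempty (Z.presheaf.stalk z ≃+* Localization.AtPrime P) := by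
  obtain ⟨R, S, _, _, _, _, _, j, i, hT, hR, hS, _, _, h, s, hs⟩ := exists_smooth_chart f g (a z)
  have hrange : Set.range l ⊆ Set.range j := by
    rintro _ ⟨t, rfl⟩
    have ht : t = b z := Subsingleton.elim _ _
    rw [ht, ← Scheme.Hom.comp_apply, ← hZ.w, Scheme.Hom.comp_apply, ← hs, ← Scheme.Hom.comp_apply,
      h, Scheme.Hom.comp_apply]
    exact ⟨_, rfl⟩
  obtain ⟨ρ, hρ⟩ := Spec.map_surjective (IsOpenImmersion.lift j l hrange)
  have hl : l = Spec.map ρ ≫ j := by rw [hρ, IsOpenImmersion.lift_fac]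
  let := ρ.hom.toAlgebra
  let : Algebra K L := (ρ.hom.comp (algebraMap K R)).toAlgebra
  have : IsScalarTower K R L := .of_algebraMap_eq' rfl
  have hW := isPullback_SpecMap_of_isPushout _ _ _ _ (CommRingCat.isPushout_tensorProduct R L S)
  have hW' : IsPullback (Spec.map (CommRingCat.ofHom
      (Algebra.TensorProduct.includeRight : S →ₐ[R] L ⊗[R] S).toRingHom))
      (Spec.map (CommRingCat.ofHom (Algebra.TensorProduct.includeLeftRingHom : L →+* L ⊗[R] S)))
      (i ≫ f) l := by
    rw [h, hl]
    exact .of_isLimit (Limits.PullbackCone.isLimitOfCompMono _ _ j _ hW.flip.isLimit)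
  have hW'' := IsPullback.of_bot' hW' hZ
  obtain ⟨w, -, hw⟩ := exists_preimage_of_isPullback hW'' s z hs
  have : IsOpenImmersion (hZ.lift _ _ _) := MorphismProperty.of_isPullback hW'' ‹_›
  obtain ⟨P, _, rfl⟩ := exists_eq_specPoint w
  refine ⟨R, S, _, _, _, _, _, j, i, _, _, P, ‹_›, hT, hR, hS, ‹_›, ‹_›, h, ‹_›, ?_⟩
  rw [← hw]
  exact ⟨stalkEquivLocalization _ P⟩

lemma flat_of_chart {X Y : Scheme.{u}} (f : X ⟶ Y) [Flat f] {R S : Type u} [CommRing R]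
    [CommRing S] [Algebra R S] {j : Spec (.of R) ⟶ Y} {i : Spec (.of S) ⟶ X} [IsOpenImmersion j]
    [IsOpenImmersion i] (h : i ≫ f = Spec.map (CommRingCat.ofHom (algebraMap R S)) ≫ j) :
    Module.Flat R S := by
  let φ := Spec.map (CommRingCat.ofHom (algebraMap R S))
  have h1 : Flat (φ ≫ j) := h ▸ inferInstance
  have hpb : IsPullback (𝟙 _) φ (φ ≫ j) (𝟙 _ ≫ j) :=
    .of_isLimit (Limits.PullbackCone.isLimitOfCompMono φ (𝟙 _) j _
      (IsPullback.id_horiz φ).isLimit)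
  have h2 : Flat φ := MorphismProperty.of_isPullback hpb h1
  rw [← RingHom.flat_algebraMap_iff]
  exact (HasRingHomProperty.Spec_iff (P := @Flat)).mp h2

section

variable {K : Type u} [Field K] {X Y : Scheme.{u}} {f : X ⟶ Y} (g : Y ⟶ Spec (.of K)) [Smooth g]
  [Smooth (f ≫ g)] {m n : ℕ} (hn : ∀ y : Y, ringKrullDim (Y.presheaf.stalk y) ≤ n)
  (H : ∀ x : X, ringKrullDim (X.presheaf.stalk x) < m → (f.stalkMap x).hom.FormallySmooth)
  {L : Type u} [Field L] {Z : Scheme.{u}} {a : Z ⟶ X} {b : Z ⟶ Spec (.of L)}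
  {l : Spec (.of L) ⟶ Y} (hZ : IsPullback a b f l)

include g hn H hZ

lemma exists_stalk_ringEquiv_localization_of_isPullback (hnm : n ≤ m) (z : Z) :
    ∃ (T : Type u) (_ : CommRing T) (_ : IsNoetherianRing T) (P : Ideal T) (_ : P.IsPrime),
      Nonempty (Z.presheaf.stalk z ≃+* Localization.AtPrime P) ∧
      (∀ (Q : Ideal T) [Q.IsPrime], IsLocalCompleteIntersection (Localization.AtPrime Q)) ∧
      ∀ k : ℕ, n + k < m → ∀ (Q : Ideal T) [Q.IsPrime],
        ringKrullDim (Localization.AtPrime Q) ≤ k →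
          IsRegularLocalRing (Localization.AtPrime Q) := by
  obtain ⟨R, S, _, _, _, _, _, j, i, _, _, P, _, _, _, _, _, _, h, _, he⟩ :=
    exists_chart_of_isPullback f g hZ z
  have : IsNoetherianRing R := Algebra.FiniteType.isNoetherianRing K R
  have : Algebra.FinitePresentation R S := .of_restrict_scalars_finitePresentation K R S
  have := flat_of_forall_ringKrullDim_lt hn H g hnm
  have := flat_of_chart f h
  exact ⟨L ⊗[R] S, inferInstance, Algebra.FiniteType.isNoetherianRing L _, P, ‹_›, he,
    fun Q _ ↦ isLocalCompleteIntersection_localization_tensorProduct K Q,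
    fun k hk Q _ hQ ↦ isRegularLocalRing_of_chart hn H h hk Q hQ⟩

theorem isRegularInCodim_of_isPullback {k : ℕ} (hk : n + k < m) : IsRegularInCodim Z k := by
  intro z hz
  obtain ⟨T, _, _, P, _, ⟨e⟩, -, hreg⟩ :=
    exists_stalk_ringEquiv_localization_of_isPullback g hn H hZ (by lia) z
  rw [ringKrullDim_eq_of_ringEquiv e] at hz
  have := hreg k hk P hz
  exact .of_ringEquiv e.symm

theorem isReduced_of_isPullback (hk : n < m) : IsReduced Z := by
  have (z : Z) : _root_.IsReduced (Z.presheaf.stalk z) := by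
    obtain ⟨T, _, _, P, _, ⟨e⟩, hci, hreg⟩ :=
      exists_stalk_ringEquiv_localization_of_isPullback g hn H hZ hk.le z
    have : _root_.IsReduced T := isReduced_of_regular_codim_zero hci
      fun Q _ hQ ↦ hreg 0 hk Q (by simpa using hQ)
    exact isReduced_of_injective e e.injective
  exact isReduced_of_isReduced_stalk Z

theorem isNormalScheme_of_isPullback (hk : n + 1 < m) : IsNormalScheme Z := by
  intro z
  obtain ⟨T, _, _, P, _, ⟨e⟩, hci, hreg⟩ :=
    exists_stalk_ringEquiv_localization_of_isPullback g hn H hZ (by lia) z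
  obtain ⟨_, _⟩ := isDomain_and_isIntegrallyClosed_localization hci
    (fun Q _ hQ ↦ hreg 1 hk Q (by simpa using hQ)) P
  exact ⟨e.toMulEquiv.isDomain _, .of_equiv e.symm⟩

end

end Charts

theorem formallySmooth_stalkMap_of_smooth {X Y : Scheme.{u}} (f : X ⟶ Y) [Smooth f] (x : X) :
    (f.stalkMap x).hom.FormallySmooth := by
  have hx : x ∈ f.smoothLocus := by rw [f.smoothLocus_eq_top]; trivial
  exact hx

theorem formallySmooth_stalkMap_comp {X Y Z : Scheme.{u}} (f : X ⟶ Y) (g : Y ⟶ Z) (x : X)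
    (hg : (g.stalkMap (f x)).hom.FormallySmooth) (hf : (f.stalkMap x).hom.FormallySmooth) :
    ((f ≫ g).stalkMap x).hom.FormallySmooth := by
  rw [Scheme.Hom.stalkMap_comp]
  exact RingHom.FormallySmooth.comp hg hf

theorem smooth_ι_smoothLocus_comp {X Y : Scheme.{u}} (f : X ⟶ Y) [LocallyOfFinitePresentation f] :
    Smooth (f.smoothLocus.ι ≫ f) := by
  rw [← Scheme.Hom.smoothLocus_eq_top_iff, ← Scheme.Hom.preimage_smoothLocus_eq]
  simp

theorem formallySmooth_stalkMap_of_isPullback {X Y Z W : Scheme.{u}} {a : Z ⟶ X} {b : Z ⟶ W}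
    {f : X ⟶ Y} {g : W ⟶ Y} [LocallyOfFinitePresentation f] (h : IsPullback a b f g) (z : Z)
    (hz : (f.stalkMap (a z)).hom.FormallySmooth) : (b.stalkMap z).hom.FormallySmooth := by
  have hb : LocallyOfFinitePresentation b := MorphismProperty.of_isPullback h ‹_›
  have hs := smooth_ι_smoothLocus_comp f
  have hp := (isPullback_morphismRestrict a f.smoothLocus).flip.paste_horiz h.flip
  have hs' : Smooth ((a ⁻¹ᵁ f.smoothLocus).ι ≫ b) := MorphismProperty.of_isPullback hp.flip hs
  rw [← Scheme.Hom.smoothLocus_eq_top_iff, ← Scheme.Hom.preimage_smoothLocus_eq] at hs'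
  have hz' : (⟨z, hz⟩ : (a ⁻¹ᵁ f.smoothLocus : Z.Opens)) ∈
      (a ⁻¹ᵁ f.smoothLocus).ι ⁻¹ᵁ b.smoothLocus := by
    rw [hs']; trivial
  exact hz'

theorem exists_iso_left_apply_eq {K : Type u} [Field K] [IsAlgClosed K] {G : Scheme.{u}}
    (f : G ⟶ Spec (.of K)) [LocallyOfFiniteType f] [GrpObj (Over.mk f)] {x y : G}
    (hx : x ∈ closedPoints G) (hy : y ∈ closedPoints G) :
    ∃ α : Over.mk f ≅ Over.mk f, α.hom.left x = y := by
  let x' : 𝟙_ _ ⟶ Over.mk f := Over.homMk _ ((pointEquivClosedPoint f).symm ⟨x, hx⟩).2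
  let y' : 𝟙_ _ ⟶ Over.mk f := Over.homMk _ ((pointEquivClosedPoint f).symm ⟨y, hy⟩).2
  let α := (GrpObj.mulRight (A := Over.mk f) x').symm ≪≫ (GrpObj.mulRight (A := Over.mk f) y')
  have hα : x' ≫ α.hom = y' := by
    dsimp only [Iso.trans_hom, Iso.symm_hom, α]
    rw [← Category.assoc, ← Iso.eq_comp_inv]
    simp [comp_lift_assoc]
  have hx' : x'.left (IsLocalRing.closedPoint K) = x := pointOfClosedPoint_apply f x hx _
  have hy' : y'.left (IsLocalRing.closedPoint K) = y := pointOfClosedPoint_apply f y hy _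
  have hαx := congr(($hα).left (IsLocalRing.closedPoint K))
  rw [hy'] at hαx
  refine ⟨α, ?_⟩
  rw [← hαx, ← hx']
  rfl

theorem smooth_of_grpObj_of_nonempty_smoothLocus {K : Type u} [Field K] [IsAlgClosed K]
    {G : Scheme.{u}} (f : G ⟶ Spec (.of K)) [LocallyOfFinitePresentation f] [GrpObj (Over.mk f)]
    (hne : (f.smoothLocus : Set G).Nonempty) : Smooth f := by
  have := LocallyOfFiniteType.jacobsonSpace f
  rw [← Scheme.Hom.smoothLocus_eq_top_iff, ← TopologicalSpace.Opens.coe_eq_univ,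
    ← not_ne_iff, ← Set.nonempty_compl]
  intro H
  obtain ⟨x, hx, hxc⟩ :=
    nonempty_inter_closedPoints H f.smoothLocus.2.isClosed_compl.isLocallyClosed
  obtain ⟨y, hy, hyc⟩ := nonempty_inter_closedPoints hne f.smoothLocus.2.isLocallyClosed
  obtain ⟨α, hα⟩ := exists_iso_left_apply_eq f hxc hyc
  have hiso : IsIso α.hom.left := inferInstanceAs (IsIso ((Over.forget _).map α.hom))
  have hsmooth : ((α.hom.left ≫ f).stalkMap x).hom.FormallySmooth :=
    formallySmooth_stalkMap_comp _ _ _ (by rw [hα]; exact hy)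
      (formallySmooth_stalkMap_of_smooth _ _)
  rw [show α.hom.left ≫ f = f from Over.w α.hom] at hsmooth
  exact hx hsmooth

theorem smooth_of_grpObj_of_isReduced {K : Type u} [Field K] [PerfectField K]
    {G : Scheme.{u}} (f : G ⟶ Spec (.of K)) [LocallyOfFiniteType f] [GrpObj (Over.mk f)]
    [IsReduced G] : Smooth f := by
  have hf : LocallyOfFinitePresentation f :=
    LocallyOfFinitePresentation.iff_locallyOfFiniteType.mpr ‹_›
  let Ω : Type u := AlgebraicClosure K
  let g : Spec (.of Ω) ⟶ Spec (.of K) := Spec.map (CommRingCat.ofHom <| algebraMap K Ω)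
  apply MorphismProperty.of_pullback_snd_of_descendsAlong
    (Q := @Surjective ⊓ @Flat ⊓ @QuasiCompact) (g := g)
  · exact ⟨⟨inferInstance, inferInstance⟩, inferInstance⟩
  · let : GrpObj (Over.mk (Limits.pullback.snd f g)) := Over.grpObjMkPullbackSnd
    have : Nonempty G := ⟨η[Over.mk f].1 (IsLocalRing.closedPoint _)⟩
    have h := f.dense_smoothLocus_of_perfectField
    obtain ⟨x, hx⟩ := h.nonempty
    have hpb := IsPullback.of_hasPullback f g
    obtain ⟨z, rfl⟩ := (Limits.pullback.fst f g).surjective x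
    exact smooth_of_grpObj_of_nonempty_smoothLocus _
      ⟨z, formallySmooth_stalkMap_of_isPullback hpb z hx⟩

/-! ### Convolution -/

section Convolution

variable {K : Type u} [Field K] {G X Y : Over (Spec (.of K))}

theorem isPullback_fst_snd (X Y : Over (Spec (.of K))) :
    IsPullback (fst X Y).left (snd X Y).left X.hom Y.hom :=
  IsPullback.of_hasPullback _ _

theorem isPullback_comp_fst_snd {Z : Over (Spec (.of K))} (e : Z ⟶ X ⊗ Y) (_ : IsIso e) :
    IsPullback (e ≫ fst X Y).left (e ≫ snd X Y).left X.hom Y.hom := by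
  refine IsPullback.of_iso (isPullback_fst_snd X Y) ((Over.forget _).mapIso (asIso e)).symm
    (Iso.refl _) (Iso.refl _) (Iso.refl _) ?_ ?_ ?_ ?_
  · exact (Category.comp_id _).trans
      congr(($(show fst X Y = inv e ≫ e ≫ fst X Y by simp)).left)
  · exact (Category.comp_id _).trans
      congr(($(show snd X Y = inv e ≫ e ≫ snd X Y by simp)).left)
  · simp
  · simp

theorem isPullback_whiskerRight_left (φ : X ⟶ G) (Y : Over (Spec (.of K))) :
    IsPullback (fst X Y).left (φ ▷ Y).left φ.left (fst G Y).left := by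
  refine IsPullback.of_bot (v₂₁ := (snd G Y).left) (v₂₂ := G.hom) (h₃₁ := Y.hom) ?_ ?_
    (isPullback_fst_snd G Y)
  · rw [Over.w φ, ← Over.comp_left, whiskerRight_snd]
    exact isPullback_fst_snd X Y
  · rw [← Over.comp_left, ← Over.comp_left, whiskerRight_fst]

theorem isPullback_whiskerLeft_left (Y : Over (Spec (.of K))) (φ : X ⟶ G) :
    IsPullback (snd Y X).left (Y ◁ φ).left φ.left (snd Y G).left := by
  refine IsPullback.of_bot (v₂₁ := (fst Y G).left) (v₂₂ := G.hom) (h₃₁ := Y.hom) ?_ ?_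
    (isPullback_fst_snd Y G).flip
  · rw [Over.w φ, ← Over.comp_left, whiskerLeft_fst]
    exact (isPullback_fst_snd Y X).flip
  · rw [← Over.comp_left, ← Over.comp_left, whiskerLeft_snd]

variable [GrpObj G]

-- The shear `(x, g) ↦ (φ x * g, x)` is an isomorphism `X ⊗ G ≅ G ⊗ X`.
theorem isPullback_whiskerRight_mul (φ : X ⟶ G) :
    IsPullback (φ ▷ G ≫ μ[G]).left (fst X G).left G.hom X.hom := by
  have hm : φ ▷ G ≫ μ[G] = (fst X G ≫ φ) * snd X G := by
    rw [Hom.mul_def]; congr 1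
  let e : X ⊗ G ≅ G ⊗ X :=
    { hom := lift ((fst X G ≫ φ) * snd X G) (fst X G)
      inv := lift (snd G X) ((snd G X ≫ φ)⁻¹ * fst G X)
      hom_inv_id := by ext1 <;> simp [MonObj.comp_mul, GrpObj.comp_inv]
      inv_hom_id := by ext1 <;> simp [MonObj.comp_mul] }
  have := isPullback_comp_fst_snd e.hom e.isIso_hom
  rwa [lift_fst, lift_snd, ← hm] at this

theorem isPullback_whiskerLeft_mul (ψ : Y ⟶ G) :
    IsPullback (G ◁ ψ ≫ μ[G]).left (snd G Y).left G.hom Y.hom := by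
  have hm : G ◁ ψ ≫ μ[G] = fst G Y * (snd G Y ≫ ψ) := by
    rw [Hom.mul_def]; congr 1
  let e : G ⊗ Y ≅ G ⊗ Y :=
    { hom := lift (fst G Y * (snd G Y ≫ ψ)) (snd G Y)
      inv := lift (fst G Y * (snd G Y ≫ ψ)⁻¹) (snd G Y)
      hom_inv_id := by ext1 <;> simp [MonObj.comp_mul, GrpObj.comp_inv]
      inv_hom_id := by ext1 <;> simp [MonObj.comp_mul] }
  have := isPullback_comp_fst_snd e.hom e.isIso_hom
  rwa [lift_fst, lift_snd, ← hm] at this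

theorem locallyOfFinitePresentation_left (φ : X ⟶ Y) [LocallyOfFiniteType X.hom]
    [LocallyOfFiniteType Y.hom] : LocallyOfFinitePresentation φ.left := by
  have : LocallyOfFiniteType (φ.left ≫ Y.hom) := by rw [Over.w φ]; assumption
  have := LocallyOfFiniteType.isLocallyNoetherian Y.hom
  exact LocallyOfFinitePresentation.iff_locallyOfFiniteType.mpr
    (locallyOfFiniteType_of_comp φ.left Y.hom)

variable [LocallyOfFiniteType G.hom] (φ : X ⟶ G) (ψ : Y ⟶ G)

theorem formallySmooth_stalkMap_conv_of_fst [Smooth Y.hom] [LocallyOfFiniteType X.hom]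
    (z : (X ⊗ Y).left) (hz : (φ.left.stalkMap ((fst X Y).left z)).hom.FormallySmooth) :
    ((conv φ ψ).left.stalkMap z).hom.FormallySmooth := by
  have h : conv φ ψ = φ ▷ Y ≫ (G ◁ ψ ≫ μ[G]) := by
    rw [conv, MonoidalCategory.tensorHom_def, Category.assoc]
  have := locallyOfFinitePresentation_left φ
  rw [h, Over.comp_left]
  refine formallySmooth_stalkMap_comp _ _ _ ?_
    (formallySmooth_stalkMap_of_isPullback (isPullback_whiskerRight_left φ Y) z hz)
  have : Smooth (G ◁ ψ ≫ μ[G]).left :=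
    MorphismProperty.of_isPullback (isPullback_whiskerLeft_mul ψ).flip ‹_›
  exact formallySmooth_stalkMap_of_smooth _ _

theorem formallySmooth_stalkMap_conv_of_snd [Smooth X.hom] [LocallyOfFiniteType Y.hom]
    (z : (X ⊗ Y).left) (hz : (ψ.left.stalkMap ((snd X Y).left z)).hom.FormallySmooth) :
    ((conv φ ψ).left.stalkMap z).hom.FormallySmooth := by
  have h : conv φ ψ = X ◁ ψ ≫ (φ ▷ G ≫ μ[G]) := by
    rw [conv, MonoidalCategory.tensorHom_def', Category.assoc]
  have := locallyOfFinitePresentation_left ψ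
  rw [h, Over.comp_left]
  refine formallySmooth_stalkMap_comp _ _ _ ?_
    (formallySmooth_stalkMap_of_isPullback (isPullback_whiskerLeft_left X ψ) z hz)
  have : Smooth (φ ▷ G ≫ μ[G]).left :=
    MorphismProperty.of_isPullback (isPullback_whiskerRight_mul φ).flip ‹_›
  exact formallySmooth_stalkMap_of_smooth _ _

end Convolution

section HeightTensorProduct

theorem height_comap_eq_add_of_flat {A T T' : Type*} [CommRing A] [CommRing T] [CommRing T']
    [IsNoetherianRing A] [IsNoetherianRing T] {f : A →+* T} (hf : f.Flat) {π : T →+* T'}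
    (hπ : Function.Surjective π) (p : Ideal A) [p.IsPrime] (hker : RingHom.ker π = p.map f)
    (Q : Ideal T') [Q.IsPrime] (hp : (Q.comap π).comap f = p) :
    (Q.comap π).height = p.height + Q.height := by
  let := f.toAlgebra
  have : Module.Flat A T := hf
  have : (Q.comap π).LiesOver p := ⟨hp.symm⟩
  rw [Ideal.height_eq_height_add_of_liesOver_of_hasGoingDown p (Q.comap π)]
  congr 1
  let e : T ⧸ p.map (algebraMap A T) ≃+* T' :=
    (Ideal.quotEquivOfEq hker.symm).trans (RingHom.quotientKerEquivOfSurjective hπ)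
  rw [← RingEquiv.height_comap e Q]
  congr 1
  have hle : p.map (algebraMap A T) ≤ Q.comap π := by
    rw [RingHom.algebraMap_toAlgebra, ← hker]
    exact Ideal.comap_mono bot_le
  ext x
  obtain ⟨x, rfl⟩ := Ideal.Quotient.mk_surjective x
  rw [Ideal.mem_quotient_iff_mem hle]
  rfl

theorem comap_eq_bot_of_mem_minimalPrimes_of_flat {D T : Type*} [CommRing D] [IsDomain D]
    [CommRing T] {f : D →+* T} (hf : f.Flat) {Q : Ideal T} (hQ : Q ∈ minimalPrimes T) :
    Q.comap f = ⊥ := by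
  let := f.toAlgebra
  have : Module.Flat D T := hf
  rw [eq_bot_iff]
  intro x hx
  by_contra h0
  refine Set.disjoint_left.mp (Ideal.disjoint_nonZeroDivisors_of_mem_minimalPrimes hQ) hx ?_
  have hreg : IsSMulRegular T (algebraMap D T x) :=
    IsSMulRegular.of_flat (IsSMulRegular.of_ne_zero h0)
  exact mem_nonZeroDivisors_iff_right.mpr fun t ht ↦
    hreg (by
      change f x • t = f x • 0
      rw [smul_zero, smul_eq_mul, _root_.mul_comm]
      exact ht)

variable {K A B : Type*} [Field K] [CommRing A] [CommRing B] [Algebra K A] [Algebra K B]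

theorem flat_includeLeft :
    (Algebra.TensorProduct.includeLeftRingHom : A →+* A ⊗[K] B).Flat :=
  RingHom.flat_algebraMap_iff.mpr (inferInstance : Module.Flat A (A ⊗[K] B))

theorem flat_includeRight :
    (Algebra.TensorProduct.includeRight : B →ₐ[K] A ⊗[K] B).toRingHom.Flat := by
  have h := RingHom.Flat.comp (flat_includeLeft (K := K) (A := B) (B := A))
    (.of_bijective (Algebra.TensorProduct.comm K B A).toRingEquiv.bijective)
  exact h

theorem surjective_map_quotientMk_id (p : Ideal A) :
    Function.Surjective (Algebra.TensorProduct.map (Ideal.Quotient.mkₐ K p)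
      (AlgHom.id K B)).toRingHom :=
  _root_.TensorProduct.map_surjective (Ideal.Quotient.mkₐ_surjective K p) Function.surjective_id

theorem ker_map_quotientMk_id (p : Ideal A) :
    RingHom.ker (Algebra.TensorProduct.map (Ideal.Quotient.mkₐ K p) (AlgHom.id K B)).toRingHom =
      p.map (Algebra.TensorProduct.includeLeftRingHom : A →+* A ⊗[K] B) := by
  have hp : RingHom.ker (Ideal.Quotient.mkₐ K p) = p := Ideal.mk_ker
  refine (Algebra.TensorProduct.rTensor_ker (S := K) (C := B) _
    (Ideal.Quotient.mkₐ_surjective K p)).trans ?_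
  rw [hp]
  rfl

theorem surjective_map_id_quotientMk (q : Ideal B) :
    Function.Surjective (Algebra.TensorProduct.map (AlgHom.id K A)
      (Ideal.Quotient.mkₐ K q)).toRingHom :=
  _root_.TensorProduct.map_surjective Function.surjective_id (Ideal.Quotient.mkₐ_surjective K q)

theorem ker_map_id_quotientMk (q : Ideal B) :
    RingHom.ker (Algebra.TensorProduct.map (AlgHom.id K A) (Ideal.Quotient.mkₐ K q)).toRingHom =
      q.map (Algebra.TensorProduct.includeRight : B →ₐ[K] A ⊗[K] B).toRingHom := by
  have hq : RingHom.ker (Ideal.Quotient.mkₐ K q) = q := Ideal.mk_ker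
  refine (Algebra.TensorProduct.lTensor_ker (A := A) _
    (Ideal.Quotient.mkₐ_surjective K q)).trans ?_
  rw [hq]
  rfl

theorem exists_mem_minimalPrimes_comap_eq (p : Ideal A) [p.IsPrime] (q : Ideal B) [q.IsPrime] :
    ∃ Q ∈ minimalPrimes ((A ⧸ p) ⊗[K] (B ⧸ q)),
      ((Q.comap (Algebra.TensorProduct.map (AlgHom.id K (A ⧸ p))
        (Ideal.Quotient.mkₐ K q)).toRingHom).comap
        (Algebra.TensorProduct.map (Ideal.Quotient.mkₐ K p) (AlgHom.id K B)).toRingHom).comap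
        (Algebra.TensorProduct.includeLeftRingHom : A →+* A ⊗[K] B) = p ∧
      (Q.comap (Algebra.TensorProduct.map (AlgHom.id K (A ⧸ p))
        (Ideal.Quotient.mkₐ K q)).toRingHom).comap
        (Algebra.TensorProduct.includeRight : B →ₐ[K] (A ⧸ p) ⊗[K] B).toRingHom = q := by
  obtain ⟨Q, hQ⟩ := Ideal.nonempty_minimalPrimes
    (bot_ne_top : (⊥ : Ideal ((A ⧸ p) ⊗[K] (B ⧸ q))) ≠ ⊤)
  have hl := comap_eq_bot_of_mem_minimalPrimes_of_flat
    (flat_includeLeft (K := K) (A := A ⧸ p) (B := B ⧸ q)) hQ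
  have hr := comap_eq_bot_of_mem_minimalPrimes_of_flat
    (flat_includeRight (K := K) (A := A ⧸ p) (B := B ⧸ q)) hQ
  refine ⟨Q, hQ, ?_, ?_⟩
  · conv_rhs => rw [← Ideal.mk_ker (I := p), RingHom.ker, ← hl, Ideal.comap_comap]
    ext x
    simp
  · conv_rhs => rw [← Ideal.mk_ker (I := q), RingHom.ker, ← hr, Ideal.comap_comap]
    ext x
    simp

variable [Algebra.FiniteType K A] [Algebra.FiniteType K B]

theorem height_comap_add_height_comap_le (P : Ideal (A ⊗[K] B)) [P.IsPrime] :
    (P.comap (Algebra.TensorProduct.includeLeftRingHom : A →+* A ⊗[K] B)).height +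
      (P.comap (Algebra.TensorProduct.includeRight : B →ₐ[K] A ⊗[K] B)).height ≤ P.height := by
  set p := P.comap (Algebra.TensorProduct.includeLeftRingHom : A →+* A ⊗[K] B)
  have : IsNoetherianRing A := Algebra.FiniteType.isNoetherianRing K A
  have : IsNoetherianRing B := Algebra.FiniteType.isNoetherianRing K B
  have : IsNoetherianRing (A ⊗[K] B) := Algebra.FiniteType.isNoetherianRing A _
  have : IsNoetherianRing ((A ⧸ p) ⊗[K] B) := Algebra.FiniteType.isNoetherianRing (A ⧸ p) _
  let π := (Algebra.TensorProduct.map (Ideal.Quotient.mkₐ K p) (AlgHom.id K B)).toRingHom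
  have hπ : Function.Surjective π := surjective_map_quotientMk_id p
  have hker : RingHom.ker π = _ := ker_map_quotientMk_id p
  have hle : RingHom.ker π ≤ P := by
    rw [hker]; exact Ideal.map_comap_le
  let Q := P.map π
  have hQ : Q.IsPrime := Ideal.map_isPrime_of_surjective hπ hle
  have hQP : Q.comap π = P := (Ideal.comap_map_of_surjective π hπ P).trans (sup_eq_left.mpr hle)
  have h1 := height_comap_eq_add_of_flat flat_includeLeft hπ p hker Q
    (by rw [hQP])
  rw [hQP] at h1
  rw [h1]
  refine add_le_add le_rfl ?_
  refine le_trans (le_of_eq ?_)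
    (height_comap_le_of_flat (flat_includeRight (K := K) (A := A ⧸ p) (B := B)) Q)
  congr 1
  conv_lhs => rw [← hQP]
  ext x
  simp [π]

theorem exists_isPrime_height_le_add (p : Ideal A) [p.IsPrime] (q : Ideal B) [q.IsPrime] :
    ∃ (P : Ideal (A ⊗[K] B)) (_ : P.IsPrime),
      P.comap (Algebra.TensorProduct.includeLeftRingHom : A →+* A ⊗[K] B) = p ∧
      P.comap (Algebra.TensorProduct.includeRight : B →ₐ[K] A ⊗[K] B) = q ∧
      P.height ≤ p.height + q.height := by
  have : IsNoetherianRing A := Algebra.FiniteType.isNoetherianRing K A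
  have : IsNoetherianRing B := Algebra.FiniteType.isNoetherianRing K B
  have : IsNoetherianRing (A ⊗[K] B) := Algebra.FiniteType.isNoetherianRing A _
  have : IsNoetherianRing ((A ⧸ p) ⊗[K] B) := Algebra.FiniteType.isNoetherianRing (A ⧸ p) _
  obtain ⟨Q, hQ, hl, hr⟩ := exists_mem_minimalPrimes_comap_eq (K := K) p q
  have hQp : Q.IsPrime := hQ.1.1
  refine ⟨_, inferInstance, hl, ?_, ?_⟩
  · conv_rhs => rw [← hr]
    ext x
    simp
  · have hleft := height_comap_eq_add_of_flat flat_includeLeft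
      (surjective_map_quotientMk_id p) p (ker_map_quotientMk_id p) _ hl
    have hright := height_comap_eq_add_of_flat flat_includeRight
      (surjective_map_id_quotientMk q) q (ker_map_id_quotientMk q) Q hr
    rw [Ideal.height_eq_zero_iff.mpr hQ, add_zero] at hright
    exact (hleft.trans congr(p.height + $hright)).le

end HeightTensorProduct

section FiniteTypeCharts

variable {K : Type u} [Field K]

theorem exists_affine_chart_of_locallyOfFiniteType {X : Scheme.{u}} (f : X ⟶ Spec (.of K))
    [LocallyOfFiniteType f] (x : X) :
    ∃ (A : Type u) (_ : CommRing A) (_ : Algebra K A) (a : Spec (.of A) ⟶ X),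
      Algebra.FiniteType K A ∧ IsOpenImmersion a ∧ x ∈ Set.range a ∧
      a ≫ f = Spec.map (CommRingCat.ofHom (algebraMap K A)) := by
  obtain ⟨A, a, ha, hxa, -⟩ := Scheme.exists_affine_mem_range_and_range_subset
    (show x ∈ (⊤ : X.Opens) from trivial)
  obtain ⟨ρ, hρ⟩ := Spec.map_surjective (a ≫ f)
  have hft : ρ.hom.FiniteType := by
    have : LocallyOfFiniteType (Spec.map ρ) := hρ ▸ inferInstance
    exact (HasRingHomProperty.Spec_iff (P := @LocallyOfFiniteType)).mp this
  let := ρ.hom.toAlgebra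
  exact ⟨A, inferInstance, inferInstance, a, hft, ha, hxa, hρ.symm⟩

theorem exists_chart_tensorObj {X Y : Over (Spec (.of K))} {A B : Type u} [CommRing A] [CommRing B]
    [Algebra K A] [Algebra K B] (a : Spec (.of A) ⟶ X.left) (b : Spec (.of B) ⟶ Y.left)
    [IsOpenImmersion a] [IsOpenImmersion b]
    (ha : a ≫ X.hom = Spec.map (CommRingCat.ofHom (algebraMap K A)))
    (hb : b ≫ Y.hom = Spec.map (CommRingCat.ofHom (algebraMap K B))) :
    ∃ c : Spec (.of (A ⊗[K] B)) ⟶ (X ⊗ Y).left, IsOpenImmersion c ∧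
      c ≫ (fst X Y).left = Spec.map (CommRingCat.ofHom
        (Algebra.TensorProduct.includeLeftRingHom : A →+* A ⊗[K] B)) ≫ a ∧
      c ≫ (snd X Y).left = Spec.map (CommRingCat.ofHom
        (Algebra.TensorProduct.includeRight : B →ₐ[K] A ⊗[K] B).toRingHom) ≫ b ∧
      Set.range c = (fst X Y).left ⁻¹' Set.range a ∩ (snd X Y).left ⁻¹' Set.range b := by
  have hW := isPullback_SpecMap_of_isPushout _ _ _ _ (CommRingCat.isPushout_tensorProduct K A B)
  let m := Limits.pullback.map _ _ X.hom Y.hom a b (𝟙 _) ((Category.comp_id _).trans ha.symm)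
    ((Category.comp_id _).trans hb.symm)
  have hm_fst : m ≫ Limits.pullback.fst X.hom Y.hom = Limits.pullback.fst _ _ ≫ a :=
    Limits.pullback.lift_fst _ _ _
  have hm_snd : m ≫ Limits.pullback.snd X.hom Y.hom = Limits.pullback.snd _ _ ≫ b :=
    Limits.pullback.lift_snd _ _ _
  refine ⟨hW.isoPullback.hom ≫ m, inferInstance, ?_, ?_, ?_⟩
  · rw [Over.fst_left, Category.assoc, hm_fst, hW.isoPullback_hom_fst_assoc]
  · rw [Over.snd_left, Category.assoc, hm_snd, hW.isoPullback_hom_snd_assoc]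
  · have hrange := Scheme.Pullback.range_map _ _ X.hom Y.hom a b (𝟙 _)
      ((Category.comp_id _).trans ha.symm) ((Category.comp_id _).trans hb.symm)
    exact (hW.isoPullback.hom.surjective.range_comp m).trans hrange

theorem ringKrullDim_stalk_add_le {X Y : Over (Spec (.of K))} [LocallyOfFiniteType X.hom]
    [LocallyOfFiniteType Y.hom] (z : (X ⊗ Y).left) :
    ringKrullDim (X.left.presheaf.stalk ((fst X Y).left z)) +
      ringKrullDim (Y.left.presheaf.stalk ((snd X Y).left z)) ≤
      ringKrullDim ((X ⊗ Y).left.presheaf.stalk z) := by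
  obtain ⟨A, _, _, a, _, _, hxa, ha⟩ := exists_affine_chart_of_locallyOfFiniteType X.hom
    ((fst X Y).left z)
  obtain ⟨B, _, _, b, _, _, hyb, hb⟩ := exists_affine_chart_of_locallyOfFiniteType Y.hom
    ((snd X Y).left z)
  obtain ⟨c, hc, hc_fst, hc_snd, hr⟩ := exists_chart_tensorObj a b ha hb
  obtain ⟨t, rfl⟩ : z ∈ Set.range c := by rw [hr]; exact ⟨hxa, hyb⟩
  obtain ⟨P, _, rfl⟩ := exists_eq_specPoint t
  have hfst : (fst X Y).left (c (specPoint P)) = a (specPoint (P.comap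
      (Algebra.TensorProduct.includeLeftRingHom : A →+* A ⊗[K] B))) :=
    congr($hc_fst (specPoint P))
  have hsnd : (snd X Y).left (c (specPoint P)) = b (specPoint (P.comap
      (Algebra.TensorProduct.includeRight : B →ₐ[K] A ⊗[K] B))) :=
    congr($hc_snd (specPoint P))
  rw [hfst, hsnd, ringKrullDim_stalk_eq_height, ringKrullDim_stalk_eq_height,
    ringKrullDim_stalk_eq_height]
  exact_mod_cast height_comap_add_height_comap_le P

theorem exists_ringKrullDim_stalk_le_add {X Y : Over (Spec (.of K))} [LocallyOfFiniteType X.hom]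
    [LocallyOfFiniteType Y.hom] (x : X.left) (y : Y.left) :
    ∃ z : (X ⊗ Y).left, (fst X Y).left z = x ∧ (snd X Y).left z = y ∧
      ringKrullDim ((X ⊗ Y).left.presheaf.stalk z) ≤
        ringKrullDim (X.left.presheaf.stalk x) + ringKrullDim (Y.left.presheaf.stalk y) := by
  obtain ⟨A, _, _, a, _, _, ⟨p, rfl⟩, ha⟩ := exists_affine_chart_of_locallyOfFiniteType X.hom x
  obtain ⟨B, _, _, b, _, _, ⟨q, rfl⟩, hb⟩ := exists_affine_chart_of_locallyOfFiniteType Y.hom y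
  obtain ⟨c, hc, hc_fst, hc_snd, -⟩ := exists_chart_tensorObj a b ha hb
  obtain ⟨p, _, rfl⟩ := exists_eq_specPoint p
  obtain ⟨q, _, rfl⟩ := exists_eq_specPoint q
  obtain ⟨P, _, rfl, rfl, hP⟩ := exists_isPrime_height_le_add (K := K) p q
  refine ⟨c (specPoint P), congr($hc_fst (specPoint P)), congr($hc_snd (specPoint P)), ?_⟩
  rw [ringKrullDim_stalk_eq_height, ringKrullDim_stalk_eq_height, ringKrullDim_stalk_eq_height]
  exact_mod_cast hP

theorem isRegularLocalRing_stalk_of_smooth {X : Scheme.{u}} (f : X ⟶ Spec (.of K)) [Smooth f]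
    (x : X) : IsRegularLocalRing (X.presheaf.stalk x) := by
  obtain ⟨_, S, _, _, _, _, _, _, i, _, _, _, _, _, _, s, rfl⟩ := exists_smooth_chart (𝟙 X) f x
  obtain ⟨q, _, rfl⟩ := exists_eq_specPoint s
  have := isRegularRing_of_smooth K S
  exact .of_ringEquiv (stalkEquivLocalization i q).symm

theorem isReduced_of_smooth {X : Scheme.{u}} (f : X ⟶ Spec (.of K)) [Smooth f] : IsReduced X := by
  have (x : X) : _root_.IsReduced (X.presheaf.stalk x) :=
    have := isRegularLocalRing_stalk_of_smooth f x
    have := isDomain_of_isRegularLocalRing (X.presheaf.stalk x)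
    inferInstance
  exact isReduced_of_isReduced_stalk X

end FiniteTypeCharts

/-! ### Strongly dominant morphisms -/

section StronglyDominant

variable {K : Type u} [Field K] {X Y G : Over (Spec (.of K))}

theorem ringKrullDim_stalk_le_topologicalKrullDim {X : Scheme.{u}} (x : X) :
    ringKrullDim (X.presheaf.stalk x) ≤ topologicalKrullDim X := by
  obtain ⟨R, j, hj, ⟨p, rfl⟩, -⟩ := Scheme.exists_affine_mem_range_and_range_subset
    (show x ∈ (⊤ : X.Opens) from trivial)
  obtain ⟨p, _, rfl⟩ := exists_eq_specPoint p
  rw [ringKrullDim_stalk_eq_height]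
  have hR : topologicalKrullDim (Spec (.of R)) = ringKrullDim R :=
    PrimeSpectrum.topologicalKrullDim_eq_ringKrullDim R
  exact (Ideal.height_le_ringKrullDim_of_ne_top (Ideal.IsPrime.ne_top ‹_›)).trans
    (hR ▸ j.isOpenEmbedding.isInducing.topologicalKrullDim_le)

theorem eq_of_specializes_of_ringKrullDim_stalk_eq_zero {X : Scheme.{u}} {x y : X} (h : y ⤳ x)
    (hx : ringKrullDim (X.presheaf.stalk x) = 0) : y = x := by
  rw [ringKrullDim_stalk_eq_coheight] at hx
  have hmax : IsMax x := Order.coheight_eq_zero.mp (by exact_mod_cast hx)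
  exact (h.antisymm (hmax h)).eq

/-- The projection `X_K̄ ⟶ X`. -/
noncomputable def closureFst (X : Over (Spec (.of K))) :
    ((Over.pullback (specClosure K)).obj X).left ⟶ X.left :=
  Limits.pullback.fst X.hom (specClosure K)

theorem isPullback_closureFst (X : Over (Spec (.of K))) :
    IsPullback (closureFst X) ((Over.pullback (specClosure K)).obj X).hom X.hom (specClosure K) :=
  IsPullback.of_hasPullback _ _

instance (X : Over (Spec (.of K))) : Surjective (closureFst X) := by
  have : Surjective (specClosure K) := inferInstanceAs (Surjective (Spec.map _))
  exact MorphismProperty.of_isPullback (isPullback_closureFst X).flip this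

theorem map_left_closureFst (φ : X ⟶ Y) :
    ((Over.pullback (specClosure K)).map φ).left ≫ closureFst Y = closureFst X ≫ φ.left :=
  Limits.pullback.lift_fst _ _ _

theorem StronglyDominant.exists_closure_eq_univ {φ : X ⟶ G} (hφ : StronglyDominant φ)
    (x : X.left) :
    ∃ ξ : ((Over.pullback (specClosure K)).obj X).left, closureFst X ξ ⤳ x ∧
      closure {((Over.pullback (specClosure K)).map φ).left ξ} = Set.univ := by
  obtain ⟨x', rfl⟩ := (closureFst X).surjective x
  have hZ := irreducibleComponent_mem_irreducibleComponents x'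
  have hξ := isIrreducible_irreducibleComponent.isGenericPoint_genericPoint
    (isClosed_irreducibleComponent (x := x'))
  refine ⟨_, (hξ.specializes mem_irreducibleComponent).map (closureFst X).continuous, ?_⟩
  have h := hφ _ hZ
  rw [← dense_iff_closure_eq, ← dense_closure]
  refine h.mono ?_
  conv_lhs => rw [← hξ.def]
  rw [← Set.image_singleton]
  exact image_closure_subset_closure_image
    ((Over.pullback (specClosure K)).map φ).left.continuous

theorem StronglyDominant.irreducibleSpace {φ : X ⟶ G} (hφ : StronglyDominant φ) [Nonempty X.left] :
    IrreducibleSpace ((Over.pullback (specClosure K)).obj G).left := by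
  obtain ⟨ξ, -, hξ⟩ := hφ.exists_closure_eq_univ (Classical.arbitrary X.left)
  rw [irreducibleSpace_def, Set.top_eq_univ, ← hξ]
  exact isIrreducible_singleton.closure

theorem StronglyDominant.closure_apply_eq_univ {φ : X ⟶ G} (hφ : StronglyDominant φ) {x : X.left}
    (hx : ringKrullDim (X.left.presheaf.stalk x) = 0) : closure {φ.left x} = Set.univ := by
  obtain ⟨ξ, hξx, hξ⟩ := hφ.exists_closure_eq_univ x
  have hφξ : closureFst G (((Over.pullback (specClosure K)).map φ).left ξ) = φ.left x := by
    rw [← eq_of_specializes_of_ringKrullDim_stalk_eq_zero hξx hx]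
    exact congr($(map_left_closureFst φ) ξ)
  rw [← dense_iff_closure_eq] at hξ ⊢
  rw [← hφξ, ← Set.image_singleton]
  exact (closureFst G).surjective.denseRange.dense_image (closureFst G).continuous hξ

theorem StronglyDominant.formallySmooth_stalkMap [CharZero K] {φ : X ⟶ G}
    (hφ : StronglyDominant φ) [IsReduced X.left] [IsReduced G.left] [LocallyOfFiniteType X.hom]
    {x : X.left} (hx : ringKrullDim (X.left.presheaf.stalk x) = 0) :
    (φ.left.stalkMap x).hom.FormallySmooth := by
  have : LocallyOfFiniteType (φ.left ≫ G.hom) := by rw [Over.w φ]; assumption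
  have : LocallyOfFiniteType φ.left := locallyOfFiniteType_of_comp φ.left G.hom
  have hdense := hφ.closure_apply_eq_univ hx
  have : IrreducibleSpace G.left := by
    rw [irreducibleSpace_def, Set.top_eq_univ, ← hdense]
    exact isIrreducible_singleton.closure
  have hFG : IsField (G.left.presheaf.stalk (φ.left x)) :=
    isField_stalk_of_closure_mem_irreducibleComponents _ _ (by
      rw [hdense, irreducibleComponents_eq_singleton]
      rfl)
  have hFX : IsField (X.left.presheaf.stalk x) := by
    have : Ring.KrullDimLE 0 (X.left.presheaf.stalk x) :=
      Ring.krullDimLE_iff.mpr (by rw [hx]; rfl)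
    exact Ring.KrullDimLE.isField_of_isReduced
  have hft := LocallyOfFiniteType.stalkMap φ.left x
  let F := G.left.presheaf.stalk (φ.left x)
  let toF : K →+* F := (G.left.presheaf.germ ⊤ (φ.left x) trivial).hom.comp
    ((G.hom.appTop).hom.comp (Scheme.ΓSpecIso (.of K)).inv.hom)
  have : Nontrivial F := hFG.nontrivial
  have : CharZero F := charZero_of_injective_ringHom toF.injective
  algebraize [(φ.left.stalkMap x).hom]
  let := hFG.toField
  let := hFX.toField
  exact Algebra.FormallySmooth.of_perfectField

end StronglyDominant

section ProdFam

variable {K : Type u} [Field K] {G : Over (Spec (.of K))} [GrpObj G]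

theorem locallyOfFiniteType_prodFam {m : ℕ} (X : Fin m → Over (Spec (.of K)))
    (hX : ∀ i, LocallyOfFiniteType (X i).hom) : LocallyOfFiniteType (prodFam m X).hom := by
  induction m with
  | zero => exact inferInstanceAs (LocallyOfFiniteType (𝟙 _))
  | succ m ih =>
    have hX₀ := hX 0
    have := ih (fun i ↦ X i.succ) fun i ↦ hX _
    exact inferInstanceAs (LocallyOfFiniteType
      (Limits.pullback.fst (X 0).hom (prodFam m fun i ↦ X i.succ).hom ≫ (X 0).hom))

theorem smooth_prodFam {m : ℕ} (X : Fin m → Over (Spec (.of K)))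
    (hX : ∀ i, Smooth (X i).hom) : Smooth (prodFam m X).hom := by
  induction m with
  | zero => exact inferInstanceAs (Smooth (𝟙 _))
  | succ m ih =>
    have hX₀ := hX 0
    have := ih (fun i ↦ X i.succ) fun i ↦ hX _
    exact inferInstanceAs (Smooth
      (Limits.pullback.fst (X 0).hom (prodFam m fun i ↦ X i.succ).hom ≫ (X 0).hom))

theorem formallySmooth_stalkMap_convFam [CharZero K] [LocallyOfFiniteType G.hom] [IsReduced G.left]
    {m : ℕ} {X : Fin m → Over (Spec (.of K))} (φ : (i : Fin m) → (X i ⟶ G))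
    (hX : ∀ i, Smooth (X i).hom) (hφ : ∀ i, StronglyDominant (φ i))
    (z : (prodFam m X).left)
    (hz : ringKrullDim ((prodFam m X).left.presheaf.stalk z) < m) :
    ((convFam m φ).left.stalkMap z).hom.FormallySmooth := by
  induction m with
  | zero =>
    exact absurd hz (not_lt.mpr (by simpa using ringKrullDim_nonneg_of_nontrivial))
  | succ m ih =>
    let Y := prodFam m (fun i ↦ X i.succ)
    have hX₀ := hX 0
    have := isReduced_of_smooth (X 0).hom
    have : Smooth Y.hom := smooth_prodFam _ fun i ↦ hX i.succ
    have hadd := (ringKrullDim_stalk_add_le (X := X 0) (Y := Y) z).trans_lt hz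
    by_cases hx : ringKrullDim ((X 0).left.presheaf.stalk ((fst (X 0) Y).left z)) = 0
    · exact formallySmooth_stalkMap_conv_of_fst (φ 0) _ z ((hφ 0).formallySmooth_stalkMap hx)
    · refine formallySmooth_stalkMap_conv_of_snd (φ 0) _ z
        (ih (fun i ↦ φ i.succ) (fun i ↦ hX _) (fun i ↦ hφ _) _ ?_)
      rw [ringKrullDim_stalk_eq_coheight] at hx ⊢
      rw [ringKrullDim_stalk_eq_coheight, ringKrullDim_stalk_eq_coheight] at hadd
      norm_cast at hadd hx ⊢
      have hlt := (add_le_add_left (Order.one_le_iff_ne_zero.mpr hx) _).trans_lt hadd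
      rw [_root_.add_comm, Nat.cast_add, Nat.cast_one] at hlt
      exact lt_of_add_lt_add_right hlt

end ProdFam

section Surjective

variable {K : Type u} [Field K] {X Y G : Over (Spec (.of K))}

theorem exists_geometric_point [LocallyOfFiniteType G.hom] {g : G.left} (hg : IsClosed {g}) :
    ∃ l : Spec (.of (AlgebraicClosure K)) ⟶ G.left, l ≫ G.hom = specClosure K ∧ ∀ t, l t = g := by
  let G' := (Over.pullback (specClosure K)).obj G
  have : LocallyOfFiniteType G'.hom := MorphismProperty.of_isPullback (isPullback_closureFst G) ‹_›
  have := LocallyOfFiniteType.jacobsonSpace G'.hom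
  obtain ⟨g', hg', hc⟩ := nonempty_inter_closedPoints
    ((Set.singleton_nonempty g).preimage (closureFst G).surjective)
    (hg.preimage (closureFst G).continuous).isLocallyClosed
  replace hc : IsClosed {g'} := hc
  refine ⟨pointOfClosedPoint G'.hom g' hc ≫ closureFst G, ?_, fun t ↦ ?_⟩
  · rw [Category.assoc, (isPullback_closureFst G).w, ← Category.assoc]
    exact (congr($(pointOfClosedPoint_comp G'.hom g' hc) ≫ specClosure K)).trans
      (Category.id_comp _)
  · rw [Scheme.Hom.comp_apply, pointOfClosedPoint_apply]
    exact hg'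

-- Over `K̄`, the fibre of the multiplication over a closed point `g` is isomorphic to `G` through
-- either projection; in particular it is irreducible, so the preimages of `U` and `V` in it meet.
theorem exists_mul_eq_of_isOpen [GrpObj G] [LocallyOfFiniteType G.hom]
    [IrreducibleSpace ((Over.pullback (specClosure K)).obj G).left] {U V : Set G.left}
    (hU : IsOpen U) (hV : IsOpen V) (hU' : U.Nonempty) (hV' : V.Nonempty) {g : G.left}
    (hg : IsClosed {g}) :
    ∃ t : (G ⊗ G).left, (fst G G).left t ∈ U ∧ (snd G G).left t ∈ V ∧ μ[G].left t = g := by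
  obtain ⟨l, hl, hlg⟩ := exists_geometric_point hg
  have hF := IsPullback.of_hasPullback μ[G].left l
  have hs : Surjective (specClosure K) := inferInstanceAs (Surjective (Spec.map _))
  have hμ_fst := (isPullback_whiskerRight_mul (𝟙 G)).flip
  have hμ_snd := (isPullback_whiskerLeft_mul (𝟙 G)).flip
  rw [id_whiskerRight, Category.id_comp] at hμ_fst
  rw [whiskerLeft_id, Category.id_comp] at hμ_snd
  have hF_fst := hF.paste_horiz hμ_fst
  have hF_snd := hF.paste_horiz hμ_snd
  rw [hl] at hF_fst hF_snd
  let F := Limits.pullback μ[G].left l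
  let a : F ⟶ (G ⊗ G).left := Limits.pullback.fst μ[G].left l
  have : Surjective (a ≫ (fst G G).left) := MorphismProperty.of_isPullback hF_fst.flip hs
  have : Surjective (a ≫ (snd G G).left) := MorphismProperty.of_isPullback hF_snd.flip hs
  let e := hF_fst.isoIsPullback _ _ (isPullback_closureFst G)
  have : IrreducibleSpace F := e.hom.homeomorph.irreducibleSpace_iff.mpr ‹_›
  obtain ⟨w, hwU, hwV⟩ := nonempty_preirreducible_inter
    (hU.preimage (a ≫ (fst G G).left).continuous) (hV.preimage (a ≫ (snd G G).left).continuous)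
    (hU'.preimage (a ≫ (fst G G).left).surjective) (hV'.preimage (a ≫ (snd G G).left).surjective)
  exact ⟨a w, hwU, hwV, congr($hF.w w).trans (hlg _)⟩

theorem exists_ringKrullDim_stalk_eq_zero (X : Scheme.{u}) [IsReduced X] [Nonempty X] :
    ∃ x : X, ringKrullDim (X.presheaf.stalk x) = 0 := by
  let x := Classical.arbitrary X
  have hξ := isIrreducible_irreducibleComponent.isGenericPoint_genericPoint
    (isClosed_irreducibleComponent (x := x))
  exact ⟨_, ringKrullDim_eq_zero_of_isField
    (isField_stalk_of_closure_mem_irreducibleComponents X _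
      (hξ.def ▸ irreducibleComponent_mem_irreducibleComponents x))⟩

theorem isOpen_image_smoothLocus {X Y : Scheme.{u}} (f : X ⟶ Y) [LocallyOfFinitePresentation f] :
    IsOpen (f '' (f.smoothLocus : Set X)) := by
  have := smooth_ι_smoothLocus_comp f
  have h := (f.smoothLocus.ι ≫ f).isOpenMap.isOpen_range
  rwa [show Set.range (f.smoothLocus.ι ≫ f) = f '' Set.range f.smoothLocus.ι from
    Set.range_comp f f.smoothLocus.ι, Scheme.Opens.range_ι] at h

theorem exists_tensorHom_left_apply_eq {H : Over (Spec (.of K))} (φ : X ⟶ G) (ψ : Y ⟶ H)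
    (t : (G ⊗ H).left) {x : X.left} {y : Y.left} (hx : φ.left x = (fst G H).left t)
    (hy : ψ.left y = (snd G H).left t) :
    ∃ z : (X ⊗ Y).left, (fst X Y).left z = x ∧ (snd X Y).left z = y ∧ (φ ⊗ₘ ψ).left z = t := by
  obtain ⟨w, rfl, rfl⟩ := exists_preimage_of_isPullback (isPullback_whiskerRight_left φ H) x t hx
  have hw : (snd G H).left ((φ ▷ H).left w) = (snd X H).left w :=
    congr(($(show φ ▷ H ≫ snd G H = snd X H by simp)).left w)
  rw [hw] at hy
  obtain ⟨z, rfl, rfl⟩ := exists_preimage_of_isPullback (isPullback_whiskerLeft_left X ψ) y w hy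
  have hz : (fst X H).left ((X ◁ ψ).left z) = (fst X Y).left z :=
    congr(($(show X ◁ ψ ≫ fst X H = fst X Y by simp)).left z)
  refine ⟨z, hz.symm, rfl, ?_⟩
  rw [MonoidalCategory.tensorHom_def']
  rfl

theorem StronglyDominant.nonempty_image_smoothLocus [CharZero K] {φ : X ⟶ G}
    (hφ : StronglyDominant φ) [IsReduced X.left] [IsReduced G.left] [LocallyOfFiniteType X.hom]
    [LocallyOfFinitePresentation φ.left] [Nonempty X.left] :
    (φ.left '' (φ.left.smoothLocus : Set X.left)).Nonempty := by
  obtain ⟨x, hx⟩ := exists_ringKrullDim_stalk_eq_zero X.left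
  exact ⟨_, x, hφ.formallySmooth_stalkMap hx, rfl⟩

variable [GrpObj G]

theorem surjective_conv [CharZero K] [LocallyOfFiniteType G.hom] [IsReduced G.left]
    [Smooth X.hom] [Smooth Y.hom] [Nonempty X.left] [Nonempty Y.left]
    {φ : X ⟶ G} {ψ : Y ⟶ G} (hφ : StronglyDominant φ) (hψ : StronglyDominant ψ) :
    Surjective (conv φ ψ).left := by
  have := isReduced_of_smooth X.hom
  have := isReduced_of_smooth Y.hom
  have := locallyOfFinitePresentation_left φ
  have := locallyOfFinitePresentation_left ψ
  have hXY : LocallyOfFiniteType (X ⊗ Y).hom := inferInstanceAs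
    (LocallyOfFiniteType (Limits.pullback.fst X.hom Y.hom ≫ X.hom))
  have := locallyOfFinitePresentation_left (conv φ ψ)
  have := hφ.irreducibleSpace
  have := LocallyOfFiniteType.jacobsonSpace G.hom
  have himage : (conv φ ψ).left '' ((conv φ ψ).left.smoothLocus : Set (X ⊗ Y).left) =
      Set.univ := by
    rw [← Set.compl_empty_iff, ← Set.not_nonempty_iff_eq_empty]
    intro hne
    obtain ⟨g, hg, hgc⟩ := nonempty_inter_closedPoints hne
      (isOpen_image_smoothLocus (conv φ ψ).left).isClosed_compl.isLocallyClosed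
    obtain ⟨t, ⟨x, hx, hxt⟩, ⟨y, hy, hyt⟩, ht⟩ := exists_mul_eq_of_isOpen
      (isOpen_image_smoothLocus φ.left) (isOpen_image_smoothLocus ψ.left)
      hφ.nonempty_image_smoothLocus hψ.nonempty_image_smoothLocus hgc
    obtain ⟨z, rfl, rfl, rfl⟩ := exists_tensorHom_left_apply_eq φ ψ t hxt hyt
    exact hg ⟨z, formallySmooth_stalkMap_conv_of_fst φ ψ z hx, ht⟩
  refine ⟨fun g ↦ ?_⟩
  obtain ⟨z, -, hz⟩ : g ∈ _ '' _ := himage ▸ Set.mem_univ g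
  exact ⟨z, hz⟩

end Surjective

section ConvFam

variable {K : Type u} [Field K] {G : Over (Spec (.of K))} [GrpObj G]

theorem smooth_convFam_comp_hom {m : ℕ} {X : Fin m → Over (Spec (.of K))}
    {φ : (i : Fin m) → (X i ⟶ G)} (hX : ∀ i, Smooth (X i).hom) :
    Smooth ((convFam m φ).left ≫ G.hom) := by
  rw [Over.w]
  exact smooth_prodFam X hX

variable [LocallyOfFiniteType G.hom] [IsReduced G.left]

variable (G) in
theorem smooth_hom_of_isReduced [PerfectField K] : Smooth G.hom :=
  have : GrpObj (Over.mk G.hom) := ‹GrpObj G›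
  smooth_of_grpObj_of_isReduced G.hom

variable [CharZero K] {m : ℕ} {X : Fin m → Over (Spec (.of K))} {φ : (i : Fin m) → (X i ⟶ G)}
  (hX : ∀ i, Smooth (X i).hom) (hφ : ∀ i, StronglyDominant (φ i)) {n : ℕ}
  (hn : topologicalKrullDim G.left ≤ n)

include hX hφ hn

theorem flat_convFam (hnm : n ≤ m) : Flat (convFam m φ).left :=
  have := smooth_hom_of_isReduced G
  have := smooth_convFam_comp_hom (φ := φ) hX
  flat_of_forall_ringKrullDim_lt
    (fun y ↦ (ringKrullDim_stalk_le_topologicalKrullDim y).trans hn)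
    (formallySmooth_stalkMap_convFam φ hX hφ) G.hom hnm

variable {L : Type u} [Field L] {Z : Scheme.{u}} {a : Z ⟶ (prodFam m X).left}
  {b : Z ⟶ Spec (.of L)} {l : Spec (.of L) ⟶ G.left} (hZ : IsPullback a b (convFam m φ).left l)

include hZ

theorem isReduced_of_isPullback_convFam (hnm : n < m) : IsReduced Z :=
  have := smooth_hom_of_isReduced G
  have := smooth_convFam_comp_hom (φ := φ) hX
  isReduced_of_isPullback G.hom
    (fun y ↦ (ringKrullDim_stalk_le_topologicalKrullDim y).trans hn)
    (formallySmooth_stalkMap_convFam φ hX hφ) hZ hnm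

theorem isNormalScheme_of_isPullback_convFam (hnm : n + 1 < m) : IsNormalScheme Z :=
  have := smooth_hom_of_isReduced G
  have := smooth_convFam_comp_hom (φ := φ) hX
  isNormalScheme_of_isPullback G.hom
    (fun y ↦ (ringKrullDim_stalk_le_topologicalKrullDim y).trans hn)
    (formallySmooth_stalkMap_convFam φ hX hφ) hZ hnm

theorem isRegularInCodim_of_isPullback_convFam {k : ℕ} (hnm : n + k < m) :
    IsRegularInCodim Z k :=
  have := smooth_hom_of_isReduced G
  have := smooth_convFam_comp_hom (φ := φ) hX
  isRegularInCodim_of_isPullback G.hom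
    (fun y ↦ (ringKrullDim_stalk_le_topologicalKrullDim y).trans hn)
    (formallySmooth_stalkMap_convFam φ hX hφ) hZ hnm

omit hZ

theorem isNormalMorphism_convFam (hnm : n + 1 < m) : IsNormalMorphism (convFam m φ).left :=
  ⟨flat_convFam hX hφ hn (by lia), geometrically_iff_forall_fiberToSpecResidueField.mp
    fun _ _ _ _ _ _ hZ ↦ isNormalScheme_of_isPullback_convFam hX hφ hn hZ hnm⟩

end ConvFam

theorem exists_topologicalKrullDim_eq_and_add_le {X : Scheme.{u}} [Nonempty X] {k m : ℕ}
    (h : topologicalKrullDim X + k ≤ m) : ∃ n : ℕ, topologicalKrullDim X = n ∧ n + k ≤ m := by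
  have hnonneg : 0 ≤ topologicalKrullDim X :=
    have : Nonempty (TopologicalSpace.IrreducibleCloseds X) :=
      ⟨⟨closure {Classical.arbitrary X}, isIrreducible_singleton.closure, isClosed_closure⟩⟩
    Order.krullDim_nonneg
  generalize topologicalKrullDim X = d at h hnonneg
  induction d with
  | bot => simp at hnonneg
  | coe d =>
    induction d with
    | top =>
      refine absurd ((le_add_of_nonneg_right (Nat.cast_nonneg k)).trans h) ?_
      exact_mod_cast (ENat.natCast_lt_top m).not_ge
    | coe d => exact ⟨d, rfl, by exact_mod_cast h⟩

/-! ### Sharpness -/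

section FlatLocal

open IsLocalRing

variable {A B C : Type u} [CommRing A] [CommRing B] [CommRing C] [IsLocalRing A] [IsLocalRing B]
  [IsNoetherianRing A]

theorem ringKrullDim_add_le_of_flat [IsLocalRing C] [IsNoetherianRing B] {f : B →+* A}
    [IsLocalHom f] (hf : f.Flat) {π : A →+* C} (hπ : Function.Surjective π)
    (hπf : ∀ b ∈ maximalIdeal B, π (f b) = 0) :
    ringKrullDim B + ringKrullDim C ≤ ringKrullDim A := by
  let := f.toAlgebra
  have : Module.Flat B A := hf
  have : (maximalIdeal A).LiesOver (maximalIdeal B) :=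
    ⟨(((local_hom_TFAE f).out 0 4).mp ‹IsLocalHom f› :
      (maximalIdeal A).comap f = maximalIdeal B).symm⟩
  let I := (maximalIdeal B).map (algebraMap B A)
  have hI : I ≤ RingHom.ker π := Ideal.map_le_iff_le_comap.mpr fun b hb ↦ hπf b hb
  have hI' : I ≠ ⊤ := fun h ↦ RingHom.ker_ne_top π (top_le_iff.mp (h ▸ hI))
  have : Nontrivial (A ⧸ I) := Ideal.Quotient.nontrivial_iff.mpr hI'
  have : IsLocalRing (A ⧸ I) := .of_surjective' _ Ideal.Quotient.mk_surjective
  have hC : ringKrullDim C ≤ ringKrullDim (A ⧸ I) :=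
    ringKrullDim_le_of_surjective (Ideal.Quotient.lift I π hI)
      (Ideal.Quotient.lift_surjective_of_surjective I hI hπ)
  have hmap : (maximalIdeal A).map (Ideal.Quotient.mk I) = maximalIdeal (A ⧸ I) :=
    IsLocalRing.map_maximalIdeal_of_surjective _ Ideal.Quotient.mk_surjective
  rw [← maximalIdeal_height_eq_ringKrullDim (R := A),
    Ideal.height_eq_height_add_of_liesOver_of_hasGoingDown (maximalIdeal B) (maximalIdeal A),
    WithBot.coe_add]
  refine add_le_add maximalIdeal_height_eq_ringKrullDim.ge (hC.trans ?_)
  rw [← maximalIdeal_height_eq_ringKrullDim, ← hmap]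

theorem ringKrullDim_le_of_ker_le_sq [IsRegularLocalRing C] {π : A →+* C}
    (hπ : Function.Surjective π) (hker : RingHom.ker π ≤ maximalIdeal A ^ 2) :
    ringKrullDim A ≤ ringKrullDim C := by
  obtain ⟨d, v, hv, hd⟩ := exists_fin_generators_maximalIdeal C
  choose w hw using fun i ↦ hπ (v i)
  let J := Ideal.span (Set.range w)
  have : IsLocalHom π := hπ.isLocalHom
  have hJ : J.map π = maximalIdeal C := by
    rw [Ideal.map_span, ← Set.range_comp, ← hv]
    exact congr_arg _ (congr_arg _ (funext hw))
  have hle : maximalIdeal A ≤ J := by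
    refine Submodule.le_of_le_smul_of_le_jacobson_bot (I := maximalIdeal A)
      (IsNoetherian.noetherian _) (maximalIdeal_le_jacobson _) fun x hx ↦ ?_
    have hx' : π x ∈ J.map π := by
      rw [hJ]
      exact fun h ↦ hx ((isUnit_map_iff π x).mp h)
    obtain ⟨j, hj, hjx⟩ := (Ideal.mem_map_iff_of_surjective π hπ).mp hx'
    have hxj : x - j ∈ maximalIdeal A ^ 2 := hker (by simp [RingHom.mem_ker, hjx])
    rw [← add_sub_cancel j x]
    refine add_mem (Submodule.mem_sup_left hj) (Submodule.mem_sup_right ?_)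
    rwa [smul_eq_mul, ← sq]
  have hJm : J ≤ maximalIdeal A := by
    rw [Ideal.span_le]
    rintro _ ⟨i, rfl⟩
    have hvi : v i ∈ maximalIdeal C := hv ▸ Ideal.subset_span ⟨i, rfl⟩
    exact fun h ↦ hvi (hw i ▸ h.map π)
  have hspan : (maximalIdeal A).spanFinrank ≤ d := by
    rw [le_antisymm hle hJm]
    refine (Submodule.spanFinrank_span_le_ncard_of_finite (Set.finite_range w)).trans ?_
    rw [← Set.image_univ]
    simpa using Set.ncard_image_le (f := w) Set.finite_univ
  rw [← hd]
  exact (ringKrullDim_le_spanFinrank_maximalIdeal A).trans (by exact_mod_cast hspan)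

-- Flatness forces `dim C ≤ dim A - dim B < dim A`, whereas `A` and `C` have the same embedding
-- dimension because `ker π ≤ 𝔪²`.
theorem not_isRegularLocalRing_of_flat [IsLocalRing C] [IsNoetherianRing B] {f : B →+* A}
    [IsLocalHom f] (hf : f.Flat) {π : A →+* C} (hπ : Function.Surjective π)
    (hπf : ∀ b ∈ maximalIdeal B, π (f b) = 0) (hker : RingHom.ker π ≤ maximalIdeal A ^ 2)
    {n k : ℕ} (hn : 0 < n) (hB : n ≤ ringKrullDim B) (hA : ringKrullDim A ≤ (n + k : ℕ)) :
    ringKrullDim C ≤ k ∧ ¬ IsRegularLocalRing C := by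
  have hle : n + ringKrullDim C ≤ ringKrullDim A :=
    (add_le_add_left hB (ringKrullDim C)).trans (ringKrullDim_add_le_of_flat hf hπ hπf)
  have : IsNoetherianRing C := isNoetherianRing_of_surjective A C π hπ
  obtain ⟨c, hc⟩ : ∃ c : ℕ, ringKrullDim C = c := by
    obtain ⟨hbot, htop⟩ := finiteRingKrullDim_iff_ne_bot_and_top.mp
      (inferInstance : FiniteRingKrullDim C)
    obtain ⟨c, hc⟩ := WithBot.ne_bot_iff_exists.mp hbot
    rw [← hc] at htop
    obtain ⟨c, rfl⟩ := ENat.ne_top_iff_exists.mp fun h ↦ htop congr(↑$h)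
    exact ⟨c, hc.symm⟩
  rw [hc] at hle ⊢
  refine ⟨?_, fun hC ↦ ?_⟩
  · have hnc := hle.trans hA
    norm_cast at hnc ⊢
    lia
  · have hnc := hle.trans (ringKrullDim_le_of_ker_le_sq hπ hker)
    rw [hc] at hnc
    norm_cast at hnc
    lia

end FlatLocal

section Fibre

variable {X Y Z : Scheme.{u}} {f : X ⟶ Y} {y : Y} {a : Z ⟶ X} {b : Z ⟶ Spec (Y.residueField y)}

theorem isField_stalk_Spec {k : Type u} [Field k] (x : Spec (.of k)) :
    IsField ((Spec (.of k)).presheaf.stalk x) := by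
  obtain ⟨p, _, rfl⟩ := exists_eq_specPoint x
  refine (stalkEquivLocalization (𝟙 (Spec (.of k))) p).toMulEquiv.isField ?_
  exact (RingEquiv.ofBijective _ (Field.localization_map_bijective (Kₘ := Localization.AtPrime p)
    (M := p.primeCompl) (by simp))).symm.toMulEquiv.isField (Field.toIsField k)

theorem stalkMap_eq_zero_of_field {k : Type u} [Field k] (g : Spec (.of k) ⟶ Y) (t : Spec (.of k))
    {s : Y.presheaf.stalk (g t)} (hs : s ∈ IsLocalRing.maximalIdeal _) : g.stalkMap t s = 0 := by
  by_contra hne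
  obtain ⟨r, hr⟩ := (isField_stalk_Spec t).mul_inv_cancel hne
  exact hs ((isUnit_map_iff (g.stalkMap t).hom s).mp (IsUnit.of_mul_eq_one r hr))

theorem stalkMap_eq_zero_of_isPullback (hZ : IsPullback a b f (Y.fromSpecResidueField y)) (q : Z)
    (s : Y.presheaf.stalk (f (a q))) (hs : s ∈ IsLocalRing.maximalIdeal _) :
    a.stalkMap q (f.stalkMap (a q) s) = 0 := by
  let g : Spec (Y.residueField y) ⟶ Y := Y.fromSpecResidueField y
  have hfactor : ∀ h : Z ⟶ Y, h = b ≫ g →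
      ∀ s ∈ IsLocalRing.maximalIdeal (Y.presheaf.stalk (h q)), h.stalkMap q s = 0 := by
    rintro _ rfl s hs
    rw [Scheme.Hom.stalkMap_comp]
    have hgs : g.stalkMap (b q) s = 0 := stalkMap_eq_zero_of_field (s := s) g (b q) hs
    exact (congr_arg (b.stalkMap q) hgs).trans (map_zero _)
  have hzero := hfactor (a ≫ f) hZ.w s hs
  rwa [Scheme.Hom.stalkMap_comp] at hzero

theorem exists_SpecMap_comp_fromSpecStalk_eq {R : CommRingCat.{u}} [IsLocalRing R]
    (w : Spec R ⟶ Z) {q : Z} (hq : w (IsLocalRing.closedPoint R) = q) :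
    ∃ ψ : Z.presheaf.stalk q ⟶ R, Spec.map ψ ≫ Z.fromSpecStalk q = w := by
  subst hq
  exact ⟨_, Scheme.Spec_stalkClosedPointTo_fromSpecStalk w⟩

theorem SpecMap_comp_fromSpecStalk_closedPoint {x : X} {R : CommRingCat.{u}} [IsLocalRing R]
    (χ : X.presheaf.stalk x ⟶ R) [IsLocalHom χ.hom] :
    (Spec.map χ ≫ X.fromSpecStalk x) (IsLocalRing.closedPoint R) = x :=
  (congr_arg (X.fromSpecStalk x) (Spec_closedPoint (f := χ))).trans Scheme.fromSpecStalk_closedPoint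

theorem ker_stalkMap_le_of_isPreimmersion [IsPreimmersion a] (q : Z)
    {I : Ideal (X.presheaf.stalk (a q))} (hI : I ≠ ⊤)
    {w : Spec (.of (X.presheaf.stalk (a q) ⧸ I)) ⟶ Z}
    (hw : w ≫ a = Spec.map (CommRingCat.ofHom (Ideal.Quotient.mk I)) ≫ X.fromSpecStalk (a q)) :
    RingHom.ker (a.stalkMap q).hom ≤ I := by
  have : Nontrivial (X.presheaf.stalk (a q) ⧸ I) := Ideal.Quotient.nontrivial_iff.mpr hI
  have : IsLocalRing (X.presheaf.stalk (a q) ⧸ I) := .of_surjective' _ Ideal.Quotient.mk_surjective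
  let c : Spec (.of (X.presheaf.stalk (a q) ⧸ I)) := IsLocalRing.closedPoint _
  have hwq : w c = q := by
    refine a.isEmbedding.injective ?_
    rw [← Scheme.Hom.comp_apply, hw]
    have : IsLocalHom (CommRingCat.ofHom (Ideal.Quotient.mk I)).hom :=
      Ideal.Quotient.mk_surjective.isLocalHom
    exact SpecMap_comp_fromSpecStalk_closedPoint _
  obtain ⟨ψ, hψ⟩ := exists_SpecMap_comp_fromSpecStalk_eq w hwq
  have hmk : CommRingCat.ofHom (Ideal.Quotient.mk I) = a.stalkMap q ≫ ψ := by
    apply Spec.map_injective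
    rw [← cancel_mono (X.fromSpecStalk (a q)), Spec.map_comp, Category.assoc,
      Scheme.SpecMap_stalkMap_fromSpecStalk, reassoc_of% hψ, hw]
  intro s hs
  rw [← Ideal.Quotient.eq_zero_iff_mem]
  exact congr($hmk s).trans ((congr_arg ψ hs).trans (map_zero ψ.hom))

theorem ker_stalkMap_le_of_isPullback (hZ : IsPullback a b f (Y.fromSpecResidueField y)) (q : Z)
    (I : Ideal (X.presheaf.stalk (a q))) (hI : I ≠ ⊤)
    (hfI : ∀ s ∈ IsLocalRing.maximalIdeal (Y.presheaf.stalk (f (a q))), f.stalkMap (a q) s ∈ I) :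
    RingHom.ker (a.stalkMap q).hom ≤ I := by
  obtain rfl : f (a q) = y := by
    have hw := congr($hZ.w q)
    rwa [Scheme.Hom.comp_apply, Scheme.Hom.comp_apply, Scheme.fromSpecResidueField_apply] at hw
  let r : IsLocalRing.ResidueField (Y.presheaf.stalk (f (a q))) →+* X.presheaf.stalk (a q) ⧸ I :=
    Ideal.Quotient.lift _ ((Ideal.Quotient.mk I).comp (f.stalkMap (a q)).hom) fun s hs ↦
      Ideal.Quotient.eq_zero_iff_mem.mpr (hfI s hs)
  have hr : (Spec.map (CommRingCat.ofHom (Ideal.Quotient.mk I)) ≫ X.fromSpecStalk (a q)) ≫ f =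
      Spec.map (CommRingCat.ofHom r : Y.residueField (f (a q)) ⟶ .of _) ≫
        Y.fromSpecResidueField (f (a q)) := by
    rw [Category.assoc, ← Scheme.SpecMap_stalkMap_fromSpecStalk, Scheme.fromSpecResidueField,
      ← Spec.map_comp_assoc]
    refine Eq.trans ?_ (Spec.map_comp_assoc (Y.residue (f (a q))) (CommRingCat.ofHom r) _)
    rfl
  have : IsPreimmersion a := MorphismProperty.of_isPullback hZ.flip inferInstance
  exact ker_stalkMap_le_of_isPreimmersion q hI (hZ.lift_fst _ _ hr)

end Fibre

section AffineGroup

variable {K : Type u} [Field K] (σ : Type u)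

/-- Affine space over a field, as an object over the spectrum of that field. -/
noncomputable def affineSpace (K : Type u) [Field K] (σ : Type u) : Over (Spec (.of K)) :=
  Over.mk (𝔸(σ; Spec (.of K)) ↘ Spec (.of K))

variable {σ} {T T' : Over (Spec (.of K))}

/-- The coordinate functions of a morphism to affine space. -/
noncomputable def coords (f : T ⟶ affineSpace K σ) (i : σ) : Γ(T.left, ⊤) :=
  f.left.appTop (AffineSpace.coord (Spec (.of K)) i)

/-- The morphism to affine space with given coordinate functions. -/
noncomputable def ofCoords (v : σ → Γ(T.left, ⊤)) : T ⟶ affineSpace K σ :=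
  Over.homMk (AffineSpace.homOfVector T.hom v) (AffineSpace.homOfVector_over _ _)

theorem coords_ofCoords (v : σ → Γ(T.left, ⊤)) (i : σ) : coords (ofCoords v) i = v i :=
  AffineSpace.homOfVector_appTop_coord _ _ _

theorem coords_comp (g : T' ⟶ T) (f : T ⟶ affineSpace K σ) (i : σ) :
    coords (g ≫ f) i = g.left.appTop (coords f i) := rfl

theorem hom_ext_coords {f g : T ⟶ affineSpace K σ} (h : ∀ i, coords f i = coords g i) : f = g :=
  Over.OverMorphism.ext (AffineSpace.hom_ext ((Over.w f).trans (Over.w g).symm) h)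

theorem coords_comp_ofCoords (g : T' ⟶ T) (v : σ → Γ(T.left, ⊤)) (i : σ) :
    coords (g ≫ ofCoords v) i = g.left.appTop (v i) :=
  (coords_comp _ _ _).trans (congr_arg _ (coords_ofCoords v i))

theorem coords_comp_add (h : T' ⟶ T) (f g : T ⟶ affineSpace K σ) (i : σ) :
    coords (h ≫ ofCoords (coords f + coords g)) i = coords (h ≫ f) i + coords (h ≫ g) i :=
  (coords_comp_ofCoords _ _ _).trans (map_add h.left.appTop.hom _ _)

theorem coords_comp_neg (h : T' ⟶ T) (f : T ⟶ affineSpace K σ) (i : σ) :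
    coords (h ≫ ofCoords (-coords f)) i = -coords (h ≫ f) i :=
  (coords_comp_ofCoords _ _ _).trans (map_neg h.left.appTop.hom _)

theorem coords_comp_zero (h : T' ⟶ T) (i : σ) :
    coords (h ≫ (ofCoords 0 : T ⟶ affineSpace K σ)) i = 0 :=
  (coords_comp_ofCoords _ _ _).trans (map_zero h.left.appTop.hom)

/-- The additive group structure on affine space. -/
noncomputable instance : GrpObj (affineSpace K σ) where
  one := ofCoords 0
  mul := ofCoords (coords (fst _ _) + coords (snd _ _))
  inv := ofCoords (-coords (𝟙 _))
  one_mul := hom_ext_coords fun i ↦ by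
    rw [coords_comp_add, whiskerRight_fst, whiskerRight_snd, coords_comp_zero, zero_add,
      leftUnitor_hom]
  mul_one := hom_ext_coords fun i ↦ by
    rw [coords_comp_add, whiskerLeft_fst, whiskerLeft_snd, coords_comp_zero, add_zero,
      rightUnitor_hom]
  mul_assoc := hom_ext_coords fun i ↦ by
    rw [coords_comp_add, whiskerRight_fst, whiskerRight_snd, coords_comp_add, ← Category.assoc,
      coords_comp_add, Category.assoc, whiskerLeft_fst, Category.assoc, whiskerLeft_snd,
      ← Category.assoc, coords_comp_add, associator_hom_fst, Category.assoc, Category.assoc,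
      associator_hom_snd_fst, associator_hom_snd_snd, _root_.add_assoc]
  left_inv := hom_ext_coords fun i ↦ by
    rw [coords_comp_add, lift_fst, lift_snd, ← Category.id_comp (ofCoords _), coords_comp_neg,
      Category.comp_id, neg_add_cancel, coords_comp_zero]
  right_inv := hom_ext_coords fun i ↦ by
    rw [coords_comp_add, lift_fst, lift_snd, ← Category.id_comp (ofCoords _), coords_comp_neg,
      Category.comp_id, add_neg_cancel, coords_comp_zero]

theorem coords_one (i : σ) : coords η[affineSpace K σ] i = 0 := coords_ofCoords _ _

theorem coords_conv (f : T ⟶ affineSpace K σ) (g : T' ⟶ affineSpace K σ) (i : σ) :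
    coords (conv f g) i = (fst T T').left.appTop (coords f i) +
      (snd T T').left.appTop (coords g i) := by
  rw [← coords_comp, ← coords_comp]
  refine (coords_comp_add _ _ _ _).trans ?_
  rw [tensorHom_fst, tensorHom_snd]

variable (K) (σ)

theorem isConnectedAlgebraicGroup_affineSpace [Finite σ] :
    IsConnectedAlgebraicGroup (affineSpace K σ) where
  nonempty := inferInstanceAs (Nonempty 𝔸(σ; Spec (.of K)))
  isReduced := inferInstanceAs (IsReduced 𝔸(σ; Spec (.of K)))
  isSeparated := inferInstanceAs (IsSeparated (𝔸(σ; Spec (.of K)) ↘ Spec (.of K)))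
  locallyOfFiniteType := inferInstanceAs (LocallyOfFiniteType (𝔸(σ; Spec (.of K)) ↘ Spec (.of K)))
  quasiCompact := inferInstanceAs (QuasiCompact (𝔸(σ; Spec (.of K)) ↘ Spec (.of K)))
  connected := inferInstanceAs (ConnectedSpace 𝔸(σ; Spec (.of K)))

theorem topologicalKrullDim_affineSpace [Finite σ] :
    topologicalKrullDim (affineSpace K σ).left = Nat.card σ := by
  refine (Scheme.homeoOfIso
    (AffineSpace.SpecIso σ (.of K))).isHomeomorph.topologicalKrullDim_eq.trans ?_
  refine (PrimeSpectrum.topologicalKrullDim_eq_ringKrullDim (MvPolynomial σ K)).trans ?_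
  rw [MvPolynomial.ringKrullDim_of_isNoetherianRing, ringKrullDim_eq_zero_of_field, zero_add]

end AffineGroup

section SquareMap

open Classical in
/-- The endomorphism `x ↦ (x₀² x_i)_i` of affine space, where `x₀` is the coordinate at `i₀` and
the factor `x_{i₀}` is omitted. -/
noncomputable def sqMap (K : Type u) [Field K] {σ : Type u} (i₀ : σ) :
    affineSpace K σ ⟶ affineSpace K σ :=
  ofCoords fun i ↦ coords (𝟙 (affineSpace K σ)) i₀ ^ 2 *
    Function.update (coords (𝟙 (affineSpace K σ))) i₀ 1 i

variable {K : Type u} [Field K] {σ : Type u} (i₀ : σ) {T : Over (Spec (.of K))}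

open Classical in
theorem coords_comp_sqMap (f : T ⟶ affineSpace K σ) (i : σ) :
    coords (f ≫ sqMap K i₀) i = coords f i₀ ^ 2 * Function.update (coords f) i₀ 1 i := by
  refine (coords_comp_ofCoords _ _ _).trans ?_
  refine (map_mul f.left.appTop.hom _ _).trans ?_
  rw [map_pow]
  congr 1
  by_cases hi : i = i₀
  · subst hi
    rw [Function.update_self, Function.update_self, map_one]
  · rw [Function.update_of_ne hi, Function.update_of_ne hi]
    rfl

theorem nonempty_basicOpen_coord :
    (((affineSpace K σ).left.basicOpen (coords (𝟙 (affineSpace K σ)) i₀) :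
      (affineSpace K σ).left.Opens) : Set (affineSpace K σ).left).Nonempty := by
  let f : 𝟙_ (Over (Spec (.of K))) ⟶ affineSpace K σ := ofCoords 1
  let x : Spec (.of K) := Classical.arbitrary _
  refine ⟨f.left x, ?_⟩
  have htop :
      f.left ⁻¹ᵁ (affineSpace K σ).left.basicOpen (coords (𝟙 (affineSpace K σ)) i₀) = ⊤ := by
    rw [Scheme.preimage_basicOpen_top]
    refine (congr_arg _ ((coords_comp f (𝟙 _) i₀).symm.trans ?_)).trans (Scheme.basicOpen_one _)
    rw [Category.comp_id]
    exact coords_ofCoords _ _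
  exact htop.ge (trivial : x ∈ (⊤ : (Spec (.of K)).Opens))

open Classical in
theorem exists_comp_sqMap_eq {L : Type u} [Field L] [IsAlgClosed L]
    (p : Spec (.of L) ⟶ Spec (.of K)) (b : Over.mk p ⟶ affineSpace K σ) (hb : coords b i₀ ≠ 0) :
    ∃ a, a ≫ sqMap K i₀ = b := by
  let e : Γ(Spec (.of L), ⊤) ≃+* L := (Scheme.ΓSpecIso (.of L)).commRingCatIsoToRingEquiv
  obtain ⟨z, hz⟩ := IsAlgClosed.exists_pow_nat_eq (e (coords b i₀)) (n := 2) (by simp)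
  have hb' : e (coords b i₀) ≠ 0 := (map_ne_zero_iff e e.injective).mpr hb
  refine ⟨ofCoords (T := Over.mk p) fun i ↦ e.symm
    (if i = i₀ then z else e (coords b i) / e (coords b i₀)), hom_ext_coords fun i ↦ ?_⟩
  rw [coords_comp_sqMap, coords_ofCoords, if_pos rfl]
  apply e.injective
  refine (map_mul e _ _).trans ?_
  rw [map_pow, e.apply_symm_apply, hz]
  by_cases hi : i = i₀
  · subst hi
    rw [Function.update_self, map_one, _root_.mul_one]
  · rw [Function.update_of_ne hi, coords_ofCoords, if_neg hi, e.apply_symm_apply]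
    field_simp

variable (K σ) in
theorem irreducibleSpace_pullback_affineSpace :
    IrreducibleSpace ((Over.pullback (specClosure K)).obj (affineSpace K σ)).left := by
  have hirr : GeometricallyIrreducible (affineSpace K σ).hom :=
    inferInstanceAs (GeometricallyIrreducible (𝔸(σ; Spec (.of K)) ↘ Spec (.of K)))
  exact hirr.geometrically_irreducibleSpace _ _ _ (isPullback_closureFst (affineSpace K σ))

theorem exists_comp_pullback_sqMap_eq {L : Type u} [Field L] [IsAlgClosed L]
    (g : Spec (.of L) ⟶ ((Over.pullback (specClosure K)).obj (affineSpace K σ)).left)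
    (x : Spec (.of L))
    (hx : g x ∈ closureFst (affineSpace K σ) ⁻¹ᵁ
      (affineSpace K σ).left.basicOpen (coords (𝟙 (affineSpace K σ)) i₀)) :
    ∃ a, a ≫ ((Over.pullback (specClosure K)).map (sqMap K i₀)).left = g := by
  let A := affineSpace K σ
  let A' := (Over.pullback (specClosure K)).obj A
  let p : Spec (.of L) ⟶ Spec (.of K) := g ≫ A'.hom ≫ specClosure K
  have hp : (g ≫ closureFst A) ≫ A.hom = p := by
    rw [Category.assoc, (isPullback_closureFst A).w]
  let b : Over.mk p ⟶ A := Over.homMk (g ≫ closureFst A) hp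
  have hb : coords b i₀ ≠ 0 := by
    intro hzero
    have hxb : x ∈ (g ≫ closureFst A) ⁻¹ᵁ A.left.basicOpen (coords (𝟙 A) i₀) := hx
    have hgzero : (g ≫ closureFst A).appTop (coords (𝟙 A) i₀) = 0 := hzero
    rw [Scheme.preimage_basicOpen_top, hgzero, Scheme.basicOpen_zero] at hxb
    exact hxb
  obtain ⟨a, ha⟩ := exists_comp_sqMap_eq i₀ p b hb
  have haA : a.left ≫ A.hom = (g ≫ A'.hom) ≫ specClosure K := by
    rw [Over.w a, Category.assoc]
    rfl
  refine ⟨(isPullback_closureFst A).lift a.left (g ≫ A'.hom) haA,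
    (isPullback_closureFst A).hom_ext ?_ ?_⟩
  · rw [Category.assoc, map_left_closureFst, (isPullback_closureFst A).lift_fst_assoc]
    exact congr_arg CommaMorphism.left ha
  · rw [Category.assoc, Over.w, (isPullback_closureFst A).lift_snd]

-- The image contains the dense open set where the coordinate at `i₀` does not vanish.
theorem stronglyDominant_sqMap : StronglyDominant (sqMap K i₀) := by
  intro Z hZ
  let A := affineSpace K σ
  let A' := (Over.pullback (specClosure K)).obj A
  have : IrreducibleSpace A'.left := irreducibleSpace_pullback_affineSpace K σ
  obtain rfl : Z = Set.univ := by
    rw [irreducibleComponents_eq_singleton] at hZ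
    exact hZ
  let U := closureFst A ⁻¹ᵁ A.left.basicOpen (coords (𝟙 A) i₀)
  have hU : (U : Set A'.left).Nonempty := by
    obtain ⟨x, hx⟩ := nonempty_basicOpen_coord (K := K) i₀
    obtain ⟨y, rfl⟩ := (closureFst A).surjective x
    exact ⟨y, hx⟩
  refine (U.isOpen.dense hU).mono fun y hy ↦ ?_
  let κ := A'.left.residueField y
  let L := AlgebraicClosure κ
  let g : Spec (.of L) ⟶ A'.left :=
    Spec.map (CommRingCat.ofHom (algebraMap κ L)) ≫ A'.left.fromSpecResidueField y
  let x : Spec (.of L) := Classical.arbitrary _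
  have hg : g x = y := by
    rw [Scheme.Hom.comp_apply, Scheme.fromSpecResidueField_apply]
  obtain ⟨a, ha⟩ := exists_comp_pullback_sqMap_eq i₀ g x (hg.symm ▸ hy)
  exact ⟨a x, trivial, by rw [← Scheme.Hom.comp_apply, ha, hg]⟩

end SquareMap

section Polynomial

open MvPolynomial

theorem height_mvPolynomial_of_isMaximal {k : Type*} [Field k] {τ : Type*} [Finite τ]
    (P : Ideal (MvPolynomial τ k)) [P.IsMaximal] : P.height = Nat.card τ := by
  revert P
  induction τ using Finite.induction_empty_option with
  | of_equiv e H =>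
    intro P _
    let e' := (renameEquiv k e).toRingEquiv
    have : (P.comap e').IsMaximal := Ideal.comap_isMaximal_of_surjective _ e'.surjective
    rw [← RingEquiv.height_comap e', H, Nat.card_congr e]
  | h_empty =>
    intro P _
    have hle := Ideal.height_le_ringKrullDim_of_ne_top (I := P) (Ideal.IsPrime.ne_top inferInstance)
    rw [ringKrullDim_of_isNoetherianRing, ringKrullDim_eq_zero_of_field, zero_add] at hle
    rw [Nat.card_of_isEmpty] at hle ⊢
    exact le_antisymm (by exact_mod_cast hle) zero_le
  | @h_option α _ IH =>
    intro P _
    let e' := (optionEquivLeft k α).symm.toRingEquiv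
    have : (P.comap e').IsMaximal := Ideal.comap_isMaximal_of_surjective _ e'.surjective
    let p := (P.comap e').comap Polynomial.C
    have : p.IsMaximal := Polynomial.isMaximal_comap_C_of_isJacobsonRing _
    have : (P.comap e').LiesOver p := ⟨rfl⟩
    rw [← RingEquiv.height_comap e', Polynomial.height_eq_height_add_one p, IH]
    simp

theorem ker_mvPolynomial_constantCoeff {k : Type*} [CommRing k] {τ : Type*} :
    RingHom.ker (constantCoeff : MvPolynomial τ k →+* k) = Ideal.span (Set.range X) := by
  refine le_antisymm (fun f hf ↦ ?_) ?_
  · rw [← Set.image_univ, mem_ideal_span_X_image]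
    intro m hm
    by_contra! hzero
    obtain rfl : m = 0 := Finsupp.ext fun i ↦ hzero i trivial
    exact mem_support_iff.mp hm hf
  · rw [Ideal.span_le]
    rintro _ ⟨i, rfl⟩
    exact constantCoeff_X (σ := τ) (R := k) i

theorem eq_ker_constantCoeff_of_X_mem {k : Type*} [Field k] {τ : Type*}
    {P : Ideal (MvPolynomial τ k)} (hPtop : P ≠ ⊤) (hP : ∀ i, X i ∈ P) :
    P = RingHom.ker constantCoeff := by
  have : (RingHom.ker (constantCoeff : MvPolynomial τ k →+* k)).IsMaximal :=
    RingHom.ker_isMaximal_of_surjective _ fun c ↦ ⟨C c, constantCoeff_C τ c⟩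
  refine (this.eq_of_le hPtop ?_).symm
  rw [ker_mvPolynomial_constantCoeff, Ideal.span_le]
  rintro _ ⟨i, rfl⟩
  exact hP i

end Polynomial

section Germs

variable {X Y : Scheme.{u}}

theorem germ_appTop_mem_pow (f : X ⟶ Y) (x : X) (s : Γ(Y, ⊤)) {k : ℕ}
    (hs : Y.presheaf.germ ⊤ (f x) trivial s ∈
      IsLocalRing.maximalIdeal (Y.presheaf.stalk (f x)) ^ k) :
    X.presheaf.germ ⊤ x trivial (f.appTop s) ∈
      IsLocalRing.maximalIdeal (X.presheaf.stalk x) ^ k := by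
  have hmap := Ideal.mem_map_of_mem (f.stalkMap x).hom hs
  rw [Ideal.map_pow] at hmap
  have hle : (IsLocalRing.maximalIdeal _).map (f.stalkMap x).hom ≤ IsLocalRing.maximalIdeal _ :=
    ((IsLocalRing.local_hom_TFAE (f.stalkMap x).hom).out 0 2).mp
      (inferInstance : IsLocalHom (f.stalkMap x).hom)
  exact Eq.mp (congr_arg (· ∈ _) (Scheme.Hom.germ_stalkMap_apply f ⊤ x trivial s))
    (Ideal.pow_right_mono hle k hmap)

theorem germ_specPoint_mem_maximalIdeal_iff {R : Type u} [CommRing R] (j : Spec (.of R) ⟶ X)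
    (p : Ideal R) [p.IsPrime] (s : Γ(X, ⊤)) (r : R)
    (h : j.appTop s = (Scheme.ΓSpecIso (.of R)).inv r) :
    X.presheaf.germ ⊤ (j (specPoint p)) trivial s ∈ IsLocalRing.maximalIdeal _ ↔ r ∈ p := by
  rw [IsLocalRing.mem_maximalIdeal, mem_nonunits_iff, ← Scheme.mem_basicOpen_top]
  change ¬ specPoint p ∈ j ⁻¹ᵁ (X.basicOpen s) ↔ r ∈ p
  rw [Scheme.preimage_basicOpen_top, h, basicOpen_eq_of_affine]
  exact not_not

theorem stalkEquivLocalization_germ {R : Type u} [CommRing R] (j : Spec (.of R) ⟶ X)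
    [IsOpenImmersion j] (p : Ideal R) [p.IsPrime] (s : Γ(X, ⊤)) (r : R)
    (h : j.appTop s = (Scheme.ΓSpecIso (.of R)).inv r) :
    stalkEquivLocalization j p (X.presheaf.germ ⊤ (j (specPoint p)) trivial s) =
      algebraMap R (Localization.AtPrime p) r := by
  have hgerm : j.stalkMap (specPoint p) (X.presheaf.germ ⊤ (j (specPoint p)) trivial s) =
      (Spec (.of R)).presheaf.germ ⊤ (specPoint p) trivial ((Scheme.ΓSpecIso (.of R)).inv r) :=
    (Scheme.Hom.germ_stalkMap_apply j ⊤ (specPoint p) trivial s).trans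
      (congr_arg ((Spec (.of R)).presheaf.germ ⊤ (specPoint p) trivial) h)
  have halg := congr($(Spec.algebraMap_stalkIso_inv (R := .of R) (x := specPoint p)) r)
  refine (congr_arg (Spec.stalkIso (.of R) (specPoint p)).hom (hgerm.trans halg.symm)).trans ?_
  exact (Spec.stalkIso (.of R) (specPoint p)).inv_hom_id_apply (algebraMap R _ r)

theorem maximalIdeal_eq_span_germ {R : Type u} [CommRing R] (j : Spec (.of R) ⟶ X)
    [IsOpenImmersion j] (p : Ideal R) [p.IsPrime] {τ : Type*} (s : τ → Γ(X, ⊤))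
    (r : τ → R) (hp : p = Ideal.span (Set.range r))
    (h : ∀ i, j.appTop (s i) = (Scheme.ΓSpecIso (.of R)).inv (r i)) :
    IsLocalRing.maximalIdeal (X.presheaf.stalk (j (specPoint p))) =
      Ideal.span (Set.range fun i ↦ X.presheaf.germ ⊤ (j (specPoint p)) trivial (s i)) := by
  let e := stalkEquivLocalization j p
  have he (i) : e.symm (algebraMap R _ (r i)) =
      X.presheaf.germ ⊤ (j (specPoint p)) trivial (s i) := by
    rw [RingEquiv.symm_apply_eq]
    exact (stalkEquivLocalization_germ j p _ _ (h i)).symm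
  have hspan : Ideal.span (Set.range fun i ↦ algebraMap R (Localization.AtPrime p) (r i)) =
      IsLocalRing.maximalIdeal _ := by
    rw [← Localization.AtPrime.map_eq_maximalIdeal]
    conv_rhs => enter [2]; rw [hp]
    rw [Ideal.map_span, ← Set.range_comp]
    rfl
  rw [← IsLocalRing.map_maximalIdeal_of_surjective
    (e.symm : Localization.AtPrime p →+* X.presheaf.stalk (j (specPoint p))) e.symm.surjective,
    ← hspan, Ideal.map_span, ← Set.range_comp]
  exact congr_arg _ (congr_arg _ (funext he))

end Germs

section AffineSpace

variable {K : Type u} [Field K] {σ : Type u} [Finite σ]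

theorem ringKrullDim_stalk_of_germ_coord_mem (y : (affineSpace K σ).left)
    (hy : ∀ i, (affineSpace K σ).left.presheaf.germ ⊤ y trivial (coords (𝟙 _) i) ∈
      IsLocalRing.maximalIdeal _) :
    ringKrullDim ((affineSpace K σ).left.presheaf.stalk y) = Nat.card σ ∧
      IsLocalRing.maximalIdeal ((affineSpace K σ).left.presheaf.stalk y) =
        Ideal.span (Set.range fun i ↦
          (affineSpace K σ).left.presheaf.germ ⊤ y trivial (coords (𝟙 _) i)) := by
  let j : Spec (.of (MvPolynomial σ K)) ⟶ (affineSpace K σ).left :=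
    (AffineSpace.SpecIso σ (.of K)).inv
  have hj (i : σ) : j.appTop (coords (𝟙 (affineSpace K σ)) i) =
      (Scheme.ΓSpecIso (.of (MvPolynomial σ K))).inv (MvPolynomial.X i) :=
    AffineSpace.SpecIso_inv_appTop_coord _ _
  have : IsOpenImmersion j := inferInstanceAs
    (IsOpenImmersion (AffineSpace.SpecIso σ (.of K)).inv)
  have hsurj : Function.Surjective j := (AffineSpace.SpecIso σ (.of K)).inv.surjective
  obtain ⟨p, rfl⟩ := hsurj y
  obtain ⟨P, _, rfl⟩ := exists_eq_specPoint p
  have hP : P = RingHom.ker MvPolynomial.constantCoeff :=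
    eq_ker_constantCoeff_of_X_mem (Ideal.IsPrime.ne_top ‹_›) fun i ↦
      (germ_specPoint_mem_maximalIdeal_iff j P _ _ (hj i)).mp (hy i)
  have : P.IsMaximal := hP ▸
    RingHom.ker_isMaximal_of_surjective _ fun c ↦ ⟨.C c, MvPolynomial.constantCoeff_C σ c⟩
  refine ⟨?_, ?_⟩
  · rw [ringKrullDim_stalk_eq_height, height_mvPolynomial_of_isMaximal]
    rfl
  · rw [ker_mvPolynomial_constantCoeff] at hP
    exact maximalIdeal_eq_span_germ j P _ _ hP hj

theorem exists_germ_coord_mem (i : σ) : ∃ x : (affineSpace K σ).left,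
    ringKrullDim ((affineSpace K σ).left.presheaf.stalk x) ≤ 1 ∧
      (affineSpace K σ).left.presheaf.germ ⊤ x trivial (coords (𝟙 _) i) ∈
        IsLocalRing.maximalIdeal _ := by
  let j : Spec (.of (MvPolynomial σ K)) ⟶ (affineSpace K σ).left :=
    (AffineSpace.SpecIso σ (.of K)).inv
  have hj : j.appTop (coords (𝟙 (affineSpace K σ)) i) =
      (Scheme.ΓSpecIso (.of (MvPolynomial σ K))).inv (MvPolynomial.X i) :=
    AffineSpace.SpecIso_inv_appTop_coord _ _
  have : IsOpenImmersion j := inferInstanceAs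
    (IsOpenImmersion (AffineSpace.SpecIso σ (.of K)).inv)
  let I : Ideal (MvPolynomial σ K) := Ideal.span {MvPolynomial.X i}
  have hI : I ≠ ⊤ := by
    rw [Ne, Ideal.span_singleton_eq_top]
    intro hunit
    simpa using hunit.map (MvPolynomial.constantCoeff (R := K) (σ := σ))
  obtain ⟨P, hP⟩ := Ideal.nonempty_minimalPrimes hI
  have := hP.isPrime
  refine ⟨j (specPoint P), ?_, (germ_specPoint_mem_maximalIdeal_iff j P _ _ hj).mpr
    (hP.1.2 (Ideal.mem_span_singleton_self _))⟩
  rw [ringKrullDim_stalk_eq_height]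
  exact_mod_cast Ideal.height_le_one_of_isPrincipal_of_mem_minimalPrimes I P hP

omit [Finite σ] in
theorem germ_coords_sqMap_mem (i₀ : σ) (x : (affineSpace K σ).left)
    (hx : (affineSpace K σ).left.presheaf.germ ⊤ x trivial (coords (𝟙 _) i₀) ∈
      IsLocalRing.maximalIdeal _) (i : σ) :
    (affineSpace K σ).left.presheaf.germ ⊤ x trivial (coords (sqMap K i₀) i) ∈
      IsLocalRing.maximalIdeal _ ^ 2 := by
  have hcoord := coords_comp_sqMap i₀ (𝟙 (affineSpace K σ)) i
  rw [Category.id_comp] at hcoord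
  rw [hcoord, map_mul, map_pow]
  exact Ideal.mul_mem_right _ _ (Ideal.pow_mem_pow hx 2)

theorem exists_germ_coords_convPow_mem (i₀ : σ) (d : ℕ) :
    ∃ p : (prodFam d fun _ ↦ affineSpace K σ).left,
      ringKrullDim ((prodFam d fun _ ↦ affineSpace K σ).left.presheaf.stalk p) ≤ d ∧
      ∀ i, (prodFam d fun _ ↦ affineSpace K σ).left.presheaf.germ ⊤ p trivial
        (coords (convPow (sqMap K i₀) d) i) ∈ IsLocalRing.maximalIdeal _ ^ 2 := by
  induction d with
  | zero =>
    let p : Spec (.of K) := Classical.arbitrary _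
    refine ⟨p, (ringKrullDim_eq_zero_of_isField (isField_stalk_Spec p)).le, fun i ↦ ?_⟩
    have hzero : coords (convPow (sqMap K i₀) 0) i = 0 := coords_one i
    rw [hzero, map_zero]
    exact zero_mem _
  | succ d ih =>
    obtain ⟨p, hp, hpi⟩ := ih
    obtain ⟨x, hx, hxi⟩ := exists_germ_coord_mem (K := K) i₀
    have : LocallyOfFiniteType (affineSpace K σ).hom :=
      (isConnectedAlgebraicGroup_affineSpace K σ).locallyOfFiniteType
    have : LocallyOfFiniteType (prodFam d fun _ ↦ affineSpace K σ).hom :=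
      locallyOfFiniteType_prodFam _ fun _ ↦ this
    obtain ⟨z, rfl, rfl, hz⟩ := exists_ringKrullDim_stalk_le_add x p
    refine ⟨z, (hz.trans (add_le_add hx hp)).trans_eq ?_, fun i ↦ ?_⟩
    · push_cast
      exact _root_.add_comm _ _
    · have hcoord : coords (convPow (sqMap K i₀) (d + 1)) i =
          (fst (affineSpace K σ) (prodFam d fun _ ↦ affineSpace K σ)).left.appTop
            (coords (sqMap K i₀) i) +
          (snd (affineSpace K σ) (prodFam d fun _ ↦ affineSpace K σ)).left.appTop
            (coords (convPow (sqMap K i₀) d) i) := coords_conv _ _ _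
      rw [hcoord]
      refine (map_add ((prodFam (d + 1) fun _ ↦ affineSpace K σ).left.presheaf.germ
        ⊤ z trivial).hom _ _).symm ▸ add_mem ?_ (germ_appTop_mem_pow _ _ _ (hpi i))
      refine germ_appTop_mem_pow _ _ _ ?_
      exact germ_coords_sqMap_mem i₀ _ hxi i

end AffineSpace

section LowDimension

variable {R : Type*} [CommRing R] [IsLocalRing R] [IsNoetherianRing R]

theorem isRegularLocalRing_of_isReduced [_root_.IsReduced R]
    (h : ringKrullDim R ≤ 0) : IsRegularLocalRing R := by
  have : Ring.KrullDimLE 0 R := Ring.krullDimLE_iff.mpr h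
  have hm : IsLocalRing.maximalIdeal R = ⊥ := by
    rw [← Ring.KrullDimLE.nilradical_eq_maximalIdeal, nilradical_eq_zero, Submodule.zero_eq_bot]
  have := (IsLocalRing.isField_iff_maximalIdeal_eq.mpr hm).isDomain
  have : IsPrincipalIdealRing R :=
    ((tfae_of_isNoetherianRing_of_isLocalRing_of_isDomain R).out 0 4).mpr
      (hm ▸ (inferInstance : (⊥ : Ideal R).IsPrincipal))
  infer_instance

theorem isRegularLocalRing_of_isIntegrallyClosed [IsDomain R] [IsIntegrallyClosed R]
    (h : ringKrullDim R ≤ 1) : IsRegularLocalRing R := by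
  have : Ring.KrullDimLE 1 R := Ring.krullDimLE_iff.mpr h
  have hR : IsIntegrallyClosed R ∧
      ∀ P : Ideal R, P ≠ ⊥ → P.IsPrime → P = IsLocalRing.maximalIdeal R :=
    ⟨inferInstance, fun P hP hP' ↦ IsLocalRing.eq_maximalIdeal (hP'.isMaximal_of_ne_bot hP)⟩
  have : IsPrincipalIdealRing R :=
    ((tfae_of_isNoetherianRing_of_isLocalRing_of_isDomain R).out 0 3).mpr hR
  infer_instance

end LowDimension

section Sharpness

variable {K : Type u} [Field K] {σ : Type u} [Finite σ]

theorem exists_stalkMap_convPow_mem (i₀ : σ) (d : ℕ) :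
    ∃ p : (prodFam d fun _ ↦ affineSpace K σ).left,
      ringKrullDim ((prodFam d fun _ ↦ affineSpace K σ).left.presheaf.stalk p) ≤ d ∧
      ringKrullDim ((affineSpace K σ).left.presheaf.stalk ((convPow (sqMap K i₀) d).left p)) =
        Nat.card σ ∧
      ∀ s ∈ IsLocalRing.maximalIdeal
        ((affineSpace K σ).left.presheaf.stalk ((convPow (sqMap K i₀) d).left p)),
        (convPow (sqMap K i₀) d).left.stalkMap p s ∈ IsLocalRing.maximalIdeal _ ^ 2 := by
  obtain ⟨p, hp, hpi⟩ := exists_germ_coords_convPow_mem (K := K) i₀ d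
  let Φ := (convPow (sqMap K i₀) d).left
  have hΦ (i : σ) : Φ.stalkMap p
      ((affineSpace K σ).left.presheaf.germ ⊤ (Φ p) trivial (coords (𝟙 _) i)) ∈
        IsLocalRing.maximalIdeal _ ^ 2 :=
    Eq.mp (congr_arg (· ∈ _) (Scheme.Hom.germ_stalkMap_apply Φ ⊤ p trivial _).symm) (hpi i)
  obtain ⟨hdim, hspan⟩ := ringKrullDim_stalk_of_germ_coord_mem (Φ p) fun i h ↦
    Ideal.pow_le_self two_ne_zero (hΦ i) (h.map (Φ.stalkMap p).hom)
  refine ⟨p, hp, hdim, fun s hs ↦ ?_⟩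
  have hle : IsLocalRing.maximalIdeal ((affineSpace K σ).left.presheaf.stalk (Φ p)) ≤
      (IsLocalRing.maximalIdeal _ ^ 2).comap (Φ.stalkMap p).hom := by
    rw [hspan, Ideal.span_le]
    rintro _ ⟨i, rfl⟩
    exact hΦ i
  exact hle hs

variable (K σ) in
theorem isLocallyNoetherian_affineSpace : IsLocallyNoetherian (affineSpace K σ).left := by
  have := (isConnectedAlgebraicGroup_affineSpace K σ).locallyOfFiniteType
  exact LocallyOfFiniteType.isLocallyNoetherian (affineSpace K σ).hom

variable (K σ) in
theorem isLocallyNoetherian_prodFam_affineSpace (d : ℕ) :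
    IsLocallyNoetherian (prodFam d fun _ ↦ affineSpace K σ).left := by
  have := locallyOfFiniteType_prodFam (m := d) (fun _ ↦ affineSpace K σ) fun _ ↦
    (isConnectedAlgebraicGroup_affineSpace K σ).locallyOfFiniteType
  exact LocallyOfFiniteType.isLocallyNoetherian (prodFam d fun _ ↦ affineSpace K σ).hom

theorem not_flat_convPow_sqMap (i₀ : σ) {d : ℕ} (hd : d < Nat.card σ) :
    ¬ Flat (convPow (sqMap K i₀) d).left := by
  intro hflat
  obtain ⟨p, hp, hy, -⟩ := exists_stalkMap_convPow_mem (K := K) i₀ d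
  have := isLocallyNoetherian_affineSpace K σ
  have := isLocallyNoetherian_prodFam_affineSpace K σ d
  have hheight := height_comap_le_of_flat
    (Flat.stalkMap (convPow (sqMap K i₀) d).left p) (IsLocalRing.maximalIdeal _)
  rw [IsLocalRing.maximalIdeal_comap, ← WithBot.coe_le_coe,
    IsLocalRing.maximalIdeal_height_eq_ringKrullDim,
    IsLocalRing.maximalIdeal_height_eq_ringKrullDim, hy] at hheight
  exact hd.not_ge (by exact_mod_cast hheight.trans hp)

variable (K σ) in
theorem smooth_affineSpace [PerfectField K] : Smooth (affineSpace K σ).hom := by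
  have hG := isConnectedAlgebraicGroup_affineSpace K σ
  have := hG.isReduced
  have := hG.locallyOfFiniteType
  exact smooth_hom_of_isReduced (affineSpace K σ)

theorem flat_convPow_sqMap [CharZero K] (i₀ : σ) {d : ℕ} (hd : Nat.card σ ≤ d) :
    Flat (convPow (sqMap K i₀) d).left := by
  have hG := isConnectedAlgebraicGroup_affineSpace K σ
  have := hG.isReduced
  have := hG.locallyOfFiniteType
  exact flat_convFam (fun _ ↦ smooth_affineSpace K σ) (fun _ ↦ stronglyDominant_sqMap i₀)
    (topologicalKrullDim_affineSpace K σ).le hd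

theorem exists_not_isRegularLocalRing_fiber [CharZero K] (i₀ : σ) (k : ℕ) :
    ∃ (y : (affineSpace K σ).left) (q : (convPow (sqMap K i₀) (Nat.card σ + k)).left.fiber y),
      ringKrullDim (((convPow (sqMap K i₀) (Nat.card σ + k)).left.fiber y).presheaf.stalk q) ≤ k ∧
      IsNoetherianRing
        (((convPow (sqMap K i₀) (Nat.card σ + k)).left.fiber y).presheaf.stalk q) ∧
      ¬ IsRegularLocalRing
        (((convPow (sqMap K i₀) (Nat.card σ + k)).left.fiber y).presheaf.stalk q) := by
  obtain ⟨p, hp, hdim, hsq⟩ := exists_stalkMap_convPow_mem (K := K) i₀ (Nat.card σ + k)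
  let Φ := (convPow (sqMap K i₀) (Nat.card σ + k)).left
  have hflat : Flat Φ := flat_convPow_sqMap i₀ (Nat.le_add_right _ k)
  generalize hy : Φ p = y
  obtain ⟨q, rfl⟩ : p ∈ Set.range (Φ.fiberι y) := by
    rw [Φ.range_fiberι]
    exact hy
  have := isLocallyNoetherian_affineSpace K σ
  have := isLocallyNoetherian_prodFam_affineSpace K σ (Nat.card σ + k)
  have hZ : IsPullback (Φ.fiberι y) (Φ.fiberToSpecResidueField y) Φ
    ((affineSpace K σ).left.fromSpecResidueField y) := .of_hasPullback _ _
  have hπ : Function.Surjective ((Φ.fiberι y).stalkMap q).hom :=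
    (Φ.fiberι y).stalkMap_surjective q
  have hker := ker_stalkMap_le_of_isPullback hZ q (IsLocalRing.maximalIdeal _ ^ 2)
    (ne_top_of_le_ne_top (Ideal.IsPrime.ne_top inferInstance) (Ideal.pow_le_self two_ne_zero)) hsq
  have hflatstalk : (Φ.stalkMap (Φ.fiberι y q)).hom.Flat := Flat.stalkMap Φ _
  have : Nonempty σ := ⟨i₀⟩
  obtain ⟨hle, hreg⟩ := not_isRegularLocalRing_of_flat hflatstalk hπ
    (stalkMap_eq_zero_of_isPullback hZ q) hker Nat.card_pos hdim.ge hp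
  exact ⟨y, q, hle, isNoetherianRing_of_surjective _ _ _ hπ, hreg⟩

theorem exists_not_isRegularInCodim_fiber [CharZero K] (i₀ : σ) (k : ℕ) :
    ∃ y, ¬ IsRegularInCodim ((convPow (sqMap K i₀) (Nat.card σ + k)).left.fiber y) k := by
  obtain ⟨y, q, hdim, -, hreg⟩ := exists_not_isRegularLocalRing_fiber (K := K) i₀ k
  exact ⟨y, fun h ↦ hreg (h q hdim)⟩

theorem exists_not_isReduced_fiber [CharZero K] (i₀ : σ) :
    ∃ y, ¬ IsReduced ((convPow (sqMap K i₀) (Nat.card σ)).left.fiber y) := by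
  obtain ⟨y, q, hdim, _, hreg⟩ := exists_not_isRegularLocalRing_fiber (K := K) i₀ 0
  exact ⟨y, fun _ ↦ hreg (isRegularLocalRing_of_isReduced (by exact_mod_cast hdim))⟩

theorem exists_not_isNormalScheme_fiber [CharZero K] (i₀ : σ) :
    ∃ y, ¬ IsNormalScheme ((convPow (sqMap K i₀) (Nat.card σ + 1)).left.fiber y) := by
  obtain ⟨y, q, hdim, _, hreg⟩ := exists_not_isRegularLocalRing_fiber (K := K) i₀ 1
  refine ⟨y, fun hnormal ↦ ?_⟩
  obtain ⟨_, _⟩ := hnormal q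
  exact hreg (isRegularLocalRing_of_isIntegrallyClosed (by exact_mod_cast hdim))

end Sharpness

theorem exists_sharp_convPow (K : Type u) [Field K] [CharZero K] {n : ℕ} (hn : 1 ≤ n) :
    ∃ (G : Over (Spec (.of K))) (_ : GrpObj G) (X : Over (Spec (.of K))) (φ : X ⟶ G),
      IsConnectedAlgebraicGroup G ∧ topologicalKrullDim G.left = n ∧ IsSmoothVariety X ∧
      StronglyDominant φ ∧
      (∀ d < n, ¬ Flat (convPow φ d).left) ∧
      (∃ y, ¬ IsReduced ((convPow φ n).left.fiber y)) ∧
      (∃ y, ¬ IsNormalScheme ((convPow φ (n + 1)).left.fiber y)) ∧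
      (∀ k : ℕ, ∃ y, ¬ IsRegularInCodim ((convPow φ (n + k)).left.fiber y) k) := by
  let σ := ULift.{u} (Fin n)
  let i₀ : σ := ⟨⟨0, hn⟩⟩
  have hσ : Nat.card σ = n := by rw [Nat.card_ulift, Nat.card_fin]
  have hG := isConnectedAlgebraicGroup_affineSpace K σ
  have hdim := topologicalKrullDim_affineSpace K σ
  have hreduced := exists_not_isReduced_fiber (K := K) i₀
  have hnormal := exists_not_isNormalScheme_fiber (K := K) i₀
  have hregular := exists_not_isRegularInCodim_fiber (K := K) i₀
  rw [hσ] at hdim hreduced hnormal hregular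
  exact ⟨affineSpace K σ, inferInstance, affineSpace K σ, sqMap K i₀, hG, hdim,
    ⟨hG.toIsVariety, smooth_affineSpace K σ⟩, stronglyDominant_sqMap i₀,
    fun d hd ↦ not_flat_convPow_sqMap i₀ (hσ.symm ▸ hd), hreduced, hnormal, hregular⟩

end AlgConv

theorem theoremB_general {K : Type u} [Field K] [CharZero K] {m : ℕ}
    {X : Fin m → Over (Spec (.of K))} {G : Over (Spec (.of K))} [GrpObj G] [IsReduced G.left]
    [LocallyOfFiniteType G.hom] {φ : (i : Fin m) → (X i ⟶ G)} (hX : ∀ i, Smooth (X i).hom)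
    (hX' : ∀ i, Nonempty (X i).left) (hφ : ∀ i, AlgConv.StronglyDominant (φ i)) :
    (∀ i j, Surjective (AlgConv.conv (φ i) (φ j)).left) ∧
    (topologicalKrullDim G.left ≤ m → Flat (AlgConv.convFam m φ).left) ∧
    (topologicalKrullDim G.left + 1 ≤ m →
      Flat (AlgConv.convFam m φ).left ∧
      ∀ y, IsReduced ((AlgConv.convFam m φ).left.fiber y)) ∧
    (topologicalKrullDim G.left + 2 ≤ m →
      AlgConv.IsNormalMorphism (AlgConv.convFam m φ).left) ∧
    (∀ k : ℕ, 2 < k → topologicalKrullDim G.left + k ≤ m →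
      AlgConv.IsNormalMorphism (AlgConv.convFam m φ).left ∧
      ∀ y, AlgConv.IsRegularInCodim ((AlgConv.convFam m φ).left.fiber y) (k - 1)) := by
  have : Nonempty G.left := ⟨η[G].left (IsLocalRing.closedPoint K)⟩
  have hdim {k : ℕ} := AlgConv.exists_topologicalKrullDim_eq_and_add_le (X := G.left) (k := k)
    (m := m)
  refine ⟨fun i j ↦ AlgConv.surjective_conv (hφ i) (hφ j),
    fun h ↦ AlgConv.flat_convFam hX hφ h le_rfl, fun h ↦ ?_, fun h ↦ ?_, fun k hk h ↦ ?_⟩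
  · obtain ⟨n, hn, hnm⟩ := hdim h
    exact ⟨AlgConv.flat_convFam hX hφ hn.le (by lia), fun y ↦
      AlgConv.isReduced_of_isPullback_convFam hX hφ hn.le (.of_hasPullback _ _) hnm⟩
  · obtain ⟨n, hn, hnm⟩ := hdim h
    exact AlgConv.isNormalMorphism_convFam hX hφ hn.le hnm
  · obtain ⟨n, hn, hnm⟩ := hdim h
    exact ⟨AlgConv.isNormalMorphism_convFam hX hφ hn.le (by lia), fun y ↦
      AlgConv.isRegularInCodim_of_isPullback_convFam hX hφ hn.le (.of_hasPullback _ _)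
        (k := k - 1) (by lia)⟩

theorem theoremB (K : Type u) [Field K] [CharZero K] :
    (∀ (m : ℕ) (X : Fin m → Over (Spec (.of K))) (G : Over (Spec (.of K))) [GrpObj G]
        (φ : (i : Fin m) → (X i ⟶ G)),
      (∀ i, AlgConv.IsSmoothVariety (X i)) →
      AlgConv.IsConnectedAlgebraicGroup G →
      (∀ i, AlgConv.StronglyDominant (φ i)) →
        (∀ i j, Surjective (AlgConv.conv (φ i) (φ j)).left) ∧
        (topologicalKrullDim G.left ≤ m → Flat (AlgConv.convFam m φ).left) ∧
        (topologicalKrullDim G.left + 1 ≤ m →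
          Flat (AlgConv.convFam m φ).left ∧
          ∀ y, IsReduced ((AlgConv.convFam m φ).left.fiber y)) ∧
        (topologicalKrullDim G.left + 2 ≤ m →
          AlgConv.IsNormalMorphism (AlgConv.convFam m φ).left) ∧
        (∀ k : ℕ, 2 < k → topologicalKrullDim G.left + k ≤ m →
          AlgConv.IsNormalMorphism (AlgConv.convFam m φ).left ∧
          ∀ y, AlgConv.IsRegularInCodim ((AlgConv.convFam m φ).left.fiber y) (k - 1))) ∧
    (∀ n : ℕ, 1 ≤ n →
      ∃ (G : Over (Spec (.of K))) (_ : GrpObj G) (X : Over (Spec (.of K))) (φ : X ⟶ G),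
        AlgConv.IsConnectedAlgebraicGroup G ∧
        topologicalKrullDim G.left = n ∧
        AlgConv.IsSmoothVariety X ∧
        AlgConv.StronglyDominant φ ∧
        (∀ d < n, ¬ Flat (AlgConv.convPow φ d).left) ∧
        (∃ y, ¬ IsReduced ((AlgConv.convPow φ n).left.fiber y)) ∧
        (∃ y, ¬ AlgConv.IsNormalScheme ((AlgConv.convPow φ (n + 1)).left.fiber y)) ∧
        (∀ k : ℕ, ∃ y,
          ¬ AlgConv.IsRegularInCodim ((AlgConv.convPow φ (n + k)).left.fiber y) k)) := by
  refine ⟨fun m X G _ φ hX hG hφ ↦ ?_, fun n hn ↦ AlgConv.exists_sharp_convPow K hn⟩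
  have := hG.isReduced
  have := hG.locallyOfFiniteType
  exact theoremB_general (fun i ↦ (hX i).smooth) (fun i ↦ (hX i).nonempty) hφ
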